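/- Let $F$ be a number field with adele ring $\mathbb{A}_F = F_\infty\times\mathbb{A}_F^\infty$, let $D$ be a (finite-dimensional) central division algebra over $F$, and put $D_{\mathbb{A}_F}=D\otimes_F\mathbb{A}_F$, $D_{\infty}=D\otimes_F F_\infty$, $D_{\mathbb{A}_F^\infty}=D\otimes_F\mathbb{A}_F^\infty$, with reduced trace $\mathrm{trd}:D_{\mathbb{A}_F}\to\mathbb{A}_F$. For $m\ge 1$ let $\mathcal{S}(D_{\mathbb{A}_F}^m)$ be the space of finite sums of functions $x\mapsto f_\infty(x_\infty)f^\infty(x^\infty)$, where $f_\infty$ is a Schwartz function on the real vector space $D_\infty^m$ and $f^\infty$ is a locally constant compactly supported function on $D_{\mathbb{A}_F^\infty}^m$. Let $\psi:F\backslash\mathbb{A}_F\to\mathbb{C}^\times$ be a nontrivial continuous additive character, and let $dx$ be the Haar measure on $D_{\mathbb{A}_F}$ that is self-dual with respect to $\psi$, i.e. Fourier inversion holds on $\mathcal{S}(D_{\mathbb{A}_F})$ for the Fourier transform $\mathcal{F}(f)(y)=\int_{D_{\mathbb{A}_F}} f(x)\psi(\mathrm{trd}(yx))\,dx$. For $\Phi\in\mathcal{S}(D_{\mathbb{A}_F}^2)$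 let $$\mathcal{F}_2(\Phi)(x,y)=\int_{D_{\mathbb{A}_F}}\Phi(x,z)\psi(\mathrm{trd}(yz))\,dz .$$ Let $A_{\mathbb{G}_m}$ be the image of the diagonal embedding $\mathbb{R}_{>0}\to F_\infty^\times$, viewed as a group of central elements of $D_{\mathbb{A}_F}^\times$ (with components $1$ at all finite places), and let $|Q|=\prod_{v\mid\infty}|Q|_v$ be the adelic norm of $Q\in A_{\mathbb{G}_m}$, where $|\cdot|_v$ is the normalized absolute value. For $\alpha\in D$ let $\delta_\alpha=1$ if $\alpha=0$ and $\delta_\alpha=0$ otherwise. Let $\Phi\in\mathcal{S}(D_{\mathbb{A}_F}^2)$. Assume that $\Phi(t,0)=0$ for all $t\in D_{\mathbb{A}_F}$ and that $\mathcal{F}_2(\Phi)(0,0)\ne 0$. Then for all $Q\in A_{\mathbb{G}_m}$ and all $\alpha\in D$ $$b_{\Phi,Q}\,\delta_\alpha=\frac{1}{|Q|^{\dim_F D}}\sum_{\delta\in D^\times}\left(\Phi\left(\frac{\alpha\delta^{-1}}{Q},\frac{\delta}{Q}\right)-\Phi\left(\frac{\delta}{Q},\frac{\delta^{-1}\alpha}{Q}\right)\right),\qquad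 b_{\Phi,Q}:=\sum_{\delta\in D}\mathcal{F}_2(\Phi)(0,Q\delta),$$ where both sums converge absolutely, and for every real $N\ge 0$ $$b_{\Phi,Q}=\mathcal{F}_2(\Phi)(0,0)+O_{N,\Phi}(|Q|^{-N})\qquad (Q\in A_{\mathbb{G}_m}).$$ Moreover, there is a constant $R$ (independent of $\alpha$ and $N$) such that for all $Q\in A_{\mathbb{G}_m}$ with $|Q|\ge R$ one has $b_{\Phi,Q}\neq 0$ and, with $c_{\Phi,Q}:=b_{\Phi,Q}^{-1}$, for all $\alpha\in D$ $$\delta_\alpha=\frac{c_{\Phi,Q}}{|Q|^{\dim_F D}}\sum_{\delta\in D^\times}\left(\Phi\left(\frac{\alpha\delta^{-1}}{Q},\frac{\delta}{Q}\right)-\Phi\left(\frac{\delta}{Q},\frac{\delta^{-1}\alpha}{Q}\right)\right),$$ and for every real $N\ge 0$ $$c_{\Phi,Q}=\frac{1}{\mathcal{F}_2(\Phi)(0,0)}+O_{N,\Phi}(|Q|^{-N})\qquad (|Q|\ge R).$$ -/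

import Mathlib

open MeasureTheory NumberField TensorProduct
open scoped SchwartzMap NumberField.AdeleRing

noncomputable section

namespace NonabelianDelta

section RealStructure

variable (F : Type*) [Field F] [NumberField F]

/-- `F_∞ = ∏_{v ∣ ∞} F_v` is an `ℝ`-algebra: each `F_v` is canonically an extension of `ℝ`.
The structure map is the diagonal embedding `ℝ → F_∞`. -/
instance : Algebra ℝ (InfiniteAdeleRing F) :=
  RingHom.toAlgebra (((InfiniteAdeleRing.ringEquiv_mixedSpace F).symm.toRingHom).comp
    (algebraMap ℝ (mixedEmbedding.mixedSpace F)))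

instance : SMulCommClass F ℝ (InfiniteAdeleRing F) where
  smul_comm a r x := by
    simp only [Algebra.smul_def]
    exact mul_left_comm _ _ _

/-- For `q > 0`, the element `Q` of `A_{𝔾_m}` given by `q`, viewed as an adele: every archimedean
component is `q`, every finite component is `1`. -/
def realIdele (q : ℝ) : 𝔸[F] :=
  ((algebraMap ℝ (InfiniteAdeleRing F) q, 1) : InfiniteAdeleRing F × 𝔸ᶠ[F])

/-- The adelic norm `|Q| = ∏_v |Q|_v` of the element `Q` of `A_{𝔾_m}` given by `q`, where `|·|_v`
is the normalized absolute value (the square of the usual one at complex places); the finite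
places contribute `1`. -/
def ideleNorm (q : ℝ) : ℝ := ‖algebraMap ℝ (InfiniteAdeleRing F) q‖

end RealStructure

section ReducedTrace

variable (F : Type*) [Field F] (D : Type*) [Ring D] [Algebra F D]

/-- The reduced trace `trd : D → F` of a central simple algebra of dimension `d²` over a field of
characteristic `0`: the trace of left multiplication divided by `d`. By `reducedTrace_of_splitting`
it is the matrix trace in every splitting. -/
def reducedTrace : D →ₗ[F] F :=
  ((Nat.sqrt (Module.finrank F D) : F))⁻¹ • (LinearMap.trace F D ∘ₗ LinearMap.mul F D)

theorem matrix_trace_mulLeft (K : Type*) [Field K] (n : ℕ) (M : Matrix (Fin n) (Fin n) K) :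
    LinearMap.trace K _ (LinearMap.mulLeft K M) = n * M.trace := by
  rw [LinearMap.trace_eq_matrix_trace K (Matrix.stdBasis K (Fin n) (Fin n))]
  simp only [Matrix.trace, Matrix.diag_apply, LinearMap.toMatrix_apply]
  rw [Fintype.sum_prod_type]
  have h : ∀ i j, ((Matrix.stdBasis K (Fin n) (Fin n)).repr
      (LinearMap.mulLeft K M (Matrix.stdBasis K (Fin n) (Fin n) (i, j)))) (i, j) = M i i := by
    intro i j
    rw [Matrix.stdBasis_eq_single]
    have : ∀ (N : Matrix (Fin n) (Fin n) K),
        (Matrix.stdBasis K (Fin n) (Fin n)).repr N (i, j) = N i j := by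
      intro N
      simp [Matrix.stdBasis]
    rw [this]
    simp [Matrix.mul_apply, Matrix.single_apply]
  simp only [h]
  simp [Finset.mul_sum]

/-- The defining property of the reduced trace: it becomes the matrix trace under every splitting
of `D` over every extension of `F`. -/
theorem reducedTrace_of_splitting [CharZero F] [FiniteDimensional F D]
    (K : Type*) [Field K] [Algebra F K] (n : ℕ) (hn : n ≠ 0)
    (φ : K ⊗[F] D ≃ₐ[K] Matrix (Fin n) (Fin n) K) (x : D) :
    algebraMap F K (reducedTrace F D x) = (φ (1 ⊗ₜ x)).trace := by
  have hdim : Module.finrank F D = n * n := by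
    rw [← Module.finrank_baseChange (R := K), φ.toLinearEquiv.finrank_eq]
    simp [Module.finrank_matrix]
  have hK : CharZero K := charZero_of_injective_algebraMap (algebraMap F K).injective
  have hconj : φ.toLinearEquiv.conj ((LinearMap.mul F D x).baseChange K)
      = LinearMap.mulLeft K (φ (1 ⊗ₜ x)) := by
    have h1 : (LinearMap.mul F D x).baseChange K = LinearMap.mulLeft K ((1 : K) ⊗ₜ[F] x) := by
      ext y
      simp
    rw [h1]
    ext y : 1
    simp [LinearEquiv.conj_apply]
  have h := matrix_trace_mulLeft K n (φ (1 ⊗ₜ x))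
  rw [← hconj, LinearMap.trace_conj', LinearMap.trace_baseChange] at h
  have hn' : (n : K) ≠ 0 := Nat.cast_ne_zero.mpr hn
  simp only [reducedTrace, hdim, Nat.sqrt_eq, LinearMap.smul_apply, LinearMap.comp_apply,
    smul_eq_mul, map_mul, map_inv₀, map_natCast, h]
  field_simp

end ReducedTrace

section AdelicAlgebra

variable (F : Type*) [Field F] [NumberField F] (D : Type*) [Ring D] [Algebra F D]

/-- `D_𝔸 = 𝔸_F ⊗_F D`. -/
abbrev AdelicAlg := 𝔸[F] ⊗[F] D

/-- `D_∞ = F_∞ ⊗_F D`, a real vector space. -/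
abbrev InfAlg := InfiniteAdeleRing F ⊗[F] D

/-- `D_{𝔸^∞} = 𝔸_F^∞ ⊗_F D`. -/
abbrev FinAlg := 𝔸ᶠ[F] ⊗[F] D

/-- The topology on `D_𝔸`: the product topology of `𝔸_F^n` in any `F`-basis of `D`. -/
instance : TopologicalSpace (AdelicAlg F D) := moduleTopology 𝔸[F] (AdelicAlg F D)

instance : MeasurableSpace (AdelicAlg F D) := borel _

instance : BorelSpace (AdelicAlg F D) := ⟨rfl⟩

/-- The topology on `D_{𝔸^∞}`: the product topology of `(𝔸_F^∞)^n` in any `F`-basis of `D`. -/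
instance : TopologicalSpace (FinAlg F D) := moduleTopology 𝔸ᶠ[F] (FinAlg F D)

/-- The component of an element of `D_𝔸` in `D_∞`. -/
def toInf : AdelicAlg F D →ₗ[F] InfAlg F D :=
  LinearMap.rTensor D (LinearMap.fst F (InfiniteAdeleRing F) 𝔸ᶠ[F] : 𝔸[F] →ₗ[F] InfiniteAdeleRing F)

/-- The component of an element of `D_𝔸` in `D_{𝔸^∞}`. -/
def toFin : AdelicAlg F D →ₗ[F] FinAlg F D :=
  LinearMap.rTensor D (LinearMap.snd F (InfiniteAdeleRing F) 𝔸ᶠ[F] : 𝔸[F] →ₗ[F] 𝔸ᶠ[F])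

/-- The diagonal embedding `D → D_𝔸`. -/
def diag : D →ₐ[F] AdelicAlg F D := Algebra.TensorProduct.includeRight

/-- The reduced trace `D_𝔸 → 𝔸_F`, the `𝔸_F`-linear extension of `trd : D → F`. -/
def adelicTrd : AdelicAlg F D →ₗ[𝔸[F]] 𝔸[F] :=
  (AlgebraTensorModule.rid F 𝔸[F] 𝔸[F]).toLinearMap ∘ₗ (reducedTrace F D).baseChange 𝔸[F]

end AdelicAlgebra

section Schwartz

/-- `f` is a Schwartz function on the finite dimensional real vector space `V`, i.e. it is one in
linear coordinates (the choice of coordinates is immaterial). -/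
def IsSchwartz {V : Type*} [AddCommGroup V] [Module ℝ V] (f : V → ℂ) : Prop :=
  ∃ (n : ℕ) (e : V ≃ₗ[ℝ] EuclideanSpace ℝ (Fin n)) (g : 𝓢(EuclideanSpace ℝ (Fin n), ℂ)),
    ∀ x, f x = g (e x)

variable (F : Type*) [Field F] [NumberField F] (D : Type*) [Ring D] [Algebra F D]

/-- The Schwartz space `𝓢(D_𝔸^m) = 𝓢(D_∞^m) ⊗ 𝓢(D_{𝔸^∞}^m)`: finite sums of functions
`x ↦ f_∞(x_∞) f^∞(x^∞)` with `f_∞` a Schwartz function on the real vector space `D_∞^m` and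
`f^∞` a locally constant function of compact support on `D_{𝔸^∞}^m`. -/
def schwartzSpace (m : ℕ) : Submodule ℂ ((Fin m → AdelicAlg F D) → ℂ) :=
  Submodule.span ℂ {f | ∃ (g : (Fin m → InfAlg F D) → ℂ) (h : (Fin m → FinAlg F D) → ℂ),
    IsSchwartz g ∧ IsLocallyConstant h ∧ HasCompactSupport h ∧
    f = fun x => g (fun i => toInf F D (x i)) * h (fun i => toFin F D (x i))}

end Schwartz

section Fourier

variable {F : Type*} [Field F] [NumberField F] {D : Type*} [Ring D] [Algebra F D]

/-- The Fourier transform in the `i`-th entry (entries are numbered from `0`) of a function on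
`D_𝔸^m`, with respect to the additive character `ψ` and the measure `μ` on `D_𝔸`. -/
def fourierEntry (ψ : AddChar 𝔸[F] ℂ) (μ : Measure (AdelicAlg F D)) {m : ℕ} (i : Fin m)
    (f : (Fin m → AdelicAlg F D) → ℂ) : (Fin m → AdelicAlg F D) → ℂ :=
  fun y => ∫ z, f (Function.update y i z) * ψ (adelicTrd F D (y i * z)) ∂μ

/-- `μ` is self-dual with respect to `ψ`: Fourier inversion holds on `𝓢(D_𝔸)`. -/
def IsSelfDual (ψ : AddChar 𝔸[F] ℂ) (μ : Measure (AdelicAlg F D)) : Prop :=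
  ∀ f ∈ schwartzSpace F D 1, ∀ y : AdelicAlg F D,
    f ![y] = ∫ x, fourierEntry ψ μ 0 f ![x] * ψ (-adelicTrd F D (x * y)) ∂μ

/-- The summand `𝓕₂(Φ)(0, Qδ)` of `b_{Φ,Q}`, where `Q` is given by `q`. -/
def bTerm (ψ : AddChar 𝔸[F] ℂ) (μ : Measure (AdelicAlg F D))
    (Φ : (Fin 2 → AdelicAlg F D) → ℂ) (q : ℝ) (δ : D) : ℂ :=
  fourierEntry ψ μ 1 Φ ![0, realIdele F q • diag F D δ]

/-- `b_{Φ,Q} = ∑_{δ ∈ D} 𝓕₂(Φ)(0, Qδ)`, where `Q` is given by `q`. -/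
def bCoeff (ψ : AddChar 𝔸[F] ℂ) (μ : Measure (AdelicAlg F D))
    (Φ : (Fin 2 → AdelicAlg F D) → ℂ) (q : ℝ) : ℂ :=
  ∑' δ : D, bTerm ψ μ Φ q δ

end Fourier

section Delta

variable (F : Type*) [Field F] [NumberField F] {D : Type*} [DivisionRing D] [Algebra F D]

/-- The summand `Φ(αδ⁻¹/Q, δ/Q) - Φ(δ/Q, δ⁻¹α/Q)`, where `Q` is given by `q`. -/
def deltaTerm (Φ : (Fin 2 → AdelicAlg F D) → ℂ) (q : ℝ) (α : D) (δ : Dˣ) : ℂ :=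
  Φ ![realIdele F q⁻¹ • diag F D (α * (δ : D)⁻¹), realIdele F q⁻¹ • diag F D (δ : D)] -
    Φ ![realIdele F q⁻¹ • diag F D (δ : D), realIdele F q⁻¹ • diag F D ((δ : D)⁻¹ * α)]

/-- The symbol `δ_α`: it is `1` if `α = 0` and `0` otherwise. -/
def deltaSymbol (α : D) : ℂ :=
  open Classical in if α = 0 then 1 else 0

end Delta

end NonabelianDelta
end

/-! For α ≠ 0 the substitution δ ↦ δ⁻¹α carries one half of the sum over D^× to the other, so the
two halves cancel (`tsum_deltaTerm_of_ne_zero`). For α = 0 the second half vanishes because Φ(·, 0)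
= 0, and the first is the sum of Φ(0, δ/Q) over all of D, the term δ = 0 being zero
(`hasSum_deltaTerm_zero`). Poisson summation for D inside D_𝔸 turns this sum into |Q|^{dim_F D} ·
b_{Φ,Q}, the constant being 1 because D has covolume one for the self-dual measure. The frequency δ
= 0 contributes 𝓕₂(Φ)(0,0) to b_{Φ,Q}. The others decay faster than any power of |Q|; for small |Q|,
boundedness of b_{Φ,Q} is read off from the other side of the Poisson formula. The estimate for
c_{Φ,Q} follows by inversion.

Adelic Poisson summation is reduced to ℤ^ι ⊂ ℝ^ι. With rational coordinates D = ℚ^ι and the open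
subgroups W N = D_∞ × N·(integral elements), every Schwartz function is a finite combination of
functions g ⊗ 1_{x + W N} with g Schwartz on D_∞ and x in D. Such a function meets D in the lattice
coset x + Nℤ^ι. Its Fourier transform is supported where the character is trivial on the finite part
of W N, and this meets D in a lattice N⁻¹ℤ^ι in dual coordinates. Both sides are then those of the
Euclidean formula (`hasSum_fourier_scaled`, `satisfiesPoisson_basic`). The constant does not depend
on N, because W 1 consists of N^|ι| cosets of W N (`density_one_eq`).

The covolume is found by applying Poisson summation twice: Fourier inversion forces its square to be
1 (`density_one_eq_one`). The arithmetic input, collected in `AdelicLattice`, is strong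
approximation, compactness of the integral finite adeles, and the fact that the N·(integral adeles)
shrink to 0. Duality rests on the absence of small subgroups in ℂ^×: a continuous character trivial
on D has a rational vector as archimedean part. -/

set_option linter.unusedSectionVars false

/-! ### Poisson summation for Schwartz functions on ℝ^ι and the lattice ℤ^ι. -/

noncomputable section
namespace NonabelianDelta

section Analysis

open scoped FourierTransform

variable {ι : Type*}

/-- An integer vector, seen in Euclidean space. -/
def intVec (k : ι → ℤ) : EuclideanSpace ℝ ι := WithLp.toLp 2 fun i => (k i : ℝ)

@[simp] lemma intVec_apply (k : ι → ℤ) (i : ι) : intVec k i = k i := rfl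

lemma intVec_zero : intVec (0 : ι → ℤ) = 0 := by ext i; simp

lemma intVec_add (k l : ι → ℤ) : intVec (k + l) = intVec k + intVec l := by ext i; simp

lemma intVec_neg (k : ι → ℤ) : intVec (-k) = -intVec k := by ext i; simp

lemma intVec_injective : Function.Injective (intVec (ι := ι)) := by
  intro k l h
  funext i
  have := congrArg (fun v : EuclideanSpace ℝ ι => v i) h
  simpa using this

variable [Fintype ι]

/-- Integer vectors enumerate the standard lattice. -/
def latticeEquiv : (ι → ℤ) ≃ Submodule.span ℤ (Set.range (Pi.basisFun ℝ ι)) :=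
  ((Pi.basisFun ℝ ι).restrictScalars ℤ).equivFun.symm.toEquiv

lemma coe_latticeEquiv (k : ι → ℤ) :
    ((latticeEquiv k : Submodule.span ℤ (Set.range (Pi.basisFun ℝ ι))) : ι → ℝ)
      = fun i => (k i : ℝ) := by
  classical
  simp only [latticeEquiv, LinearEquiv.coe_toEquiv, Module.Basis.equivFun_symm_apply,
    AddSubmonoidClass.coe_finsetSum, Submodule.coe_smul_of_tower,
    Module.Basis.restrictScalars_apply]
  funext i
  simp [Finset.sum_apply, Pi.single_apply]

lemma finrank_standardLattice :
    Module.finrank ℤ (Submodule.span ℤ (Set.range (Pi.basisFun ℝ ι))) = Fintype.card ι :=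
  Module.finrank_eq_card_basis ((Pi.basisFun ℝ ι).restrictScalars ℤ)

lemma norm_ofLp_le (v : EuclideanSpace ℝ ι) : ‖WithLp.ofLp v‖ ≤ ‖v‖ := by
  rw [pi_norm_le_iff_of_nonneg (norm_nonneg _)]
  intro i
  exact EuclideanSpace.norm_eq v ▸ Real.le_sqrt_of_sq_le
    (Finset.single_le_sum (f := fun i => ‖v i‖ ^ 2) (fun _ _ => by positivity) (Finset.mem_univ i))

/-- Lattice summability is available for the sup norm, which is at most the Euclidean norm. The term
k = 0 is harmless, since 0⁻¹ = 0. -/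
lemma summable_norm_intVec_pow_inv {b : ℕ} (hb : Fintype.card ι < b) :
    Summable fun k : ι → ℤ => (‖intVec k‖ ^ b)⁻¹ := by
  have h := ZLattice.summable_norm_pow_inv (Submodule.span ℤ (Set.range (Pi.basisFun ℝ ι))) b
    (by rw [finrank_standardLattice]; exact hb)
  have h2 := (latticeEquiv (ι := ι)).summable_iff.mpr h
  refine Summable.of_nonneg_of_le (fun k => by positivity) (fun k => ?_) h2
  by_cases hk : intVec k = 0
  · rw [hk, norm_zero, zero_pow (by omega), inv_zero]
    simp only [Function.comp_apply]
    positivity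
  have h0 : 0 < ‖(latticeEquiv k : Submodule.span ℤ (Set.range (Pi.basisFun ℝ ι)))‖ := by
    rw [norm_pos_iff]
    intro h
    apply hk
    have := congrArg Subtype.val h
    rw [coe_latticeEquiv] at this
    ext i
    simpa using congrFun this i
  simp only [Function.comp_apply]
  rw [← inv_pow]
  gcongr
  have := norm_ofLp_le (intVec k)
  rwa [Submodule.coe_norm, coe_latticeEquiv]

lemma summable_one_add_norm_intVec_pow_inv {b : ℕ} (hb : Fintype.card ι < b) :
    Summable fun k : ι → ℤ => ((1 + ‖intVec k‖) ^ b)⁻¹ := by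
  refine Summable.of_norm_bounded_eventually (summable_norm_intVec_pow_inv hb) ?_
  have : ∀ᶠ k : ι → ℤ in Filter.cofinite, k ≠ 0 := by
    simp [Filter.eventually_cofinite]
  filter_upwards [this] with k hk
  have h0 : 0 < ‖intVec k‖ := by
    rw [norm_pos_iff]
    intro h
    exact hk (intVec_injective (h.trans intVec_zero.symm))
  rw [Real.norm_of_nonneg (by positivity)]
  gcongr
  linarith

lemma schwartz_bound {V : Type*} [NormedAddCommGroup V] [NormedSpace ℝ V] (g : 𝓢(V, ℂ)) (b : ℕ) :
    ∃ C, 0 ≤ C ∧ ∀ x, ‖g x‖ ≤ C * ((1 + ‖x‖) ^ b)⁻¹ := by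
  refine ⟨2 ^ b * ((Finset.Iic (b, 0)).sup fun m => SchwartzMap.seminorm ℝ m.1 m.2) g,
    by positivity, fun x => ?_⟩
  have h := SchwartzMap.one_add_le_sup_seminorm_apply (𝕜 := ℝ) (m := (b, 0)) (k := b) (n := 0)
    le_rfl le_rfl g x
  rw [norm_iteratedFDeriv_zero] at h
  rw [← div_eq_mul_inv, le_div_iff₀ (by positivity)]
  linarith

/-- The inequality 1 + ‖k‖ ≤ (1 + R)(1 + ‖x + k‖) makes the decay in k uniform for x in a ball. This
gives both continuity of the periodization and the exchange of sum and integral. -/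
lemma schwartz_translate_bound (g : 𝓢(EuclideanSpace ℝ ι, ℂ)) (b : ℕ) (R : ℝ) (hR : 0 ≤ R) :
    ∃ C, 0 ≤ C ∧ ∀ x k, ‖x‖ ≤ R → ‖g (x + intVec k)‖ ≤ C * ((1 + ‖intVec k‖) ^ b)⁻¹ := by
  obtain ⟨C, hC, h⟩ := schwartz_bound g b
  refine ⟨C * (1 + R) ^ b, by positivity, fun x k hx => (h _).trans ?_⟩
  rw [mul_assoc]
  gcongr
  rw [← div_eq_mul_inv, le_div_iff₀ (by positivity), inv_mul_le_iff₀ (by positivity), ← mul_pow]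
  gcongr
  have h1 : ‖intVec k‖ ≤ ‖x + intVec k‖ + ‖x‖ := by
    calc ‖intVec k‖ = ‖(x + intVec k) - x‖ := by congr 1; abel
      _ ≤ _ := norm_sub_le _ _
  nlinarith [norm_nonneg (x + intVec k)]

lemma summable_schwartz_intVec (g : 𝓢(EuclideanSpace ℝ ι, ℂ)) (x : EuclideanSpace ℝ ι) :
    Summable fun k : ι → ℤ => g (x + intVec k) := by
  obtain ⟨C, hC, h⟩ := schwartz_translate_bound g (Fintype.card ι + 1) ‖x‖ (norm_nonneg _)
  exact Summable.of_norm_bounded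
    ((summable_one_add_norm_intVec_pow_inv (Nat.lt_succ_self _)).mul_left C) fun k => h x k le_rfl

/-- The periodization of a Schwartz function. -/
def periodization (g : 𝓢(EuclideanSpace ℝ ι, ℂ)) (x : ι → ℝ) : ℂ :=
  ∑' k : ι → ℤ, g (WithLp.toLp 2 x + intVec k)

lemma continuous_periodization (g : 𝓢(EuclideanSpace ℝ ι, ℂ)) :
    Continuous (periodization g) := by
  have hcont : Continuous fun x : EuclideanSpace ℝ ι => ∑' k : ι → ℤ, g (x + intVec k) := by
    rw [continuous_iff_continuousAt]
    intro x
    obtain ⟨C, hC, h⟩ := schwartz_translate_bound g (Fintype.card ι + 1) (‖x‖ + 1) (by positivity)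
    have : ContinuousOn (fun x : EuclideanSpace ℝ ι => ∑' k : ι → ℤ, g (x + intVec k))
        (Metric.ball 0 (‖x‖ + 1)) := by
      refine continuousOn_tsum (u := fun k => C * ((1 + ‖intVec k‖) ^ (Fintype.card ι + 1))⁻¹)
        (fun k => ?_) ((summable_one_add_norm_intVec_pow_inv (Nat.lt_succ_self _)).mul_left C)
        fun k y hy => h y k ?_
      · exact (g.continuous.comp (by fun_prop)).continuousOn
      · exact (mem_ball_zero_iff.mp hy).le
    exact this.continuousAt (Metric.isOpen_ball.mem_nhds (by simp))
  exact hcont.comp (PiLp.continuous_toLp 2 _)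

lemma periodization_add_int (g : 𝓢(EuclideanSpace ℝ ι, ℂ)) (x : ι → ℝ) (k : ι → ℤ) :
    periodization g (x + fun i => (k i : ℝ)) = periodization g x := by
  unfold periodization
  conv_rhs => rw [← (Equiv.addLeft k).tsum_eq]
  refine tsum_congr fun l => ?_
  congr 1
  simp only [Equiv.coe_addLeft, intVec_add]
  ext i
  simp [add_assoc]

/-- The projection of `ℝ^ι` onto the torus. -/
def toTorus : C(ι → ℝ, UnitAddTorus ι) where
  toFun x i := (x i : UnitAddCircle)
  continuous_toFun := continuous_pi fun i => (AddCircle.continuous_mk' 1).comp (continuous_apply i)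

omit [Fintype ι] in
lemma isOpenQuotientMap_toTorus : IsOpenQuotientMap (toTorus (ι := ι)) :=
  IsOpenQuotientMap.piMap fun _ => QuotientAddGroup.isOpenQuotientMap_mk

lemma periodization_factorsThrough (g : 𝓢(EuclideanSpace ℝ ι, ℂ)) :
    Function.FactorsThrough (⟨periodization g, continuous_periodization g⟩ : C(ι → ℝ, ℂ))
      (toTorus (ι := ι)) := by
  intro x y hxy
  have h : ∀ i, ∃ k : ℤ, y i - x i = k := by
    intro i
    have := congrFun hxy i
    simp only [toTorus, ContinuousMap.coe_mk] at this
    obtain ⟨k, hk⟩ := AddSubgroup.mem_zmultiples_iff.mp (QuotientAddGroup.eq.mp this)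
    exact ⟨k, by rw [zsmul_one] at hk; rw [hk]; ring⟩
  choose k hk using h
  have : y = x + fun i => (k i : ℝ) := by
    funext i
    simp [← hk]
  simp only [ContinuousMap.coe_mk]
  rw [this, periodization_add_int]

/-- The periodization, as a continuous function on the torus. -/
def torusPeriodization (g : 𝓢(EuclideanSpace ℝ ι, ℂ)) : C(UnitAddTorus ι, ℂ) :=
  (isOpenQuotientMap_toTorus.isQuotientMap).lift ⟨periodization g, continuous_periodization g⟩
    (periodization_factorsThrough g)

lemma torusPeriodization_apply (g : 𝓢(EuclideanSpace ℝ ι, ℂ)) (x : ι → ℝ) :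
    torusPeriodization g (toTorus x) = periodization g x :=
  congrArg (fun f : C(ι → ℝ, ℂ) => f x)
    ((isOpenQuotientMap_toTorus (ι := ι)).isQuotientMap.lift_comp
      ⟨periodization g, continuous_periodization g⟩ (periodization_factorsThrough g))

lemma mFourier_toTorus (m : ι → ℤ) (x : ι → ℝ) :
    UnitAddTorus.mFourier m (toTorus x) = 𝐞 (inner ℝ (WithLp.toLp 2 x) (intVec m)) := by
  simp only [UnitAddTorus.mFourier, ContinuousMap.coe_mk, toTorus, fourier_coe_apply,
    Real.fourierChar_apply]
  rw [← Complex.exp_sum]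
  congr 1
  rw [PiLp.inner_apply]
  push_cast
  rw [Finset.mul_sum, Finset.sum_mul]
  refine Finset.sum_congr rfl fun i _ => ?_
  simp
  ring

lemma fourierChar_inner_intVec_intVec (k m : ι → ℤ) :
    𝐞 (inner ℝ (intVec k) (intVec m)) = 1 := by
  have h : (inner ℝ (intVec k) (intVec m) : ℝ) = ((∑ i, k i * m i : ℤ) : ℝ) := by
    rw [PiLp.inner_apply]
    push_cast
    refine Finset.sum_congr rfl fun i _ => ?_
    simp [mul_comm]
  rw [h]
  ext
  rw [Real.fourierChar_apply]
  rw [Circle.coe_one, Complex.exp_eq_one_iff]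
  exact ⟨∑ i, k i * m i, by push_cast; ring⟩

/-- Unfolding: the integral of the periodization over a unit cube is the integral of `g` over the
whole space, because the exponential of frequency m is ℤ^ι-periodic. -/
lemma mFourierCoeff_torusPeriodization (g : 𝓢(EuclideanSpace ℝ ι, ℂ)) (m : ι → ℤ) :
    UnitAddTorus.mFourierCoeff (torusPeriodization g) m = 𝓕 (g : EuclideanSpace ℝ ι → ℂ)
      (intVec m) := by
  classical
  set G : EuclideanSpace ℝ ι → ℂ := fun v => 𝐞 (-inner ℝ v (intVec m)) • g v with hG
  have hGnorm : ∀ v, ‖G v‖ = ‖g v‖ := fun v => by simp [hG]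
  have hGcont : Continuous G := by
    simp only [hG]
    fun_prop
  have hGint : Integrable G := by
    refine (integrable_norm_iff hGcont.aestronglyMeasurable).mp ?_
    simp only [hGnorm]
    exact g.integrable.norm
  set f : (ι → ℝ) → ℂ := fun x => G (WithLp.toLp 2 x) with hf
  have hmp := (EuclideanSpace.volume_preserving_symm_measurableEquiv_toLp ι).symm
  have hfint : Integrable f := (hmp.integrable_comp_emb (MeasurableEquiv.measurableEmbedding _)).mpr
    hGint
  have hfI : ∫ x, f x = ∫ v, G v := hmp.integral_comp (MeasurableEquiv.measurableEmbedding _) G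
  have hfcont : Continuous f := hGcont.comp (PiLp.continuous_toLp 2 _)
  set B : Set (ι → ℝ) := {x | ∀ i, x i ∈ Set.Ioc (0 : ℝ) (0 + 1)} with hB
  have hBmeas : MeasurableSet B := MeasurableSet.univ_pi' fun i => measurableSet_Ioc
  -- The lattice fundamental domain is closed on the left and the cube computing Fourier
  -- coefficients is closed on the right; they differ by a null set.
  have hBae : (ZSpan.fundamentalDomain (Pi.basisFun ℝ ι)) =ᵐ[volume] B := by
    rw [ZSpan.fundamentalDomain_pi_basisFun]
    have h1 := Measure.univ_pi_Ico_ae_eq_Icc (μ := fun _ : ι => (volume : Measure ℝ))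
      (f := fun _ => (0 : ℝ)) (g := fun _ => (1 : ℝ))
    have h2 := Measure.univ_pi_Ioc_ae_eq_Icc (μ := fun _ : ι => (volume : Measure ℝ))
      (f := fun _ => (0 : ℝ)) (g := fun _ => (1 : ℝ))
    have h3 : B = Set.univ.pi fun _ => Set.Ioc (0 : ℝ) 1 := by
      ext x; simp [hB]
    rw [h3]
    exact h1.trans h2.symm
  have htile : ∫ x, f x = ∑' k : ι → ℤ, ∫ x in B, f (x + fun i => (k i : ℝ)) := by
    have : VAddInvariantMeasure (Submodule.span ℤ (Set.range (Pi.basisFun ℝ ι))) (ι → ℝ) volume :=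
      ⟨fun c s _ => measure_preimage_add volume (c : ι → ℝ) s⟩
    have := (ZSpan.isAddFundamentalDomain (Pi.basisFun ℝ ι) volume).integral_eq_tsum'' f hfint
    rw [this, ← (latticeEquiv (ι := ι)).tsum_eq]
    refine tsum_congr fun k => ?_
    rw [setIntegral_congr_set hBae]
    refine integral_congr_ae (Filter.Eventually.of_forall fun x => ?_)
    simp only
    congr 1
    rw [Submodule.vadd_def, coe_latticeEquiv, vadd_eq_add, add_comm]
  have hshift : ∀ (x : ι → ℝ) (k : ι → ℤ), f (x + fun i => (k i : ℝ)) =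
      𝐞 (-inner ℝ (WithLp.toLp 2 x) (intVec m)) • g (WithLp.toLp 2 x + intVec k) := by
    intro x k
    have hk : (WithLp.toLp 2 (x + fun i => (k i : ℝ)) : EuclideanSpace ℝ ι)
        = WithLp.toLp 2 x + intVec k := rfl
    simp only [hf, hG]
    rw [hk, inner_add_left, neg_add, AddChar.map_add_eq_mul]
    rw [AddChar.map_neg_eq_inv _ (inner ℝ (intVec k) (intVec m)), fourierChar_inner_intVec_intVec]
    simp
  -- The square root of the dimension bounds the Euclidean norm on the unit cube.
  obtain ⟨C, hC, hbound⟩ := schwartz_translate_bound g (Fintype.card ι + 1)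
    (Real.sqrt (Fintype.card ι)) (Real.sqrt_nonneg _)
  have hBvol : volume B < ⊤ := by
    rw [← measure_congr hBae]
    exact (ZSpan.fundamentalDomain_isBounded _).measure_lt_top
  have hbd : ∀ (k : ι → ℤ), ∀ x ∈ B, ‖f (x + fun i => (k i : ℝ))‖ ≤
      C * ((1 + ‖intVec k‖) ^ (Fintype.card ι + 1))⁻¹ := by
    intro k x hx
    rw [hshift]
    rw [Circle.norm_smul]
    apply hbound
    rw [EuclideanSpace.norm_eq]
    apply Real.sqrt_le_sqrt
    calc ∑ i, ‖(WithLp.toLp 2 x : EuclideanSpace ℝ ι) i‖ ^ 2 ≤ ∑ i : ι, (1 : ℝ) := by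
          refine Finset.sum_le_sum fun i _ => ?_
          have := hx i
          rw [Real.norm_eq_abs, sq_abs]
          simp only
          nlinarith [this.1, this.2]
      _ = _ := by simp
  have hswap : ∑' k : ι → ℤ, ∫ x in B, f (x + fun i => (k i : ℝ)) =
      ∫ x in B, ∑' k : ι → ℤ, f (x + fun i => (k i : ℝ)) := by
    refine (hasSum_integral_of_summable_integral_norm (fun k => ?_) ?_).tsum_eq
    · refine Measure.integrableOn_of_bounded hBvol.ne
        (hfcont.comp (by fun_prop)).aestronglyMeasurable
        ((ae_restrict_iff' hBmeas).mpr (Filter.Eventually.of_forall fun x hx => hbd k x hx))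
    · refine Summable.of_nonneg_of_le (fun k => integral_nonneg fun x => norm_nonneg _) (fun k => ?_)
        (((summable_one_add_norm_intVec_pow_inv (ι := ι) (Nat.lt_succ_self _)).mul_left C).mul_right
          (volume.real B))
      have := norm_setIntegral_le_of_norm_le_const (μ := volume) (s := B)
        (f := fun x => ‖f (x + fun i => (k i : ℝ))‖) hBvol
        (fun x hx => by rw [norm_norm]; exact hbd k x hx)
      exact (le_abs_self _).trans this
  rw [UnitAddTorus.mFourierCoeff_eq_integral _ _ (fun _ => 0), Real.fourier_eq]
  change _ = ∫ v, G v
  rw [← hfI, htile, hswap]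
  refine integral_congr_ae (Filter.Eventually.of_forall fun x => ?_)
  simp only [hshift]
  have h1 := mFourier_toTorus (-m) x
  have h2 := torusPeriodization_apply g x
  simp only [toTorus, ContinuousMap.coe_mk] at h1 h2
  rw [h1, h2, intVec_neg, inner_neg_right]
  simp only [periodization, Circle.smul_def, smul_eq_mul]
  rw [tsum_mul_left]

/-- **Poisson summation** for Schwartz functions on Euclidean space and the standard lattice. -/
theorem hasSum_fourier_intVec (g : 𝓢(EuclideanSpace ℝ ι, ℂ)) :
    HasSum (fun m : ι → ℤ => 𝓕 g (intVec m)) (∑' k : ι → ℤ, g (intVec k)) := by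
  have hs : Summable (UnitAddTorus.mFourierCoeff (torusPeriodization g)) := by
    have h := summable_schwartz_intVec (𝓕 g) 0
    simp only [zero_add] at h
    refine h.congr fun m => ?_
    rw [mFourierCoeff_torusPeriodization, SchwartzMap.fourier_coe]
  -- The Fourier series of the periodization converges to it pointwise; its value at 0 is the
  -- lattice sum.
  have h := UnitAddTorus.hasSum_mFourier_series_apply_of_summable hs (toTorus 0)
  rw [torusPeriodization_apply] at h
  simp only [mFourier_toTorus, mFourierCoeff_torusPeriodization] at h
  convert h using 1
  · funext m
    simp [SchwartzMap.fourier_coe]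
  · simp [periodization]

end Analysis

end NonabelianDelta
end

/-! ### Continuous characters of real vector spaces, and Poisson summation for dilated lattice
cosets. -/

noncomputable section
namespace NonabelianDelta

section Characters

/-- A continuous multiplicative character of the real line is exponential. -/
lemma exists_exp_of_continuous_char {φ : ℝ → ℂ} (hc : Continuous φ)
    (hadd : ∀ x y, φ (x + y) = φ x * φ y) (h0 : φ 0 = 1) : ∃ c : ℂ, ∀ x, φ x = Complex.exp (c * x) := by
  -- Otherwise the primitive of φ would vanish to the right of 0, although its derivative there is φ
  -- 0 = 1.
  obtain ⟨ε, hε, hint⟩ : ∃ ε : ℝ, 0 < ε ∧ ∫ t in (0 : ℝ)..ε, φ t ≠ 0 := by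
    by_contra! h
    have hd : HasDerivAt (fun x => ∫ t in (0 : ℝ)..x, φ t) (φ 0) 0 :=
      intervalIntegral.integral_hasDerivAt_right (hc.intervalIntegrable _ _)
        (hc.stronglyMeasurableAtFilter _ _) hc.continuousAt
    have hd' := hd.hasDerivWithinAt (s := Set.Ici 0)
    have hz : HasDerivWithinAt (fun x => ∫ t in (0 : ℝ)..x, φ t) 0 (Set.Ici 0) 0 := by
      refine (hasDerivWithinAt_const (0 : ℝ) (Set.Ici 0) (0 : ℂ)).congr ?_ (by simp)
      intro x hx
      rcases eq_or_lt_of_le (Set.mem_Ici.mp hx) with rfl | hx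
      · simp
      · exact h x hx
    have := (uniqueDiffWithinAt_Ici (0 : ℝ)).eq_deriv _ hd' hz
    rw [h0] at this
    exact one_ne_zero this
  set A := ∫ t in (0 : ℝ)..ε, φ t with hA
  -- A continuous character is a multiple of its own moving average, hence differentiable.
  have hkey : ∀ x, φ x = A⁻¹ * ∫ t in x..(x + ε), φ t := by
    intro x
    have : ∫ t in x..(x + ε), φ t = φ x * A := by
      rw [hA, ← intervalIntegral.integral_const_mul]
      have := intervalIntegral.integral_comp_add_left (a := 0) (b := ε) φ x
      rw [add_zero] at this
      rw [← this]
      simp only [hadd]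
    rw [this]
    field_simp
  have hdiff : Differentiable ℝ φ := by
    have hF : ∀ x, HasDerivAt (fun x => ∫ t in (0 : ℝ)..x, φ t) (φ x) x := fun x =>
      intervalIntegral.integral_hasDerivAt_right (hc.intervalIntegrable _ _)
        (hc.stronglyMeasurableAtFilter _ _) hc.continuousAt
    have heq : φ = fun x => A⁻¹ * ((∫ t in (0 : ℝ)..(x + ε), φ t) - ∫ t in (0 : ℝ)..x, φ t) := by
      funext x
      rw [hkey x, intervalIntegral.integral_interval_sub_left (hc.intervalIntegrable _ _)
        (hc.intervalIntegrable _ _)]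
    rw [heq]
    intro x
    have h1 : DifferentiableAt ℝ (fun x => ∫ t in (0 : ℝ)..(x + ε), φ t) x :=
      ((hF (x + ε)).comp_add_const x ε).differentiableAt
    exact (h1.sub (hF x).differentiableAt).const_mul _
  set c := deriv φ 0 with hcdef
  have hder : ∀ x, HasDerivAt φ (φ x * c) x := by
    intro x
    have h1 : HasDerivAt (fun y => φ (x + y)) (deriv φ x) 0 := by
      have := (hdiff x).hasDerivAt
      have h2 : HasDerivAt φ (deriv φ x) (x + 0) := by simpa using this
      exact h2.comp_const_add x 0
    have h2 : HasDerivAt (fun y => φ (x + y)) (φ x * c) 0 := by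
      simp only [hadd]
      exact (hdiff 0).hasDerivAt.const_mul _
    rw [← h1.unique h2]
    exact (hdiff x).hasDerivAt
  refine ⟨c, fun x => ?_⟩
  have hexp : ∀ x : ℝ, HasDerivAt (fun x : ℝ => Complex.exp (-(c * x))) (Complex.exp (-(c * x)) * -c) x := by
    intro x
    have h1 : HasDerivAt (fun x : ℝ => -(c * (x : ℂ))) (-c) x := by
      have := ((hasDerivAt_id x).ofReal_comp.const_mul c).neg
      simpa using! this
    exact h1.cexp
  have hconst : ∀ x, HasDerivAt (fun x : ℝ => φ x * Complex.exp (-(c * x))) 0 x := by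
    intro x
    have : HasDerivAt (fun x : ℝ => φ x * Complex.exp (-(c * x)))
        (φ x * c * Complex.exp (-(c * x)) + φ x * (Complex.exp (-(c * x)) * -c)) x :=
      (hder x).mul (hexp x)
    rwa [show φ x * c * Complex.exp (-(c * x)) + φ x * (Complex.exp (-(c * x)) * -c) = 0 by ring]
      at this
  have := is_const_of_deriv_eq_zero (fun x => (hconst x).differentiableAt)
    (fun x => (hconst x).deriv) x 0
  simp only [h0, Complex.ofReal_zero, mul_zero, neg_zero, Complex.exp_zero, mul_one] at this
  rw [Complex.exp_neg] at this
  field_simp at this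
  exact this

/-- The complex numbers have no small multiplicative subgroups. -/
lemma eq_one_of_forall_norm_pow_sub_one_le {z : ℂ} (h : ∀ k : ℕ, ‖z ^ k - 1‖ ≤ 1 / 2) : z = 1 := by
  by_contra hz
  have hpos : 0 < ‖z - 1‖ := norm_pos_iff.mpr (sub_ne_zero.mpr hz)
  -- Since z² − 1 = (z − 1)(2 + (z − 1)), each squaring expands the distance to 1 by at least 3/2 as
  -- long as that distance is at most 1/2.
  have hgrow : ∀ j : ℕ, (3 / 2 : ℝ) ^ j * ‖z - 1‖ ≤ ‖z ^ (2 ^ j) - 1‖ := by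
    intro j
    induction j with
    | zero => simp
    | succ j ih =>
      have h1 : z ^ (2 ^ (j + 1)) - 1 = (z ^ (2 ^ j) - 1) * (2 + (z ^ (2 ^ j) - 1)) := by ring
      have h2 : (3 / 2 : ℝ) ≤ ‖2 + (z ^ (2 ^ j) - 1)‖ := by
        have h3 := norm_sub_norm_le (2 : ℂ) (-(z ^ (2 ^ j) - 1))
        rw [norm_neg, sub_neg_eq_add] at h3
        have := h (2 ^ j)
        simp only [Complex.norm_ofNat] at h3
        linarith
      rw [h1, norm_mul, pow_succ]
      nlinarith [norm_nonneg (z ^ 2 ^ j - 1)]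
  obtain ⟨j, hj⟩ := pow_unbounded_of_one_lt (1 / ‖z - 1‖) (by norm_num : (1 : ℝ) < 3 / 2)
  have := hgrow j
  rw [div_lt_iff₀ hpos] at hj
  linarith [h (2 ^ j)]

open scoped FourierTransform

variable {ι : Type*} [Fintype ι]

/-- A continuous character of Euclidean space that is trivial on a multiple of the standard lattice
is given by a rational vector. -/
lemma exists_vec_of_continuous_char {φ : EuclideanSpace ℝ ι → ℂ} (hc : Continuous φ)
    (hadd : ∀ x y, φ (x + y) = φ x * φ y) (h0 : φ 0 = 1) {M : ℕ} (hM : 0 < M)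
    (htriv : ∀ k : ι → ℤ, φ ((M : ℝ) • intVec k) = 1) :
    ∃ a : ι → ℤ, ∀ r, φ r = 𝐞 (inner ℝ ((M : ℝ)⁻¹ • intVec a) r) := by
  classical
  have hMne : (M : ℂ) ≠ 0 := by exact_mod_cast hM.ne'
  have hi : ∀ i, ∃ a : ℤ, ∀ t : ℝ, φ (EuclideanSpace.single i t)
      = Complex.exp (2 * Real.pi * (a / M * t) * Complex.I) := by
    intro i
    obtain ⟨c, hcx⟩ := exists_exp_of_continuous_char (φ := fun t => φ (EuclideanSpace.single i t))
      (hc.comp (by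
        refine (PiLp.continuous_toLp 2 _).comp (continuous_pi fun j => ?_)
        rcases eq_or_ne j i with rfl | hj
        · simpa using continuous_id'
        · simpa [Pi.single_apply, hj] using continuous_const))
      (fun x y => by
        rw [← hadd]
        congr 1
        ext j
        by_cases hj : j = i <;> simp [hj])
      (by
        rw [← h0]
        congr 1
        ext j
        simp)
    -- Triviality at M times the i-th basis vector makes the exponent on the i-th axis an integer
    -- multiple of 2πi/M.
    have h1 : φ (EuclideanSpace.single i (M : ℝ)) = 1 := by
      rw [← htriv (Pi.single i 1)]
      congr 1
      ext j
      by_cases hj : j = i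
      · subst hj; simp
      · simp [hj]
    rw [hcx, Complex.exp_eq_one_iff] at h1
    obtain ⟨a, ha⟩ := h1
    refine ⟨a, fun t => ?_⟩
    rw [hcx]
    congr 1
    have : c = a * (2 * Real.pi * Complex.I) / M := by
      field_simp
      push_cast at ha
      rw [ha]
      ring
    rw [this]
    field_simp
  choose a ha using hi
  refine ⟨a, fun r => ?_⟩
  have hsum : ∀ s : Finset ι, φ (∑ i ∈ s, EuclideanSpace.single i (r i))
      = ∏ i ∈ s, φ (EuclideanSpace.single i (r i)) := by
    intro s
    induction s using Finset.induction_on with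
    | empty => simpa using h0
    | insert i s his ih => rw [Finset.sum_insert his, Finset.prod_insert his, hadd, ih]
  have hr : r = ∑ i, EuclideanSpace.single i (r i) := by
    ext j
    simp [Finset.sum_apply]
  conv_lhs => rw [hr]
  rw [hsum]
  simp only [ha]
  rw [← Complex.exp_sum, Real.fourierChar_apply, PiLp.inner_apply]
  congr 1
  push_cast
  rw [Finset.mul_sum, Finset.sum_mul]
  refine Finset.sum_congr rfl fun i _ => ?_
  simp only [PiLp.smul_apply, intVec_apply, smul_eq_mul, RCLike.inner_apply, conj_trivial]
  push_cast
  ring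

lemma fourierChar_inner_ext {v w : EuclideanSpace ℝ ι}
    (h : ∀ r, (𝐞 (inner ℝ v r) : ℂ) = 𝐞 (inner ℝ w r)) : v = w := by
  have h1 : ∀ r : EuclideanSpace ℝ ι, ∃ n : ℤ, (inner ℝ (v - w) r : ℝ) = n := by
    intro r
    have h2 := h r
    rw [Real.fourierChar_apply, Real.fourierChar_apply, Complex.exp_eq_exp_iff_exists_int] at h2
    obtain ⟨n, hn⟩ := h2
    refine ⟨n, ?_⟩
    have h3 : (2 * Real.pi * Complex.I) * ((inner ℝ v r : ℝ) : ℂ)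
        = (2 * Real.pi * Complex.I) * (((inner ℝ w r : ℝ) : ℂ) + n) := by
      push_cast at hn
      linear_combination hn
    have h4 := mul_left_cancel₀ Complex.two_pi_I_ne_zero h3
    rw [inner_sub_left]
    have h5 : (inner ℝ v r : ℝ) = inner ℝ w r + n := by exact_mod_cast h4
    rw [h5]
    ring
  by_contra hvw
  have hpos : 0 < ‖v - w‖ ^ 2 := by
    exact pow_pos (norm_pos_iff.mpr (sub_ne_zero.mpr hvw)) 2
  -- The test vector is chosen so that its pairing with v − w is 1/2, which is not an integer.
  obtain ⟨n, hn⟩ := h1 ((1 / (2 * ‖v - w‖ ^ 2)) • (v - w))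
  rw [inner_smul_right, real_inner_self_eq_norm_sq] at hn
  have h6 : (1 : ℝ) / 2 = n := by
    rw [← hn]
    have := hpos.ne'
    generalize ‖v - w‖ ^ 2 = t at *
    field_simp
  have h7 : (1 : ℝ) = 2 * n := by linarith
  have h8 : (1 : ℤ) = 2 * n := by exact_mod_cast h7
  omega

/-- **Poisson summation** for the translate `ξ + N ℤ^ι`, dilated by `1 / q`. -/
theorem hasSum_fourier_scaled (g : 𝓢(EuclideanSpace ℝ ι, ℂ)) (ξ : EuclideanSpace ℝ ι)
    {N : ℕ} (hN : 0 < N) {q : ℝ} (hq : 0 < q) :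
    Summable (fun k : ι → ℤ => g (q⁻¹ • (ξ + (N : ℝ) • intVec k))) ∧
    HasSum (fun m : ι → ℤ => 𝐞 (inner ℝ ξ ((N : ℝ)⁻¹ • intVec m)) •
        𝓕 g (q • (N : ℝ)⁻¹ • intVec m))
      ((N / q : ℂ) ^ Fintype.card ι * ∑' k : ι → ℤ, g (q⁻¹ • (ξ + (N : ℝ) • intVec k))) := by
  have hN' : (0 : ℝ) < N := by exact_mod_cast hN
  have hNq : (N / q : ℝ) ≠ 0 := by positivity
  set e : EuclideanSpace ℝ ι ≃L[ℝ] EuclideanSpace ℝ ι :=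
    ContinuousLinearEquiv.smulLeft (Units.mk0 (N / q : ℝ) hNq) with he
  have he_apply : ∀ v, e v = (N / q : ℝ) • v := fun v => rfl
  set g₁ : 𝓢(EuclideanSpace ℝ ι, ℂ) := SchwartzMap.compCLMOfContinuousLinearEquiv ℂ e g with hg₁
  have hg₁_apply : ∀ v, g₁ v = g ((N / q : ℝ) • v) := fun v => by simp [hg₁, he_apply]
  -- Absorbing the translation and the dilation into the function reduces the claim to the standard
  -- lattice.
  set g₂ : 𝓢(EuclideanSpace ℝ ι, ℂ) := SchwartzMap.compSubConstCLM ℂ (-((N : ℝ)⁻¹ • ξ)) g₁ with hg₂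
  have harg : ∀ v : EuclideanSpace ℝ ι,
      (N / q : ℝ) • (v + (N : ℝ)⁻¹ • ξ) = q⁻¹ • (ξ + (N : ℝ) • v) := by
    intro v
    simp only [smul_add, smul_smul]
    rw [add_comm]
    congr 2 <;> field_simp
  have hg₂_apply : ∀ v, g₂ v = g (q⁻¹ • (ξ + (N : ℝ) • v)) := fun v => by
    rw [hg₂, SchwartzMap.compSubConstCLM_apply, hg₁_apply, sub_neg_eq_add, harg]
  have hsum := summable_schwartz_intVec g₂ 0
  simp only [zero_add, hg₂_apply] at hsum
  refine ⟨hsum, ?_⟩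
  have hfour : ∀ m : ι → ℤ, 𝐞 (inner ℝ ξ ((N : ℝ)⁻¹ • intVec m)) • 𝓕 g (q • (N : ℝ)⁻¹ • intVec m)
      = (N / q : ℂ) ^ Fintype.card ι * 𝓕 g₂ (intVec m) := by
    intro m
    set h : EuclideanSpace ℝ ι → ℂ :=
      fun u => 𝐞 (-inner ℝ ((N : ℝ)⁻¹ • (q • u - ξ)) (intVec m)) • g u with hh
    have h1 : 𝓕 g₂ (intVec m) = ∫ v, h ((N / q : ℝ) • (v + (N : ℝ)⁻¹ • ξ)) := by
      rw [SchwartzMap.fourier_coe, Real.fourier_eq]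
      refine integral_congr_ae (Filter.Eventually.of_forall fun v => ?_)
      simp only [hh]
      rw [harg, hg₂_apply]
      congr 4
      rw [smul_smul, mul_inv_cancel₀ hq.ne', one_smul, add_sub_cancel_left, smul_smul,
        inv_mul_cancel₀ hN'.ne', one_smul]
    have h2 : ∫ v, h ((N / q : ℝ) • (v + (N : ℝ)⁻¹ • ξ))
        = ((N / q : ℝ) ^ Fintype.card ι)⁻¹ • ∫ u, h u := by
      rw [integral_add_right_eq_self (fun v => h ((N / q : ℝ) • v)), Measure.integral_comp_smul,
        finrank_euclideanSpace, abs_of_nonneg (by positivity)]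
    have h3 : ∫ u, h u
        = 𝐞 (inner ℝ ξ ((N : ℝ)⁻¹ • intVec m)) • 𝓕 g (q • (N : ℝ)⁻¹ • intVec m) := by
      rw [SchwartzMap.fourier_coe, Real.fourier_eq, Circle.smul_def, ← integral_smul]
      refine integral_congr_ae (Filter.Eventually.of_forall fun u => ?_)
      simp only [hh]
      rw [← Circle.smul_def, smul_smul, ← AddChar.map_add_eq_mul]
      congr 2
      rw [inner_smul_left, inner_sub_left, inner_smul_left, inner_smul_right, inner_smul_right,
        inner_smul_right]
      simp only [conj_trivial]
      ring
    rw [h1, h2, h3, Complex.real_smul]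
    push_cast
    rw [mul_inv_cancel_left₀]
    have : (N / q : ℂ) ≠ 0 := by exact_mod_cast hNq
    exact pow_ne_zero _ this
  simp only [hfour]
  have := (hasSum_fourier_intVec g₂).mul_left ((N / q : ℂ) ^ Fintype.card ι)
  simpa only [hg₂_apply] using this

end Characters

end NonabelianDelta
end

/-! ### An axiomatic model of a division algebra inside its adelic algebra, and characters trivial
on it. -/

noncomputable section
namespace NonabelianDelta

open scoped FourierTransform

/-- A rational vector, seen in Euclidean space. -/
def ratVec {ι : Type*} (v : ι → ℚ) : EuclideanSpace ℝ ι := WithLp.toLp 2 fun i => (v i : ℝ)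

section RatVec

variable {ι : Type*}

@[simp] lemma ratVec_apply (v : ι → ℚ) (i : ι) : ratVec v i = v i := rfl

lemma ratVec_add (v w : ι → ℚ) : ratVec (v + w) = ratVec v + ratVec w := by ext i; simp

lemma ratVec_injective : Function.Injective (ratVec (ι := ι)) := by
  intro k l h
  funext i
  have := congrArg (fun v : EuclideanSpace ℝ ι => v i) h
  simpa using this

lemma ratVec_zero : ratVec (0 : ι → ℚ) = 0 := by ext i; simp

end RatVec

section MulChar

variable {A : Type*} [Ring A]

/-- The character `z ↦ Ψ (y * z)`. -/
def mulLeftChar (Ψ : AddChar A ℂ) (y : A) : AddChar A ℂ :=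
  Ψ.compAddMonoidHom (AddMonoidHom.mulLeft y)

@[simp] lemma mulLeftChar_apply (Ψ : AddChar A ℂ) (y z : A) : mulLeftChar Ψ y z = Ψ (y * z) := rfl

/-- The character `z ↦ Ψ (z * y)`. -/
def mulRightChar (Ψ : AddChar A ℂ) (y : A) : AddChar A ℂ :=
  Ψ.compAddMonoidHom (AddMonoidHom.mulRight y)

end MulChar

/-- The features of an adelic algebra `A` over a division algebra `D` that enter Poisson summation:
`P` gives real coordinates of the archimedean component and `s` embeds the archimedean component;
the `W N` are open subgroups shrinking, with `N`, to the archimedean component; `D` is embedded by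
`diag` and has rational coordinates `coord`. -/
structure AdelicLattice (A D ι : Type*) [Ring A] [TopologicalSpace A] [DivisionRing D]
    [Fintype ι] where
  diag : D →+* A
  P : A →+ EuclideanSpace ℝ ι
  s : EuclideanSpace ℝ ι →+ A
  W : ℕ → AddSubgroup A
  coord : D ≃+ (ι → ℚ)
  continuous_P : Continuous P
  continuous_s : Continuous s
  P_s : ∀ r, P (s r) = r
  s_P_mul : ∀ x y, s (P (x * y)) = s (P x) * y
  s_P_mul' : ∀ x y, s (P (x * y)) = x * s (P y)
  P_diag : ∀ δ, P (diag δ) = ratVec (coord δ)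
  isOpen_W : ∀ N, 0 < N → IsOpen (W N : Set A)
  s_mem_W : ∀ N r, s r ∈ W N
  diag_mem_W : ∀ N, 0 < N → ∀ δ, diag δ ∈ W N ↔ ∃ k : ι → ℤ, ∀ i, coord δ i = N * k i
  W_le : ∀ M N, M ∣ N → W N ≤ W M
  exists_W_subset : ∀ U ∈ nhds (0 : A), ∃ N, 0 < N ∧ ∀ z ∈ W N, P z = 0 → z ∈ U
  exists_sub_mem_W : ∀ N, 0 < N → ∀ z, ∃ δ, z - diag δ ∈ W N
  exists_isCompact : ∀ R : ℝ, ∃ K, IsCompact K ∧ ∀ z ∈ W 1, ‖P z‖ ≤ R → z ∈ K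

namespace AdelicLattice

variable {A D ι : Type*} [Ring A] [TopologicalSpace A] [DivisionRing D] [Fintype ι]
  (L : AdelicLattice A D ι)

/-- The component of `z` outside the archimedean places. -/
def fin : A →+ A := AddMonoidHom.id A - L.s.comp L.P

lemma fin_apply (z : A) : L.fin z = z - L.s (L.P z) := rfl

lemma s_add_fin (z : A) : L.s (L.P z) + L.fin z = z := by rw [fin_apply]; abel

@[simp] lemma P_fin (z : A) : L.P (L.fin z) = 0 := by rw [fin_apply, map_sub, L.P_s, sub_self]

lemma fin_mem_W {N : ℕ} {z : A} : L.fin z ∈ L.W N ↔ z ∈ L.W N := by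
  rw [fin_apply, sub_eq_add_neg, AddSubgroup.add_mem_cancel_right _ (neg_mem (L.s_mem_W N _))]

lemma fin_eq_self {z : A} (hz : L.P z = 0) : L.fin z = z := by
  rw [fin_apply, hz, map_zero, sub_zero]

lemma mul_s (z : A) (r : EuclideanSpace ℝ ι) : z * L.s r = L.s (L.P (z * L.s r)) := by
  rw [L.s_P_mul', L.P_s]

lemma mul_s' (z : A) (r : EuclideanSpace ℝ ι) : z * L.s r = L.s (L.P z) * L.s r := by
  rw [L.mul_s z r, L.s_P_mul]

/-- The archimedean and finite parts annihilate each other: `s (P (s r * w))` can be evaluated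
through either factor, by `s_P_mul` or by `s_P_mul'`. -/
lemma s_mul_fin (r : EuclideanSpace ℝ ι) {w : A} (hw : L.P w = 0) : L.s r * w = 0 := by
  have h := L.s_P_mul (L.s r) w
  rw [L.s_P_mul', hw, map_zero, mul_zero, L.P_s] at h
  exact h.symm

/-- Multiplication of the archimedean component by `q`. -/
def scale (q : ℝ) (z : A) : A := L.s (q • L.P z) + L.fin z

@[simp] lemma P_scale (q : ℝ) (z : A) : L.P (L.scale q z) = q • L.P z := by
  rw [scale, map_add, L.P_s, P_fin, add_zero]

@[simp] lemma scale_zero (q : ℝ) : L.scale q 0 = 0 := by simp [scale]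

@[simp] lemma scale_one (z : A) : L.scale 1 z = z := by rw [scale, one_smul, s_add_fin]

lemma scale_sub_mem_W {N : ℕ} {q : ℝ} {z x : A} : L.scale q z - x ∈ L.W N ↔ z - x ∈ L.W N := by
  have : L.scale q z - x = L.s (q • L.P z - L.P z) + (z - x) := by
    rw [scale, fin_apply, map_sub]; abel
  rw [this, AddSubgroup.add_mem_cancel_left _ (L.s_mem_W N _)]

lemma scale_mul_fin (q : ℝ) (z : A) {w : A} (hw : L.P w = 0) : L.scale q z * w = z * w := by
  rw [scale, add_mul, L.s_mul_fin _ hw, zero_add, fin_apply, sub_mul, L.s_mul_fin _ hw, sub_zero]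

section Characters

/-- No small subgroups: for suitable M the finite part of W M is a subgroup that χ maps into the
ball of radius 1/2 about 1, so its image is trivial. -/
lemma exists_char_eq_one (χ : AddChar A ℂ) (hc : Continuous χ) :
    ∃ M, 0 < M ∧ ∀ z ∈ L.W M, L.P z = 0 → χ z = 1 := by
  have hU : χ ⁻¹' Metric.closedBall 1 (1 / 2) ∈ nhds (0 : A) := by
    apply hc.continuousAt.preimage_mem_nhds
    rw [χ.map_zero_eq_one]
    exact Metric.closedBall_mem_nhds _ (by norm_num)
  obtain ⟨M, hM, h⟩ := L.exists_W_subset _ hU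
  refine ⟨M, hM, fun z hz hP => eq_one_of_forall_norm_pow_sub_one_le fun k => ?_⟩
  have := h (k • z) (AddSubgroup.nsmul_mem _ hz k) (by rw [map_nsmul, hP, nsmul_zero])
  rw [Set.mem_preimage, AddChar.map_nsmul_eq_pow, mem_closedBall_iff_norm] at this
  exact this

/-- If δ has coordinates in Mℤ, then χ kills both δ and its finite part, hence also its archimedean
part. So r ↦ χ(s r) is trivial on Mℤ^ι, and such a character has a rational frequency. -/
lemma exists_ratVec (χ : AddChar A ℂ) (hc : Continuous χ) (hD : ∀ δ, χ (L.diag δ) = 1) :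
    ∃ v : ι → ℚ, ∀ r, χ (L.s r) = 𝐞 (inner ℝ (ratVec v) r) := by
  obtain ⟨M, hM, h⟩ := L.exists_char_eq_one χ hc
  obtain ⟨a, ha⟩ := exists_vec_of_continuous_char (φ := fun r => χ (L.s r))
    (hc.comp L.continuous_s) (fun x y => by rw [map_add, AddChar.map_add_eq_mul])
    (by rw [map_zero, AddChar.map_zero_eq_one]) hM (fun k => by
      set δ := L.coord.symm fun i => (M * k i : ℚ) with hδ
      have hmem : L.diag δ ∈ L.W M := (L.diag_mem_W M hM δ).mpr ⟨k, fun i => by simp [hδ]⟩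
      have hfin := h _ (L.fin_mem_W.mpr hmem) (L.P_fin _)
      have hPδ : L.P (L.diag δ) = (M : ℝ) • intVec k := by
        rw [L.P_diag, hδ]
        ext i
        simp
      have := hD δ
      rwa [← L.s_add_fin (L.diag δ), AddChar.map_add_eq_mul, hfin, mul_one, hPδ] at this)
  refine ⟨fun i => a i / M, fun r => ?_⟩
  rw [ha]
  congr 4
  ext i
  simp [div_eq_inv_mul]

variable {Ψ : AddChar A ℂ} (hc : Continuous Ψ) (hD : ∀ δ, Ψ (L.diag δ) = 1)

include hc hD

/-- By approximation every z is an element of D plus an archimedean vector plus an element of the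
finite part of W M, and on each of the three the character has absolute value 1. -/
lemma norm_char_eq_one (z : A) : ‖Ψ z‖ = 1 := by
  obtain ⟨M, hM, h⟩ := L.exists_char_eq_one Ψ hc
  obtain ⟨v, hv⟩ := L.exists_ratVec Ψ hc hD
  obtain ⟨δ, hδ⟩ := L.exists_sub_mem_W M hM z
  have : z = L.diag δ + (L.s (L.P (z - L.diag δ)) + L.fin (z - L.diag δ)) := by
    rw [L.s_add_fin]; abel
  rw [this, AddChar.map_add_eq_mul, AddChar.map_add_eq_mul, hD, hv,
    h _ (L.fin_mem_W.mpr hδ) (L.P_fin _), one_mul, mul_one, Circle.norm_coe]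

omit hc hD

variable [IsTopologicalRing A] (hne : Ψ ≠ 1)

lemma continuous_mulLeftChar (hc : Continuous Ψ) (y : A) : Continuous (mulLeftChar Ψ y) :=
  hc.comp (continuous_const_mul y)

lemma continuous_mulRightChar (hc : Continuous Ψ) (y : A) : Continuous (mulRightChar Ψ y) :=
  hc.comp (continuous_mul_const y)

include hc hD hne

/-- The identification of `D` with its dual in rational coordinates. -/
lemma exists_dual : ∃ T : D ≃+ (ι → ℚ),
    ∀ δ r, Ψ (L.diag δ * L.s r) = 𝐞 (inner ℝ (ratVec (T δ)) r) := by
  have h : ∀ δ, ∃ v : ι → ℚ, ∀ r, Ψ (L.diag δ * L.s r) = 𝐞 (inner ℝ (ratVec v) r) := fun δ =>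
    L.exists_ratVec (mulLeftChar Ψ (L.diag δ)) (continuous_mulLeftChar hc _) fun δ' => by
      rw [mulLeftChar_apply, ← map_mul, hD]
  choose T₀ hT₀ using h
  let T₁ : D →+ (ι → ℚ) := AddMonoidHom.mk' T₀ fun x y => by
    apply ratVec_injective
    apply fourierChar_inner_ext
    intro r
    rw [← hT₀, ratVec_add, inner_add_left, AddChar.map_add_eq_mul, Circle.coe_mul, ← hT₀, ← hT₀,
      map_add, add_mul, AddChar.map_add_eq_mul]
  -- If δ ≠ 0 had zero dual vector, then Ψ would vanish on all archimedean vectors s r = δ · (δ⁻¹ s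
  -- r), here in the sense of being equal to 1, and then by approximation on all of A.
  have hinj : Function.Injective T₁ := by
    rw [injective_iff_map_eq_zero]
    intro δ hδ
    by_contra hδ0
    apply hne
    have h1 : ∀ r, Ψ (L.s r) = 1 := by
      intro r
      have h2 : L.s r = L.diag δ * L.s (L.P (L.diag δ⁻¹ * L.s r)) := by
        rw [← L.mul_s, ← mul_assoc, ← map_mul, mul_inv_cancel₀ hδ0, map_one, one_mul]
      rw [h2, hT₀, show T₀ δ = 0 from hδ, ratVec_zero, inner_zero_left]
      simp
    obtain ⟨M, hM, h⟩ := L.exists_char_eq_one Ψ hc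
    ext z
    obtain ⟨δ, hδ⟩ := L.exists_sub_mem_W M hM z
    have : z = L.diag δ + (L.s (L.P (z - L.diag δ)) + L.fin (z - L.diag δ)) := by
      rw [L.s_add_fin]; abel
    rw [this, AddChar.map_add_eq_mul, AddChar.map_add_eq_mul, hD, h1,
      h _ (L.fin_mem_W.mpr hδ) (L.P_fin _)]
    simp
  -- An additive map between ℚ-vector spaces is ℚ-linear, and an injective endomorphism in finite
  -- dimension is surjective.
  have hsurj : Function.Surjective T₁ := by
    let T₂ : (ι → ℚ) →ₗ[ℚ] (ι → ℚ) := (T₁.comp L.coord.symm.toAddMonoidHom).toRatLinearMap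
    have : Function.Injective T₂ := hinj.comp L.coord.symm.injective
    have hs := LinearMap.injective_iff_surjective.mp this
    intro v
    obtain ⟨w, hw⟩ := hs v
    exact ⟨L.coord.symm w, hw⟩
  exact ⟨AddEquiv.ofBijective T₁ ⟨hinj, hsurj⟩, hT₀⟩

end Characters

end AdelicLattice

end NonabelianDelta
end

/-! ### Duality: orthogonality relations and the archimedean pairing. -/

noncomputable section
namespace NonabelianDelta

open scoped FourierTransform

/-- A nontrivial continuous additive character of `A`, trivial on `D`, together with the resulting
identification `T` of `D` with its dual in rational coordinates. -/
structure DualityChar {A D ι : Type*} [Ring A] [TopologicalSpace A] [DivisionRing D] [Fintype ι]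
    (L : AdelicLattice A D ι) where
  char : AddChar A ℂ
  continuous_char : Continuous char
  char_diag : ∀ δ, char (L.diag δ) = 1
  T : D ≃+ (ι → ℚ)
  char_diag_mul_s : ∀ δ r, char (L.diag δ * L.s r) = 𝐞 (inner ℝ (ratVec (T δ)) r)

namespace AdelicLattice

variable {A D ι : Type*} [Ring A] [TopologicalSpace A] [DivisionRing D] [Fintype ι]
  {L : AdelicLattice A D ι} (X : DualityChar L)

lemma norm_char (z : A) : ‖X.char z‖ = 1 := L.norm_char_eq_one X.continuous_char X.char_diag z

lemma char_sub (x y : A) : X.char (x - y) = X.char x * (X.char y)⁻¹ := by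
  have h : X.char y ≠ 0 := fun h => by have := norm_char X y; rw [h, norm_zero] at this; norm_num at this
  rw [eq_mul_inv_iff_mul_eq₀ h, ← AddChar.map_add_eq_mul, sub_add_cancel]

/-- The character is trivial on δβ, so its finite part at δβ is the inverse of its archimedean part.
-/
lemma char_diag_mul_fin (δ β : D) : X.char (L.diag δ * L.fin (L.diag β))
    = 𝐞 (-inner ℝ (ratVec (X.T δ)) (ratVec (L.coord β))) := by
  rw [fin_apply, mul_sub, char_sub, ← map_mul, X.char_diag, X.char_diag_mul_s, L.P_diag, one_mul,
    AddChar.map_neg_eq_inv, Circle.coe_inv]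

lemma fourierChar_eq_one_iff {t : ℝ} : (𝐞 t : ℂ) = 1 ↔ ∃ n : ℤ, t = n := by
  rw [Real.fourierChar_apply, Complex.exp_eq_one_iff]
  refine exists_congr fun n => ⟨fun h => ?_, fun h => ?_⟩
  · have h3 : (2 * Real.pi * Complex.I) * (t : ℂ) = (2 * Real.pi * Complex.I) * (n : ℂ) := by
      push_cast at h
      linear_combination h
    exact_mod_cast mul_left_cancel₀ Complex.two_pi_I_ne_zero h3
  · rw [h]; push_cast; ring

lemma inner_ratVec_intVec (v : ι → ℚ) (k : ι → ℤ) :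
    (inner ℝ (ratVec v) (intVec k) : ℝ) = ∑ i, (v i : ℝ) * k i := by
  rw [PiLp.inner_apply]
  exact Finset.sum_congr rfl fun i _ => by simp [mul_comm]

variable [IsTopologicalRing A]

/-- `diag δ` is orthogonal to the non-archimedean part of `W N` iff its dual coordinates lie in
`N⁻¹ ℤ`. -/
lemma char_diag_mul_eq_one_iff {N : ℕ} (hN : 0 < N) (δ : D) :
    (∀ w ∈ L.W N, L.P w = 0 → X.char (L.diag δ * w) = 1) ↔
      ∃ m : ι → ℤ, ∀ i, (N : ℚ) * X.T δ i = m i := by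
  classical
  constructor
  · intro h
    have hi : ∀ i, ∃ m : ℤ, (N : ℚ) * X.T δ i = m := by
      intro i
      set β := L.coord.symm fun j => (N : ℚ) * (Pi.single i 1 : ι → ℤ) j with hβ
      have hmem : L.diag β ∈ L.W N := (L.diag_mem_W N hN β).mpr ⟨Pi.single i 1, fun j => by simp [hβ]⟩
      have := h _ (L.fin_mem_W.mpr hmem) (L.P_fin _)
      rw [char_diag_mul_fin, fourierChar_eq_one_iff] at this
      obtain ⟨n, hn⟩ := this
      refine ⟨-n, ?_⟩
      have h2 : ratVec (L.coord β) = (N : ℝ) • intVec (Pi.single i 1) := by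
        rw [hβ, AddEquiv.apply_symm_apply]
        ext j
        by_cases hj : j = i
        · subst hj; simp
        · simp [hj]
      rw [h2, inner_smul_right, inner_ratVec_intVec] at hn
      simp only [Pi.single_apply, Int.cast_ite, Int.cast_one, Int.cast_zero, mul_ite, mul_one,
        mul_zero, Finset.sum_ite_eq', Finset.mem_univ, if_true] at hn
      have : (N : ℝ) * (X.T δ i : ℝ) = ((-n : ℤ) : ℝ) := by push_cast; linarith
      exact_mod_cast this
    choose m hm using hi
    exact ⟨m, hm⟩
  · rintro ⟨m, hm⟩ w hw hPw
    obtain ⟨M, hM, h⟩ := L.exists_char_eq_one (mulLeftChar X.char (L.diag δ))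
      (continuous_mulLeftChar X.continuous_char _)
    -- The modulus N·M serves two purposes: it keeps β in W N, so that β has coordinates in Nℤ, and
    -- it puts the error in W M, where z ↦ char(δz) is trivial on the finite part.
    obtain ⟨β, hβ⟩ := L.exists_sub_mem_W (N * M) (Nat.mul_pos hN hM) w
    have hβN : L.diag β ∈ L.W N := by
      have := sub_mem hw (L.W_le N (N * M) (dvd_mul_right _ _) hβ)
      rwa [sub_sub_cancel] at this
    obtain ⟨k, hk⟩ := (L.diag_mem_W N hN β).mp hβN
    have h1 : L.fin (w - L.diag β) ∈ L.W M :=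
      L.fin_mem_W.mpr (L.W_le M (N * M) (dvd_mul_left _ _) hβ)
    have h2 := h _ h1 (L.P_fin _)
    rw [mulLeftChar_apply, map_sub, L.fin_eq_self hPw, mul_sub, char_sub, char_diag_mul_fin] at h2
    have h3 : (𝐞 (-inner ℝ (ratVec (X.T δ)) (ratVec (L.coord β))) : ℂ) = 1 := by
      rw [fourierChar_eq_one_iff]
      refine ⟨-∑ i, m i * k i, ?_⟩
      have : ratVec (L.coord β) = (N : ℝ) • intVec k := by ext i; simp [hk]
      rw [this, inner_smul_right, inner_ratVec_intVec]
      push_cast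
      rw [Finset.mul_sum]
      congr 1
      refine Finset.sum_congr rfl fun i _ => ?_
      have : (N : ℝ) * (X.T δ i : ℝ) = m i := by exact_mod_cast hm i
      rw [← this]; ring
    rwa [h3, inv_one, mul_one] at h2

/-- The real bilinear pairing that the character induces on archimedean coordinates. -/
lemma exists_pairing : ∃ B : EuclideanSpace ℝ ι ≃L[ℝ] EuclideanSpace ℝ ι,
    (∀ y r, X.char (y * L.s r) = 𝐞 (inner ℝ (B (L.P y)) r)) ∧
    ∀ δ, B (L.P (L.diag δ)) = ratVec (X.T δ) := by
  classical
  set l := ratVec (X.T 1) with hl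
  have hchar : ∀ r, X.char (L.s r) = 𝐞 (inner ℝ l r) := fun r => by
    have := X.char_diag_mul_s 1 r
    rwa [map_one, one_mul] at this
  let Rl : EuclideanSpace ℝ ι → (EuclideanSpace ℝ ι →L[ℝ] EuclideanSpace ℝ ι) := fun p =>
    AddMonoidHom.toRealLinearMap
      ((L.P.comp (AddMonoidHom.mulLeft (L.s p))).comp L.s)
      (L.continuous_P.comp ((continuous_const_mul _).comp L.continuous_s))
  have hRl : ∀ p r, Rl p r = L.P (L.s p * L.s r) := fun p r => rfl
  let Rr : EuclideanSpace ℝ ι → (EuclideanSpace ℝ ι →L[ℝ] EuclideanSpace ℝ ι) := fun r =>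
    AddMonoidHom.toRealLinearMap
      ((L.P.comp (AddMonoidHom.mulRight (L.s r))).comp L.s)
      (L.continuous_P.comp ((continuous_mul_const _).comp L.continuous_s))
  have hRr : ∀ p r, Rr r p = L.P (L.s p * L.s r) := fun p r => rfl
  -- All values of the character on the archimedean part come from the vector `l` through
  -- multiplication, so the pairing is (p, r) ↦ ⟨l, p·r⟩ written as an inner product.
  let B₀ : EuclideanSpace ℝ ι →ₗ[ℝ] EuclideanSpace ℝ ι :=
    { toFun := fun p => WithLp.toLp 2 fun i => inner ℝ l (Rr (EuclideanSpace.single i 1) p)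
      map_add' := fun p q => by ext i; simp [inner_add_right]
      map_smul' := fun c p => by ext i; simp [inner_smul_right] }
  have hB₀ : ∀ p r, (inner ℝ (B₀ p) r : ℝ) = inner ℝ l (L.P (L.s p * L.s r)) := by
    intro p r
    have hr : r = ∑ i, (r i) • EuclideanSpace.single i (1 : ℝ) := by
      ext j
      simp [Finset.sum_apply, Pi.single_apply]
    rw [← hRl]
    conv_rhs => rw [hr]
    rw [map_sum, inner_sum, PiLp.inner_apply]
    refine Finset.sum_congr rfl fun i _ => ?_
    rw [map_smul, inner_smul_right, hRl, ← hRr]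
    simp [B₀]
  have h1 : ∀ y r, X.char (y * L.s r) = 𝐞 (inner ℝ (B₀ (L.P y)) r) := by
    intro y r
    rw [hB₀, L.mul_s' y r, L.mul_s, hchar, L.P_s]
  have h2 : ∀ δ, B₀ (L.P (L.diag δ)) = ratVec (X.T δ) := by
    intro δ
    apply fourierChar_inner_ext
    intro r
    rw [← h1, X.char_diag_mul_s]
  -- Every standard basis vector is a dual vector `T δ`, so surjectivity of `T` gives nondegeneracy.
  have hsurj : Function.Surjective B₀ := by
    rw [← LinearMap.range_eq_top, eq_top_iff]
    intro r _
    have hr : r = ∑ i, (r i) • EuclideanSpace.single i (1 : ℝ) := by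
      ext j
      simp [Finset.sum_apply, Pi.single_apply]
    rw [hr]
    refine Submodule.sum_mem _ fun i _ => Submodule.smul_mem _ _ ?_
    refine ⟨L.P (L.diag (X.T.symm (Pi.single i 1))), ?_⟩
    rw [h2, AddEquiv.apply_symm_apply]
    ext j
    by_cases hj : j = i
    · subst hj; simp
    · simp [hj]
  have hinj := LinearMap.injective_iff_surjective.mpr hsurj
  exact ⟨(LinearEquiv.ofBijective B₀ ⟨hinj, hsurj⟩).toContinuousLinearEquiv, h1, h2⟩

end AdelicLattice

end NonabelianDelta
end

/-! ### The functions g ⊗ 1_{x + W N}: integration and Fourier transform. -/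

noncomputable section
namespace NonabelianDelta

open scoped FourierTransform

namespace AdelicLattice

variable {A D ι : Type*} [Ring A] [TopologicalSpace A] [DivisionRing D] [Fintype ι]
  (L : AdelicLattice A D ι)

/-- The function `g ⊗ 1_{x + W N}`. -/
def basic (g : EuclideanSpace ℝ ι → ℂ) (x : D) (N : ℕ) : A → ℂ :=
  Set.indicator {z | z - L.diag x ∈ L.W N} fun z => g (L.P z)

lemma basic_of_mem {g : EuclideanSpace ℝ ι → ℂ} {x : D} {N : ℕ} {z : A}
    (h : z - L.diag x ∈ L.W N) : L.basic g x N z = g (L.P z) :=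
  Set.indicator_of_mem (s := {z | z - L.diag x ∈ L.W N}) h _

lemma basic_of_notMem {g : EuclideanSpace ℝ ι → ℂ} {x : D} {N : ℕ} {z : A}
    (h : z - L.diag x ∉ L.W N) : L.basic g x N z = 0 :=
  Set.indicator_of_notMem (s := {z | z - L.diag x ∈ L.W N}) h _

/-- Translating by the finite part of x moves the coset of W N without touching the argument of g,
so statements about general x reduce to x = 0. -/
lemma basic_add_fin (g : EuclideanSpace ℝ ι → ℂ) (x : D) (N : ℕ) (z : A) :
    L.basic g x N (z + L.fin (L.diag x)) = L.basic g 0 N z := by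
  have hP : L.P (z + L.fin (L.diag x)) = L.P z := by rw [map_add, L.P_fin, add_zero]
  have hiff : z + L.fin (L.diag x) - L.diag x ∈ L.W N ↔ z - L.diag 0 ∈ L.W N := by
    have : z + L.fin (L.diag x) - L.diag x = -L.s (L.P (L.diag x)) + z := by
      rw [fin_apply]; abel
    rw [this, map_zero, sub_zero, AddSubgroup.add_mem_cancel_left _ (neg_mem (L.s_mem_W N _))]
  by_cases h : z - L.diag 0 ∈ L.W N
  · rw [L.basic_of_mem h, L.basic_of_mem (hiff.mpr h), hP]
  · rw [L.basic_of_notMem h, L.basic_of_notMem (fun h' => h (hiff.mp h'))]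

lemma basic_zero_eq (G : EuclideanSpace ℝ ι → ℂ) (N : ℕ) :
    L.basic G 0 N = Set.indicator (L.W N : Set A) fun z => G (L.P z) := by
  unfold basic
  congr 1
  ext z
  simp

section Measure

variable [MeasurableSpace A] [BorelSpace A] (μ : Measure A)

/-- The measure on archimedean coordinates induced by the slab `W N`. -/
def archMeasure (N : ℕ) : Measure (EuclideanSpace ℝ ι) := (μ.restrict (L.W N)).map L.P

lemma measurable_P : Measurable L.P := L.continuous_P.measurable

lemma measurableSet_W {N : ℕ} (hN : 0 < N) : MeasurableSet (L.W N : Set A) :=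
  (L.isOpen_W N hN).measurableSet

lemma archMeasure_apply {N : ℕ} {B : Set (EuclideanSpace ℝ ι)} (hB : MeasurableSet B) :
    L.archMeasure μ N B = μ (L.P ⁻¹' B ∩ L.W N) := by
  rw [archMeasure, Measure.map_apply L.measurable_P hB,
    Measure.restrict_apply (L.measurable_P hB)]

variable [IsTopologicalRing A] [μ.IsAddHaarMeasure]

/-- Invariance holds because W N absorbs archimedean translations, positivity because W N is open,
and finiteness because the part of W 1 over a ball lies in a compact set. -/
lemma isAddHaarMeasure_archMeasure {N : ℕ} (hN : 0 < N) :
    (L.archMeasure μ N).IsAddHaarMeasure where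
  lt_top_of_isCompact := by
    intro C hC
    obtain ⟨R, hR⟩ := hC.isBounded.subset_closedBall 0
    obtain ⟨K, hK, h⟩ := L.exists_isCompact R
    calc L.archMeasure μ N C ≤ L.archMeasure μ N (Metric.closedBall 0 R) := measure_mono hR
      _ = μ (L.P ⁻¹' Metric.closedBall 0 R ∩ L.W N) :=
        L.archMeasure_apply μ Metric.isClosed_closedBall.measurableSet
      _ ≤ μ K := measure_mono fun z hz =>
        h z (L.W_le 1 N (one_dvd _) hz.2) (mem_closedBall_zero_iff.mp hz.1)
      _ < ⊤ := hK.measure_lt_top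
  map_add_left_eq_self := by
    intro r
    ext B hB
    rw [Measure.map_apply (measurable_const_add r) hB, L.archMeasure_apply μ hB,
      L.archMeasure_apply μ (measurable_const_add r hB),
      ← measure_preimage_add μ (L.s r) (L.P ⁻¹' B ∩ L.W N)]
    congr 1
    ext z
    simp only [Set.mem_inter_iff, Set.mem_preimage, map_add, L.P_s, SetLike.mem_coe]
    rw [AddSubgroup.add_mem_cancel_left _ (L.s_mem_W N r)]
  open_pos := by
    intro U hU ⟨r, hr⟩
    rw [L.archMeasure_apply μ hU.measurableSet]
    refine IsOpen.measure_ne_zero μ ((hU.preimage L.continuous_P).inter (L.isOpen_W N hN)) ?_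
    exact ⟨L.s r, by simpa [L.P_s] using hr, L.s_mem_W N r⟩

/-- The density with respect to Lebesgue measure of `archMeasure`. -/
def density (N : ℕ) : ℝ := (L.archMeasure μ N (Metric.ball 0 1)).toReal /
  (volume (Metric.ball (0 : EuclideanSpace ℝ ι) 1)).toReal

lemma archMeasure_eq {N : ℕ} (hN : 0 < N) :
    0 < L.density μ N ∧ L.archMeasure μ N = ENNReal.ofReal (L.density μ N) • volume := by
  have := L.isAddHaarMeasure_archMeasure μ hN
  obtain ⟨c, hc0, hctop, hc⟩ : ∃ c : ENNReal, c ≠ 0 ∧ c ≠ ⊤ ∧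
      L.archMeasure μ N = c • (volume : Measure (EuclideanSpace ℝ ι)) :=
    ⟨Measure.addHaarScalarFactor (L.archMeasure μ N) volume,
      ENNReal.coe_ne_zero.mpr (Measure.addHaarScalarFactor_pos_of_isAddHaarMeasure _ _).ne',
      ENNReal.coe_ne_top, Measure.isAddLeftInvariant_eq_smul _ _⟩
  have hv0 : (volume (Metric.ball (0 : EuclideanSpace ℝ ι) 1)).toReal ≠ 0 :=
    (ENNReal.toReal_pos (Metric.measure_ball_pos _ _ one_pos).ne' measure_ball_lt_top.ne).ne'
  have hd : L.density μ N = c.toReal := by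
    rw [density, hc, Measure.smul_apply, smul_eq_mul, ENNReal.toReal_mul, mul_div_cancel_right₀ _ hv0]
  rw [hd]
  exact ⟨ENNReal.toReal_pos hc0 hctop, by rw [ENNReal.ofReal_toReal hctop, hc]⟩

lemma density_pos {N : ℕ} (hN : 0 < N) : 0 < L.density μ N := (L.archMeasure_eq μ hN).1

lemma integral_basic_zero {G : EuclideanSpace ℝ ι → ℂ} (hG : Continuous G) {N : ℕ} (hN : 0 < N) :
    ∫ z, L.basic G 0 N z ∂μ = L.density μ N * ∫ r, G r := by
  rw [basic_zero_eq, integral_indicator (L.measurableSet_W hN),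
    ← integral_map (μ := μ.restrict (L.W N)) (φ := L.P) L.measurable_P.aemeasurable
      hG.aestronglyMeasurable]
  change ∫ r, G r ∂(L.archMeasure μ N) = _
  rw [(L.archMeasure_eq μ hN).2, integral_smul_measure,
    ENNReal.toReal_ofReal (L.density_pos μ hN).le, Complex.real_smul]

lemma integrable_basic_zero {G : EuclideanSpace ℝ ι → ℂ} (hG : Integrable G) {N : ℕ}
    (hN : 0 < N) : Integrable (L.basic G 0 N) μ := by
  rw [basic_zero_eq, integrable_indicator_iff (L.measurableSet_W hN)]
  have h : Integrable G (L.archMeasure μ N) := by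
    rw [(L.archMeasure_eq μ hN).2]
    exact hG.smul_measure ENNReal.ofReal_ne_top
  exact h.comp_measurable L.measurable_P

lemma integrable_basic {G : EuclideanSpace ℝ ι → ℂ} (hG : Integrable G) (x : D) {N : ℕ}
    (hN : 0 < N) : Integrable (L.basic G x N) μ := by
  have h := (L.integrable_basic_zero μ hG hN).comp_sub_right (L.fin (L.diag x))
  refine h.congr (Filter.Eventually.of_forall fun z => ?_)
  simp only
  rw [← L.basic_add_fin G x N, sub_add_cancel]

variable {L} (X : DualityChar L)

/-- The Fourier transform on `A`. -/
def ft (f : A → ℂ) (y : A) : ℂ := ∫ z, f z * X.char (y * z) ∂μ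

omit [μ.IsAddHaarMeasure] in
lemma integrable_mul_char {f : A → ℂ} (hf : Integrable f μ) (y : A) :
    Integrable (fun z => f z * X.char (y * z)) μ := by
  refine hf.mul_bdd (c := 1) ?_ (Filter.Eventually.of_forall fun z => (norm_char X _).le)
  exact (continuous_mulLeftChar X.continuous_char y).measurable.aestronglyMeasurable

lemma ft_basic (g : EuclideanSpace ℝ ι → ℂ) (x : D) (N : ℕ) (y : A) :
    ft μ X (L.basic g x N) y
      = X.char (y * L.fin (L.diag x)) * ft μ X (L.basic g 0 N) y := by
  unfold ft
  rw [← integral_add_right_eq_self _ (L.fin (L.diag x)), ← integral_const_mul]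
  refine integral_congr_ae (Filter.Eventually.of_forall fun z => ?_)
  simp only
  rw [L.basic_add_fin, mul_add, AddChar.map_add_eq_mul]
  ring

/-- When y is orthogonal to the finite part of W N, the character depends only on the archimedean
coordinate along W N, so the integral is a Euclidean Fourier transform. The sign comes from the
opposite sign conventions of `ft` and `𝓕`. -/
lemma ft_basic_zero_of_forall (g : 𝓢(EuclideanSpace ℝ ι, ℂ))
    {B : EuclideanSpace ℝ ι ≃L[ℝ] EuclideanSpace ℝ ι}
    (hB : ∀ y r, X.char (y * L.s r) = 𝐞 (inner ℝ (B (L.P y)) r)) {N : ℕ} (hN : 0 < N) {y : A}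
    (hy : ∀ w ∈ L.W N, L.P w = 0 → X.char (y * w) = 1) :
    ft μ X (L.basic g 0 N) y = L.density μ N * 𝓕 g (-B (L.P y)) := by
  have h : ∀ z, L.basic g 0 N z * X.char (y * z)
      = L.basic (fun r => g r * X.char (y * L.s r)) 0 N z := by
    intro z
    by_cases hz : z - L.diag 0 ∈ L.W N
    · rw [L.basic_of_mem hz, L.basic_of_mem hz]
      congr 1
      rw [map_zero, sub_zero] at hz
      conv_lhs => rw [← L.s_add_fin z, mul_add, AddChar.map_add_eq_mul,
        hy _ (L.fin_mem_W.mpr hz) (L.P_fin _), mul_one]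
    · rw [L.basic_of_notMem hz, L.basic_of_notMem hz, zero_mul]
  unfold ft
  simp only [h]
  rw [L.integral_basic_zero μ _ hN]
  · congr 1
    rw [SchwartzMap.fourier_coe, Real.fourier_eq]
    refine integral_congr_ae (Filter.Eventually.of_forall fun r => ?_)
    simp only
    rw [hB, inner_neg_right, neg_neg, real_inner_comm, Circle.smul_def, smul_eq_mul, mul_comm]
  · simp only [hB]
    exact g.continuous.mul (by fun_prop)

/-- Translation by w preserves the function but multiplies the integral by a number different from
1. -/
lemma ft_basic_zero_of_exists (g : EuclideanSpace ℝ ι → ℂ) {N : ℕ} {y w : A} (hw : w ∈ L.W N)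
    (hPw : L.P w = 0) (hyw : X.char (y * w) ≠ 1) : ft μ X (L.basic g 0 N) y = 0 := by
  have h : ft μ X (L.basic g 0 N) y = X.char (y * w) * ft μ X (L.basic g 0 N) y := by
    conv_lhs => rw [ft, ← integral_add_right_eq_self _ w]
    rw [ft, ← integral_const_mul]
    refine integral_congr_ae (Filter.Eventually.of_forall fun z => ?_)
    simp only
    have : L.basic g 0 N (z + w) = L.basic g 0 N z := by
      have hiff : z + w - L.diag 0 ∈ L.W N ↔ z - L.diag 0 ∈ L.W N := by
        rw [map_zero, sub_zero, sub_zero, AddSubgroup.add_mem_cancel_right _ hw]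
      by_cases hz : z - L.diag 0 ∈ L.W N
      · rw [L.basic_of_mem hz, L.basic_of_mem (hiff.mpr hz), map_add, hPw, add_zero]
      · rw [L.basic_of_notMem hz, L.basic_of_notMem (fun h' => hz (hiff.mp h'))]
    rw [this, mul_add, AddChar.map_add_eq_mul]
    ring
  by_contra h0
  exact hyw (mul_right_cancel₀ h0 (by rw [one_mul]; exact h.symm))

end Measure

end AdelicLattice

end NonabelianDelta
end

/-! ### Decomposition into cosets of W M, and stability of the Poisson formula under linear
combinations. -/

noncomputable section
namespace NonabelianDelta

open scoped FourierTransform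

namespace AdelicLattice

variable {A D ι : Type*} [Ring A] [TopologicalSpace A] [DivisionRing D] [Fintype ι]
  (L : AdelicLattice A D ι)

section Partition

/-- The element of `D` with coordinates `a / K`. -/
def rep (K : ℕ) (a : ι → ℕ) : D := L.coord.symm fun i => (a i : ℚ) / K

lemma coord_rep (K : ℕ) (a : ι → ℕ) (i : ι) : L.coord (L.rep K a) i = (a i : ℚ) / K := by
  simp [rep]

/-- The quotient of K⁻¹ W 1 by W M is that of K⁻¹ℤ^ι by Mℤ^ι, by strong approximation; it is
represented by a/K with 0 ≤ a < KM in each coordinate. -/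
lemma existsUnique_rep {K M : ℕ} (hK : 0 < K) (hM : 0 < M) {z : A} (hz : K • z ∈ L.W 1) :
    ∃! a : ι → Fin (K * M), z - L.diag (L.rep K fun i => a i) ∈ L.W M := by
  have hKM : (0 : ℤ) < (K * M : ℕ) := by exact_mod_cast Nat.mul_pos hK hM
  have hKq : (K : ℚ) ≠ 0 := by exact_mod_cast hK.ne'
  obtain ⟨δ, hδ⟩ := L.exists_sub_mem_W M hM z
  have h1 : L.diag (K • δ) ∈ L.W 1 := by
    have : L.diag (K • δ) = K • z - K • (z - L.diag δ) := by rw [map_nsmul, smul_sub]; abel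
    rw [this]
    exact sub_mem hz (AddSubgroup.nsmul_mem _ (L.W_le 1 M (one_dvd _) hδ) K)
  obtain ⟨k, hk⟩ := (L.diag_mem_W 1 one_pos _).mp h1
  have hk' : ∀ i, L.coord δ i = k i / K := by
    intro i
    have := hk i
    rw [map_nsmul, Pi.smul_apply, nsmul_eq_mul, Nat.cast_one, one_mul] at this
    rw [eq_div_iff hKq, mul_comm, this]
  have ha : ∀ i, ∃ a : Fin (K * M), ((a : ℕ) : ℤ) = k i % (K * M : ℕ) := by
    intro i
    have h0 := Int.emod_nonneg (k i) hKM.ne'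
    have h2 := Int.emod_lt_of_pos (k i) hKM
    exact ⟨⟨(k i % (K * M : ℕ)).toNat, by omega⟩, by simp only; omega⟩
  choose a ha using ha
  refine ⟨a, ?_, ?_⟩
  · have h2 : L.diag (δ - L.rep K fun i => a i) ∈ L.W M := by
      refine (L.diag_mem_W M hM _).mpr ⟨fun i => k i / (K * M : ℕ), fun i => ?_⟩
      rw [map_sub, Pi.sub_apply, hk', coord_rep, ← sub_div, div_eq_iff hKq]
      have h3 := Int.emod_add_mul_ediv (k i) (K * M : ℕ)
      rw [← ha i] at h3
      have h4 : (k i : ℚ) = (a i : ℕ) + (K * M : ℕ) * (k i / (K * M : ℕ) : ℤ) := by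
        exact_mod_cast h3.symm
      rw [h4]
      push_cast
      ring
    have : z - L.diag (L.rep K fun i => a i) =
        (z - L.diag δ) + L.diag (δ - L.rep K fun i => a i) := by rw [map_sub]; abel
    simp only
    rw [this]
    exact add_mem hδ h2
  · intro b hb
    have h2 : L.diag (δ - L.rep K fun i => b i) ∈ L.W M := by
      have : L.diag (δ - L.rep K fun i => b i)
          = (z - L.diag (L.rep K fun i => b i)) - (z - L.diag δ) := by rw [map_sub]; abel
      rw [this]
      exact sub_mem hb hδ
    obtain ⟨l, hl⟩ := (L.diag_mem_W M hM _).mp h2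
    funext i
    have h3 := hl i
    rw [map_sub, Pi.sub_apply, hk', coord_rep, ← sub_div, div_eq_iff hKq] at h3
    have h4 : k i = (b i : ℕ) + (K * M : ℕ) * l i := by
      have : (k i : ℚ) = (b i : ℕ) + (K * M : ℕ) * l i := by push_cast; linear_combination h3
      exact_mod_cast this
    have h5 := ha i
    rw [h4, Int.add_mul_emod_self_left, Int.emod_eq_of_lt (by positivity)
      (by exact_mod_cast (b i).2)] at h5
    exact Fin.ext (by exact_mod_cast h5.symm)

-- The function h is constant on cosets of W M and lives on K⁻¹ W 1, which contains finitely many of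
-- them, each represented by an element of D.
open Classical in
lemma mul_eq_sum_basic (g : EuclideanSpace ℝ ι → ℂ) {h : A → ℂ} {K M : ℕ} (hK : 0 < K) (hM : 0 < M)
    (hinv : ∀ z, ∀ w ∈ L.W M, h (z + w) = h z) (hsupp : ∀ z, h z ≠ 0 → K • z ∈ L.W 1) (z : A) :
    g (L.P z) * h z = ∑ a : ι → Fin (K * M), h (L.diag (L.rep K fun i => a i)) *
      L.basic g (L.rep K fun i => a i) M z := by
  have hval : ∀ x, z - L.diag x ∈ L.W M → h (L.diag x) = h z := by
    intro x hx
    have := hinv (L.diag x) _ hx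
    rw [add_sub_cancel] at this
    exact this.symm
  by_cases hz : h z = 0
  · rw [hz, mul_zero, Finset.sum_eq_zero]
    intro a _
    by_cases ha : z - L.diag (L.rep K fun i => a i) ∈ L.W M
    · rw [hval _ ha, hz, zero_mul]
    · rw [L.basic_of_notMem ha, mul_zero]
  · obtain ⟨a, ha, huniq⟩ := L.existsUnique_rep hK hM (hsupp z hz)
    rw [Finset.sum_eq_single a]
    · rw [hval _ ha, L.basic_of_mem ha, mul_comm]
    · intro b _ hb
      rw [L.basic_of_notMem (fun h => hb (huniq b h)), mul_zero]
    · simp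

end Partition

variable [IsTopologicalRing A] [MeasurableSpace A] [BorelSpace A] (μ : Measure A)
  [μ.IsAddHaarMeasure]

lemma integral_basic {G : EuclideanSpace ℝ ι → ℂ} (hG : Continuous G) (x : D) {N : ℕ}
    (hN : 0 < N) : ∫ z, L.basic G x N z ∂μ = L.density μ N * ∫ r, G r := by
  rw [← L.integral_basic_zero μ hG hN, ← integral_add_right_eq_self _ (L.fin (L.diag x))]
  simp only [L.basic_add_fin]

/-- A smooth bump of radius 1/2 with value 1 at the origin sees no other integer point. It
normalizes comparisons of constants. -/
lemma exists_schwartz_bump : ∃ g : 𝓢(EuclideanSpace ℝ ι, ℂ), ∑' k : ι → ℤ, g (intVec k) = 1 ∧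
    ∫ r, g r ≠ 0 := by
  let b : ContDiffBump (0 : EuclideanSpace ℝ ι) := ⟨1 / 4, 1 / 2, by norm_num, by norm_num⟩
  have hcs : HasCompactSupport fun x => ((b x : ℝ) : ℂ) := 
    b.hasCompactSupport.comp_left (g := ((↑) : ℝ → ℂ)) Complex.ofReal_zero
  have hsm : ContDiff ℝ ((⊤ : ℕ∞) : WithTop ℕ∞) fun x => ((b x : ℝ) : ℂ) :=
    Complex.ofRealCLM.contDiff.comp b.contDiff
  refine ⟨hcs.toSchwartzMap hsm, ?_, ?_⟩
  · rw [tsum_eq_single 0]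
    · have : b (0 : EuclideanSpace ℝ ι) = 1 := b.one_of_mem_closedBall (by simp [b.rIn_pos.le])
      simp [intVec_zero, this]
    · intro k hk
      obtain ⟨i, hi⟩ := Function.ne_iff.mp hk
      have h1 : (1 : ℝ) ≤ ‖intVec k‖ := by
        have h2 := (norm_le_pi_norm (WithLp.ofLp (intVec k)) i).trans (norm_ofLp_le _)
        have h3 : (1 : ℝ) ≤ ‖(k i : ℝ)‖ := by
          rw [Real.norm_eq_abs, ← Int.cast_abs]
          exact_mod_cast Int.one_le_abs hi
        exact h3.trans h2
      have : b (intVec k) = 0 := b.zero_of_le_dist (by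
        rw [dist_zero_right]
        exact le_trans (by norm_num [b]) h1)
      simp [this]
  · have : ∫ r, ((b r : ℝ) : ℂ) = ((∫ r, b r : ℝ) : ℂ) := integral_ofReal
    simp only [HasCompactSupport.toSchwartzMap_toFun]
    change ∫ r, ((b r : ℝ) : ℂ) ≠ 0
    rw [this]
    exact_mod_cast b.integral_pos.ne'

/-- W 1 is the disjoint union of N^|ι| translates of W N; integrating a bump over both sides
compares the densities. -/
lemma density_one_eq {N : ℕ} (hN : 0 < N) :
    L.density μ 1 = (N : ℝ) ^ Fintype.card ι * L.density μ N := by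
  classical
  obtain ⟨g, -, hg⟩ := exists_schwartz_bump (ι := ι)
  have h : ∀ z, L.basic g 0 1 z = ∑ a : ι → Fin (1 * N), L.basic g (L.rep 1 fun i => a i) N z := by
    intro z
    have := L.mul_eq_sum_basic g (h := Set.indicator (L.W 1 : Set A) 1) one_pos hN
      (fun z w hw => by
        have hw1 := L.W_le 1 N (one_dvd _) hw
        have hiff : z + w ∈ (L.W 1 : Set A) ↔ z ∈ (L.W 1 : Set A) :=
          AddSubgroup.add_mem_cancel_right _ hw1
        by_cases hz : z ∈ (L.W 1 : Set A)
        · rw [Set.indicator_of_mem hz, Set.indicator_of_mem (hiff.mpr hz)]; rfl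
        · rw [Set.indicator_of_notMem hz, Set.indicator_of_notMem (fun h => hz (hiff.mp h))])
      (fun z hz => by
        rw [one_smul]
        exact Set.mem_of_indicator_ne_zero hz) z
    have hl : L.basic g 0 1 z = g (L.P z) * Set.indicator (L.W 1 : Set A) 1 z := by
      rw [L.basic_zero_eq]
      by_cases hz : z ∈ (L.W 1 : Set A)
      · rw [Set.indicator_of_mem hz, Set.indicator_of_mem hz, Pi.one_apply, mul_one]
      · rw [Set.indicator_of_notMem hz, Set.indicator_of_notMem hz, mul_zero]
    rw [hl, this]
    refine Finset.sum_congr rfl fun a _ => ?_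
    rw [Set.indicator_of_mem, Pi.one_apply, one_mul]
    exact (L.diag_mem_W 1 one_pos _).mpr ⟨fun i => (a i : ℕ), fun i => by rw [L.coord_rep]; simp⟩
  have h1 := L.integral_basic_zero μ g.continuous one_pos
  simp only [h] at h1
  rw [integral_finsetSum _ fun a _ => L.integrable_basic μ g.integrable _ hN] at h1
  simp only [L.integral_basic μ g.continuous _ hN, Finset.sum_const, nsmul_eq_mul] at h1
  rw [← mul_assoc] at h1
  have h2 := mul_right_cancel₀ hg h1
  simp only [Finset.card_univ, Fintype.card_pi, Fintype.card_fin, Finset.prod_const, one_mul] at h2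
  exact_mod_cast h2.symm

variable {L} (X : DualityChar L)

/-- `f` satisfies the Poisson summation formula for `D ⊆ A` with constant `c`, with rapid decay of
the nonzero frequencies under archimedean scaling. -/
structure SatisfiesPoisson (c : ℝ) (f : A → ℂ) : Prop where
  integrable : Integrable f μ
  hasSum : ∀ q : ℝ, 0 < q → ∃ S, HasSum (fun δ : D => f (L.scale q⁻¹ (L.diag δ))) S ∧
    HasSum (fun δ : D => ft μ X f (L.scale q (L.diag δ))) (c * (q⁻¹ : ℂ) ^ Fintype.card ι * S)
  decay : ∀ b : ℕ, Fintype.card ι < b → ∃ C : ℝ, ∀ q : ℝ, 0 < q →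
    ‖∑' δ : D, ft μ X f (L.scale q (L.diag δ)) - ft μ X f 0‖ ≤ C * (q ^ b)⁻¹

lemma SatisfiesPoisson.zero (c : ℝ) : SatisfiesPoisson μ X c 0 where
  integrable := integrable_zero _ _ _
  hasSum q hq := ⟨0, by simp, by simp [ft]⟩
  decay b hb := ⟨0, fun q hq => by simp [ft]⟩

variable {μ X}

lemma ft_add {f₁ f₂ : A → ℂ} (h₁ : Integrable f₁ μ) (h₂ : Integrable f₂ μ) (y : A) :
    ft μ X (f₁ + f₂) y = ft μ X f₁ y + ft μ X f₂ y := by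
  unfold ft
  rw [← integral_add (integrable_mul_char μ X h₁ y) (integrable_mul_char μ X h₂ y)]
  simp only [Pi.add_apply, add_mul]

lemma ft_smul (a : ℂ) (f : A → ℂ) (y : A) : ft μ X (a • f) y = a * ft μ X f y := by
  unfold ft
  rw [← integral_const_mul]
  simp only [Pi.smul_apply, smul_eq_mul, mul_assoc]

lemma SatisfiesPoisson.add {c : ℝ} {f₁ f₂ : A → ℂ} (h₁ : SatisfiesPoisson μ X c f₁)
    (h₂ : SatisfiesPoisson μ X c f₂) : SatisfiesPoisson μ X c (f₁ + f₂) where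
  integrable := h₁.integrable.add h₂.integrable
  hasSum q hq := by
    obtain ⟨S₁, ha₁, hb₁⟩ := h₁.hasSum q hq
    obtain ⟨S₂, ha₂, hb₂⟩ := h₂.hasSum q hq
    refine ⟨S₁ + S₂, ha₁.add ha₂, ?_⟩
    simp only [ft_add h₁.integrable h₂.integrable]
    rw [mul_add]
    exact hb₁.add hb₂
  decay b hb := by
    obtain ⟨C₁, hC₁⟩ := h₁.decay b hb
    obtain ⟨C₂, hC₂⟩ := h₂.decay b hb
    refine ⟨C₁ + C₂, fun q hq => ?_⟩
    obtain ⟨S₁, -, hb₁⟩ := h₁.hasSum q hq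
    obtain ⟨S₂, -, hb₂⟩ := h₂.hasSum q hq
    simp only [ft_add h₁.integrable h₂.integrable]
    rw [hb₁.summable.tsum_add hb₂.summable, add_sub_add_comm, add_mul]
    exact (norm_add_le _ _).trans (add_le_add (hC₁ q hq) (hC₂ q hq))

lemma SatisfiesPoisson.smul {c : ℝ} {f : A → ℂ} (h : SatisfiesPoisson μ X c f) (a : ℂ) :
    SatisfiesPoisson μ X c (a • f) where
  integrable := h.integrable.smul a
  hasSum q hq := by
    obtain ⟨S, ha, hb⟩ := h.hasSum q hq
    refine ⟨a * S, ha.mul_left a, ?_⟩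
    simp only [ft_smul]
    rw [mul_left_comm]
    exact hb.mul_left a
  decay b hb := by
    obtain ⟨C, hC⟩ := h.decay b hb
    refine ⟨‖a‖ * C, fun q hq => ?_⟩
    simp only [ft_smul]
    rw [tsum_mul_left, ← mul_sub, norm_mul, mul_assoc]
    gcongr
    exact hC q hq

lemma SatisfiesPoisson.of_mem_span {c : ℝ} {s : Set (A → ℂ)} (hs : ∀ f ∈ s, SatisfiesPoisson μ X c f)
    {f : A → ℂ} (hf : f ∈ Submodule.span ℂ s) : SatisfiesPoisson μ X c f := by
  induction hf using Submodule.span_induction with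
  | mem f hf => exact hs f hf
  | zero => exact SatisfiesPoisson.zero μ X c
  | add f g _ _ hf hg => exact hf.add hg
  | smul a f _ hf => exact hf.smul a

end AdelicLattice

end NonabelianDelta
end

/-! ### Adelic Poisson summation and the covolume of D. -/

noncomputable section
namespace NonabelianDelta

open scoped FourierTransform

namespace AdelicLattice

variable {A D ι : Type*} [Ring A] [TopologicalSpace A] [DivisionRing D] [Fintype ι]
  {L : AdelicLattice A D ι} [IsTopologicalRing A] [MeasurableSpace A] [BorelSpace A]
  (μ : Measure A) [μ.IsAddHaarMeasure] (X : DualityChar L)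

/-- Scaling leaves finite parts alone, so only δ in x + Nℤ^ι (in coordinates) contribute. -/
lemma hasSum_basic (g : 𝓢(EuclideanSpace ℝ ι, ℂ)) (x : D) {N : ℕ} (hN : 0 < N) {q : ℝ}
    (hq : 0 < q) : HasSum (fun δ : D => L.basic g x N (L.scale q⁻¹ (L.diag δ)))
      (∑' k : ι → ℤ, g (q⁻¹ • (ratVec (L.coord x) + (N : ℝ) • intVec k))) := by
  have hNq : (N : ℚ) ≠ 0 := by exact_mod_cast hN.ne'
  set j : (ι → ℤ) → D := fun k => x + L.coord.symm fun i => (N : ℚ) * k i with hj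
  have hinj : Function.Injective j := by
    intro k l hkl
    have h1 := L.coord.symm.injective (add_left_cancel hkl)
    funext i
    have := mul_left_cancel₀ hNq (congrFun h1 i)
    exact_mod_cast this
  have hmem : ∀ δ, L.scale q⁻¹ (L.diag δ) - L.diag x ∈ L.W N ↔ δ ∈ Set.range j := by
    intro δ
    rw [L.scale_sub_mem_W, ← map_sub, L.diag_mem_W N hN]
    constructor
    · rintro ⟨k, hk⟩
      refine ⟨k, ?_⟩
      simp only [hj]
      rw [show (fun i => (N : ℚ) * k i) = L.coord (δ - x) from funext fun i => (hk i).symm,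
        AddEquiv.symm_apply_apply, add_sub_cancel]
    · rintro ⟨k, rfl⟩
      exact ⟨k, fun i => by simp [hj]⟩
  rw [← hinj.hasSum_iff fun δ hδ => L.basic_of_notMem fun h => hδ ((hmem δ).mp h)]
  convert (hasSum_fourier_scaled g (ratVec (L.coord x)) hN hq).1.hasSum using 1
  funext k
  rw [Function.comp_apply, L.basic_of_mem ((hmem _).mpr ⟨k, rfl⟩), L.P_scale, L.P_diag]
  congr 2
  simp only [hj, map_add, AddEquiv.apply_symm_apply, ratVec_add]
  congr 1
  ext i
  simp

/-- The elements of `D` orthogonal to `W N`, enumerated by integer vectors. -/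
def freqPoint (N : ℕ) (m : ι → ℤ) : D := X.T.symm fun i => -((m i : ℚ) / N)

lemma freqPoint_injective {N : ℕ} (hN : 0 < N) : Function.Injective (freqPoint X N) := by
  have hNq : (N : ℚ) ≠ 0 := by exact_mod_cast hN.ne'
  intro k l hkl
  have h1 := X.T.symm.injective hkl
  funext i
  have := congrFun h1 i
  simp only [neg_inj] at this
  have := (div_left_inj' hNq).mp this
  exact_mod_cast this

lemma ratVec_T_freqPoint (N : ℕ) (m : ι → ℤ) :
    ratVec (X.T (freqPoint X N m)) = -((N : ℝ)⁻¹ • intVec m) := by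
  ext i
  simp [freqPoint, div_eq_inv_mul]

lemma freqPoint_zero (N : ℕ) : freqPoint X N 0 = 0 := by
  have : (fun i : ι => -(((0 : ι → ℤ) i : ℚ) / N)) = 0 := by funext i; simp
  rw [freqPoint, this, map_zero]

/-- The minus sign in `freqPoint` cancels the one in `ft_basic_zero_of_forall`; the phase is the
effect of translating the finite part by x. -/
lemma ft_basic_freqPoint (g : 𝓢(EuclideanSpace ℝ ι, ℂ)) (x : D) {N : ℕ} (hN : 0 < N) (q : ℝ)
    (m : ι → ℤ) : ft μ X (L.basic g x N) (L.scale q (L.diag (freqPoint X N m))) = L.density μ N *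
      (𝐞 (inner ℝ (ratVec (L.coord x)) ((N : ℝ)⁻¹ • intVec m)) •
        𝓕 g (q • (N : ℝ)⁻¹ • intVec m)) := by
  have hNq : (N : ℚ) ≠ 0 := by exact_mod_cast hN.ne'
  obtain ⟨B, hB, hBT⟩ := exists_pairing X
  have horth : ∀ w ∈ L.W N, L.P w = 0 →
      X.char (L.scale q (L.diag (freqPoint X N m)) * w) = 1 := by
    intro w hw hPw
    rw [L.scale_mul_fin _ _ hPw]
    refine (char_diag_mul_eq_one_iff X hN _).mpr ⟨fun i => -m i, fun i => ?_⟩ w hw hPw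
    simp only [freqPoint, AddEquiv.apply_symm_apply]
    push_cast
    field_simp
  rw [ft_basic, ft_basic_zero_of_forall μ X g hB hN horth, L.scale_mul_fin _ _ (L.P_fin _),
    char_diag_mul_fin, L.P_scale, map_smul, hBT, ratVec_T_freqPoint, smul_neg, neg_neg,
    inner_neg_left, neg_neg, real_inner_comm, Circle.smul_def, smul_eq_mul]
  ring

lemma ft_basic_of_notMem_range (g : 𝓢(EuclideanSpace ℝ ι, ℂ)) (x : D) {N : ℕ} (hN : 0 < N) (q : ℝ)
    {δ : D} (hδ : δ ∉ Set.range (freqPoint X N)) :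
    ft μ X (L.basic g x N) (L.scale q (L.diag δ)) = 0 := by
  have hNq : (N : ℚ) ≠ 0 := by exact_mod_cast hN.ne'
  have h : ¬ ∀ w ∈ L.W N, L.P w = 0 → X.char (L.diag δ * w) = 1 := by
    rw [char_diag_mul_eq_one_iff X hN]
    rintro ⟨m, hm⟩
    refine hδ ⟨fun i => -m i, ?_⟩
    rw [freqPoint, AddEquiv.symm_apply_eq]
    funext i
    have := hm i
    push_cast
    field_simp
    linear_combination (-1) * this
  push Not at h
  obtain ⟨w, hw, hPw, hne⟩ := h
  rw [ft_basic, ft_basic_zero_of_exists μ X g hw hPw (by rwa [L.scale_mul_fin _ _ hPw]), mul_zero]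

lemma norm_intVec_pos {m : ι → ℤ} (hm : m ≠ 0) : 0 < ‖intVec m‖ :=
  norm_pos_iff.mpr fun h => hm (intVec_injective (h.trans intVec_zero.symm))

/-- **Poisson summation** on `A` for the functions `g ⊗ 1_{x + W N}`. -/
theorem satisfiesPoisson_basic (g : 𝓢(EuclideanSpace ℝ ι, ℂ)) (x : D) {N : ℕ} (hN : 0 < N) :
    SatisfiesPoisson μ X (L.density μ 1) (L.basic g x N) := by
  classical
  have hN' : (0 : ℝ) < N := by exact_mod_cast hN
  have hfreq : ∀ q : ℝ, 0 < q → HasSum (fun δ : D => ft μ X (L.basic g x N) (L.scale q (L.diag δ)))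
      (L.density μ 1 * (q⁻¹ : ℂ) ^ Fintype.card ι *
        ∑' k : ι → ℤ, g (q⁻¹ • (ratVec (L.coord x) + (N : ℝ) • intVec k))) := by
    intro q hq
    rw [← (freqPoint_injective X hN).hasSum_iff fun δ hδ => ft_basic_of_notMem_range μ X g x hN q hδ]
    have h := (hasSum_fourier_scaled g (ratVec (L.coord x)) hN hq).2.mul_left (L.density μ N : ℂ)
    have e1 : (fun δ : D => ft μ X (L.basic g x N) (L.scale q (L.diag δ))) ∘ freqPoint X N =
        fun m => L.density μ N * (𝐞 (inner ℝ (ratVec (L.coord x)) ((N : ℝ)⁻¹ • intVec m)) •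
          𝓕 g (q • (N : ℝ)⁻¹ • intVec m)) := by
      funext m
      rw [Function.comp_apply, ft_basic_freqPoint μ X g x hN]
    -- The factor N^|ι| of the Euclidean formula is exactly the ratio of the densities of W 1 and W
    -- N, so the constant is independent of N.
    have e2 : (L.density μ 1 : ℂ) * (q⁻¹ : ℂ) ^ Fintype.card ι *
        (∑' k : ι → ℤ, g (q⁻¹ • (ratVec (L.coord x) + (N : ℝ) • intVec k))) =
        L.density μ N * (((N : ℂ) / q) ^ Fintype.card ι *
          ∑' k : ι → ℤ, g (q⁻¹ • (ratVec (L.coord x) + (N : ℝ) • intVec k))) := by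
      rw [L.density_one_eq μ hN]
      push_cast
      rw [div_pow, inv_pow]
      ring
    rw [e1, e2]
    exact h
  refine ⟨L.integrable_basic μ g.integrable x hN,
    fun q hq => ⟨_, hasSum_basic g x hN hq, hfreq q hq⟩, fun b hb => ?_⟩
  obtain ⟨C, hC, hbound⟩ := schwartz_bound (𝓕 g) b
  set Z := ∑' m : ι → ℤ, (‖intVec m‖ ^ b)⁻¹ with hZ
  refine ⟨L.density μ N * C * (N : ℝ) ^ b * Z, fun q hq => ?_⟩
  set F : (ι → ℤ) → ℂ := fun m =>
    ft μ X (L.basic g x N) (L.scale q (L.diag (freqPoint X N m))) with hF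
  have hF0 : F 0 = ft μ X (L.basic g x N) 0 := by
    simp only [hF]
    rw [freqPoint_zero, map_zero, L.scale_zero]
  have hFs : HasSum F (∑' δ : D, ft μ X (L.basic g x N) (L.scale q (L.diag δ))) := by
    have := (hfreq q hq).summable.hasSum
    rwa [← (freqPoint_injective X hN).hasSum_iff
      fun δ hδ => ft_basic_of_notMem_range μ X g x hN q hδ] at this
  -- Overwriting the zero frequency by 0 subtracts its term from the sum.
  have hupd := hFs.update 0 0
  rw [hF0, zero_sub, neg_add_eq_sub] at hupd
  rw [← hupd.tsum_eq]
  have hmaj : HasSum (fun m : ι → ℤ => L.density μ N * C * (N : ℝ) ^ b * (q ^ b)⁻¹ *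
      (‖intVec m‖ ^ b)⁻¹) (L.density μ N * C * (N : ℝ) ^ b * (q ^ b)⁻¹ * Z) :=
    (summable_norm_intVec_pow_inv hb).hasSum.mul_left _
  have hle := tsum_of_norm_bounded (f := Function.update F 0 0) hmaj fun m => by
    have hd := (L.density_pos μ hN).le
    by_cases hm : m = 0
    · subst hm
      rw [Function.update_self, norm_zero]
      positivity
    · have hmpos := norm_intVec_pos hm
      rw [Function.update_of_ne hm]
      simp only [hF]
      rw [ft_basic_freqPoint μ X g x hN, norm_mul, Circle.norm_smul, Complex.norm_real,
        Real.norm_of_nonneg hd]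
      have h1 := hbound (q • (N : ℝ)⁻¹ • intVec m)
      rw [norm_smul, norm_smul, Real.norm_of_nonneg hq.le, Real.norm_of_nonneg (by positivity)] at h1
      -- Dropping the 1 separates q from m and leaves a series in m that converges since b exceeds
      -- the dimension.
      have h2 : ((1 + q * ((N : ℝ)⁻¹ * ‖intVec m‖)) ^ b)⁻¹
          ≤ (N : ℝ) ^ b * (q ^ b)⁻¹ * (‖intVec m‖ ^ b)⁻¹ := by
        have h3 : (N : ℝ) ^ b * (q ^ b)⁻¹ * (‖intVec m‖ ^ b)⁻¹
            = ((q * ((N : ℝ)⁻¹ * ‖intVec m‖)) ^ b)⁻¹ := by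
          rw [mul_pow, mul_pow, inv_pow, mul_inv, mul_inv, inv_inv]
          ring
        rw [h3]
        gcongr
        linarith
      calc _ ≤ L.density μ N * (C * ((1 + q * ((N : ℝ)⁻¹ * ‖intVec m‖)) ^ b)⁻¹) := by gcongr
        _ ≤ L.density μ N * (C * ((N : ℝ) ^ b * (q ^ b)⁻¹ * (‖intVec m‖ ^ b)⁻¹)) := by gcongr
        _ = _ := by ring
  refine hle.trans (le_of_eq ?_)
  ring

/-- The span of the functions `g ⊗ 1_{x + W N}`. -/
def basicSpan (L : AdelicLattice A D ι) : Submodule ℂ (A → ℂ) :=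
  Submodule.span ℂ {f | ∃ (g : 𝓢(EuclideanSpace ℝ ι, ℂ)) (x : D) (N : ℕ), 0 < N ∧
    f = L.basic g x N}

lemma satisfiesPoisson_of_mem_basicSpan {f : A → ℂ} (hf : f ∈ basicSpan L) :
    SatisfiesPoisson μ X (L.density μ 1) f := by
  refine SatisfiesPoisson.of_mem_span ?_ hf
  rintro f ⟨g, x, N, hN, rfl⟩
  exact satisfiesPoisson_basic μ X g x hN

lemma mul_mem_basicSpan (g : 𝓢(EuclideanSpace ℝ ι, ℂ)) {h : A → ℂ} {K M : ℕ} (hK : 0 < K)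
    (hM : 0 < M) (hinv : ∀ z, ∀ w ∈ L.W M, h (z + w) = h z) (hsupp : ∀ z, h z ≠ 0 → K • z ∈ L.W 1) :
    (fun z => g (L.P z) * h z) ∈ basicSpan L := by
  classical
  have : (fun z => g (L.P z) * h z) = ∑ a : ι → Fin (K * M), h (L.diag (L.rep K fun i => a i)) •
      L.basic g (L.rep K fun i => a i) M := by
    funext z
    rw [L.mul_eq_sum_basic g hK hM hinv hsupp z, Finset.sum_apply]
    convert rfl using 3
    rfl
  rw [this]
  exact Submodule.sum_mem _ fun a _ => Submodule.smul_mem _ _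
    (Submodule.subset_span ⟨g, _, M, hM, rfl⟩)

/-! ### The Fourier transform of g ⊗ 1_{W 1} is again a combination of basic functions. -/

section DualLattice

/-- The orthogonal complement of the non-archimedean part of `W 1`. -/
def orthogonal (X : DualityChar L) : AddSubgroup A where
  carrier := {y | ∀ w ∈ L.W 1, L.P w = 0 → X.char (y * w) = 1}
  zero_mem' w _ _ := by rw [zero_mul, AddChar.map_zero_eq_one]
  add_mem' ha hb w hw hPw := by
    rw [add_mul, AddChar.map_add_eq_mul, ha w hw hPw, hb w hw hPw, one_mul]
  neg_mem' {y} hy w hw hPw := by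
    have : X.char (0 - y * w) = 1 := by
      rw [char_sub, hy w hw hPw, AddChar.map_zero_eq_one, inv_one, one_mul]
    rwa [neg_mul, ← zero_sub]

/-- Modulo a subgroup on which z ↦ char(yz) is trivial, the finite part of W 1 is generated by the
finite parts of the coordinate vectors, so finitely many tests suffice. -/
lemma mem_orthogonal_iff (y : A) [DecidableEq ι] : y ∈ orthogonal X ↔
    ∀ i, X.char (y * L.fin (L.diag (L.coord.symm (Pi.single i 1)))) = 1 := by
  have hmem : ∀ i, L.diag (L.coord.symm (Pi.single i 1)) ∈ L.W 1 := fun i =>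
    (L.diag_mem_W 1 one_pos _).mpr ⟨Pi.single i 1, fun j => by
      by_cases h : j = i
      · subst h; simp
      · simp [h]⟩
  refine ⟨fun h i => h _ (L.fin_mem_W.mpr (hmem i)) (L.P_fin _), fun h w hw hPw => ?_⟩
  obtain ⟨M, hM, hMy⟩ := L.exists_char_eq_one (mulLeftChar X.char y)
    (continuous_mulLeftChar X.continuous_char y)
  obtain ⟨β, hβ⟩ := L.exists_sub_mem_W M hM w
  have hβ1 : L.diag β ∈ L.W 1 := by
    have := sub_mem hw (L.W_le 1 M (one_dvd _) hβ)
    rwa [sub_sub_cancel] at this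
  obtain ⟨k, hk⟩ := (L.diag_mem_W 1 one_pos β).mp hβ1
  have h2 := hMy _ (L.fin_mem_W.mpr hβ) (L.P_fin _)
  rw [mulLeftChar_apply, map_sub, L.fin_eq_self hPw, mul_sub, char_sub] at h2
  have hβs : β = ∑ i, k i • L.coord.symm (Pi.single i 1) := by
    apply L.coord.injective
    rw [map_sum]
    funext j
    rw [hk j, Finset.sum_apply]
    simp only [map_zsmul, AddEquiv.apply_symm_apply, Pi.smul_apply]
    simp [Pi.single_apply]
  have h3 : X.char (y * L.fin (L.diag β)) = 1 := by
    rw [hβs]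
    simp only [map_sum, map_zsmul, Finset.mul_sum, mul_smul_comm]
    have : ∀ s : Finset ι, X.char (∑ i ∈ s,
        k i • (y * L.fin (L.diag (L.coord.symm (Pi.single i 1))))) = 1 := by
      intro s
      induction s using Finset.induction_on with
      | empty => simp
      | insert i s his ih =>
        rw [Finset.sum_insert his, AddChar.map_add_eq_mul, ih, AddChar.map_zsmul_eq_zpow, h i,
          one_zpow, one_mul]
    exact this _
  rwa [h3, inv_one, mul_one] at h2

/-- Each of the finitely many tests is a continuous character in y, trivial on the finite part of
some W M; the product of these M works for all. -/
lemma exists_W_le_orthogonal : ∃ M, 0 < M ∧ L.W M ≤ orthogonal X := by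
  classical
  have h : ∀ i : ι, ∃ M, 0 < M ∧ ∀ y ∈ L.W M, L.P y = 0 →
      X.char (y * L.fin (L.diag (L.coord.symm (Pi.single i 1)))) = 1 := fun i =>
    L.exists_char_eq_one (mulRightChar X.char _) (continuous_mulRightChar X.continuous_char _)
  choose M hM hMy using h
  refine ⟨∏ i, M i, Finset.prod_pos fun i _ => hM i, fun y hy => ?_⟩
  rw [mem_orthogonal_iff]
  intro i
  rw [← L.s_add_fin y, add_mul, L.s_mul_fin _ (L.P_fin _), zero_add]
  exact hMy i _ (L.fin_mem_W.mpr (L.W_le _ _ (Finset.dvd_prod_of_mem M (Finset.mem_univ i)) hy))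
    (L.P_fin _)

/-- Up to W M, an element orthogonal to W 1 is an integral combination of the basis dual to the
coordinates. The integer K is the product of all denominators of the coordinates of this basis. -/
lemma exists_nsmul_orthogonal_mem : ∃ K, 0 < K ∧ ∀ y ∈ orthogonal X, K • y ∈ L.W 1 := by
  classical
  obtain ⟨M, hM, hMle⟩ := exists_W_le_orthogonal X
  set d : ι → ι → ℕ := fun i j => (L.coord (X.T.symm (Pi.single i 1)) j).den with hd
  set K := ∏ i, ∏ j, d i j with hK
  refine ⟨K, Finset.prod_pos fun i _ => Finset.prod_pos fun j _ => Rat.den_pos _, fun y hy => ?_⟩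
  obtain ⟨δ, hδ⟩ := L.exists_sub_mem_W M hM y
  have hδo : L.diag δ ∈ orthogonal X := by
    have := sub_mem hy (hMle hδ)
    rwa [sub_sub_cancel] at this
  obtain ⟨m, hm⟩ := (char_diag_mul_eq_one_iff X one_pos δ).mp hδo
  have hint : ∀ i j, ∃ n : ℤ, (K : ℚ) * L.coord (X.T.symm (Pi.single i 1)) j = n := by
    intro i j
    obtain ⟨e, he⟩ : d i j ∣ K := (Finset.dvd_prod_of_mem (d i) (Finset.mem_univ j)).trans
      (Finset.dvd_prod_of_mem (fun i => ∏ j, d i j) (Finset.mem_univ i))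
    refine ⟨(L.coord (X.T.symm (Pi.single i 1)) j).num * e, ?_⟩
    rw [he]
    have := Rat.mul_den_eq_num (L.coord (X.T.symm (Pi.single i 1)) j)
    push_cast
    rw [← this]
    simp only [hd]
    ring
  choose n hn using hint
  have hδs : δ = ∑ i, m i • X.T.symm (Pi.single i 1) := by
    apply X.T.injective
    rw [map_sum]
    funext j
    have := hm j
    rw [Nat.cast_one, one_mul] at this
    rw [this, Finset.sum_apply]
    simp only [map_zsmul, AddEquiv.apply_symm_apply, Pi.smul_apply]
    simp [Pi.single_apply]
  have h1 : K • L.diag δ ∈ L.W 1 := by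
    rw [← map_nsmul, L.diag_mem_W 1 one_pos]
    refine ⟨fun j => ∑ i, m i * n i j, fun j => ?_⟩
    rw [hδs, map_nsmul, map_sum, Pi.smul_apply, Finset.sum_apply, nsmul_eq_mul, Finset.mul_sum]
    push_cast
    rw [one_mul]
    refine Finset.sum_congr rfl fun i _ => ?_
    rw [map_zsmul, Pi.smul_apply, zsmul_eq_mul, ← hn i j]
    ring
  have : K • y = K • (y - L.diag δ) + K • L.diag δ := by rw [← smul_add, sub_add_cancel]
  rw [this]
  exact add_mem (AddSubgroup.nsmul_mem _ (L.W_le 1 M (one_dvd _) hδ) K) h1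

end DualLattice

/-- The transform is a Schwartz function of the archimedean coordinate times the indicator of the
orthogonal subgroup, which has bounded denominators and is invariant under some W M. Hence Poisson
summation applies to it as well. -/
lemma ft_basic_mem_basicSpan (g : 𝓢(EuclideanSpace ℝ ι, ℂ)) :
    ft μ X (L.basic g 0 1) ∈ basicSpan L := by
  obtain ⟨B, hB, -⟩ := exists_pairing X
  obtain ⟨M, hM, hMle⟩ := exists_W_le_orthogonal X
  obtain ⟨K, hK, hKo⟩ := exists_nsmul_orthogonal_mem X
  set G : 𝓢(EuclideanSpace ℝ ι, ℂ) := (L.density μ 1 : ℂ) •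
    SchwartzMap.compCLMOfContinuousLinearEquiv ℂ (B.trans (ContinuousLinearEquiv.neg ℝ)) (𝓕 g)
    with hG
  have h : ft μ X (L.basic g 0 1)
      = fun z => G (L.P z) * Set.indicator (orthogonal X : Set A) 1 z := by
    funext y
    by_cases hy : y ∈ (orthogonal X : Set A)
    · rw [ft_basic_zero_of_forall μ X g hB one_pos hy, Set.indicator_of_mem hy, Pi.one_apply, mul_one]
      simp [hG]
    · rw [Set.indicator_of_notMem hy, mul_zero]
      have : ¬ ∀ w ∈ L.W 1, L.P w = 0 → X.char (y * w) = 1 := hy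
      push Not at this
      obtain ⟨w, hw, hPw, hne⟩ := this
      exact ft_basic_zero_of_exists μ X g hw hPw hne
  rw [h]
  refine mul_mem_basicSpan G hK hM (fun z w hw => ?_)
    fun z hz => hKo z (Set.mem_of_indicator_ne_zero hz)
  have hiff : z + w ∈ (orthogonal X : Set A) ↔ z ∈ (orthogonal X : Set A) :=
    AddSubgroup.add_mem_cancel_right _ (hMle hw)
  by_cases hz : z ∈ (orthogonal X : Set A)
  · rw [Set.indicator_of_mem hz, Set.indicator_of_mem (hiff.mpr hz)]; rfl
  · rw [Set.indicator_of_notMem hz, Set.indicator_of_notMem (fun h => hz (hiff.mp h))]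

/-- If Fourier inversion holds, then `D` has covolume one. -/
theorem density_one_eq_one (hinv : ∀ (g : 𝓢(EuclideanSpace ℝ ι, ℂ)) (y : A),
    L.basic g 0 1 y = ft μ X (ft μ X (L.basic g 0 1)) (-y)) : L.density μ 1 = 1 := by
  obtain ⟨g, hg, -⟩ := exists_schwartz_bump (ι := ι)
  have h1 := hasSum_basic (L := L) g 0 one_pos one_pos
  simp only [inv_one, one_smul, L.scale_one, map_zero, ratVec_zero, zero_add, Nat.cast_one] at h1
  rw [hg] at h1
  obtain ⟨S, hS, hS'⟩ := (satisfiesPoisson_basic μ X g 0 one_pos).hasSum 1 one_pos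
  simp only [inv_one, L.scale_one, Complex.ofReal_one, one_pow, mul_one] at hS hS'
  rw [hS.unique h1, mul_one] at hS'
  -- The second application of Poisson summation returns, by inversion and δ ↦ −δ, the original
  -- lattice sum 1 times the square of the constant.
  obtain ⟨S₂, hS₂, hS₂'⟩ :=
    (satisfiesPoisson_of_mem_basicSpan μ X (ft_basic_mem_basicSpan μ X g)).hasSum 1 one_pos
  simp only [inv_one, L.scale_one, Complex.ofReal_one, one_pow, mul_one] at hS₂ hS₂'
  rw [hS₂.unique hS'] at hS₂'
  have h3 : HasSum (fun δ : D => ft μ X (ft μ X (L.basic g 0 1)) (L.diag δ)) 1 := by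
    rw [← (Equiv.neg D).hasSum_iff]
    convert h1 using 1
    funext δ
    rw [Function.comp_apply, Equiv.neg_apply, map_neg, ← hinv]
  have h4 := hS₂'.unique h3
  have h5 : L.density μ 1 * L.density μ 1 = 1 := by exact_mod_cast h4
  nlinarith [L.density_pos μ one_pos]

end AdelicLattice

end NonabelianDelta
end

/-! ### Finite adeles: compactness, shrinking neighbourhoods and strong approximation. -/

noncomputable section
namespace NonabelianDelta

open IsDedekindDomain HeightOneSpectrum WithZero

section FiniteAdeles

variable {F : Type*} [Field F] [NumberField F]

/-- Density of F gives an approximation in F. It is v-integral because c is, and v-integral elements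
of F are approximated by global integers. -/
lemma exists_integer_valued_sub_le (v : HeightOneSpectrum (𝓞 F)) {x : v.adicCompletion F}
    (hx : Valued.v x ≤ 1) {c : F} (hc : c ≠ 0) (hc1 : v.valuation F c ≤ 1) :
    ∃ r : 𝓞 F, Valued.v (x - ((r : F) : v.adicCompletion F)) ≤ v.valuation F c := by
  have hcv : v.valuation F c ≠ 0 := (Valuation.ne_zero_iff _).mpr hc
  have hopen : IsOpen {y : v.adicCompletion F | Valued.v (x - y) ≤ v.valuation F c} := by
    have h1 : Continuous fun y : v.adicCompletion F => ((c⁻¹ : F) : v.adicCompletion F) * (x - y) :=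
      by fun_prop
    convert (Valued.isOpen_valuationSubring (v.adicCompletion F)).preimage h1 using 1
    ext y
    rw [Set.mem_ofPred_eq, Set.mem_preimage, SetLike.mem_coe, Valuation.mem_valuationSubring_iff,
      Valuation.map_mul, valuedAdicCompletion_eq_valuation', map_inv₀]
    rw [inv_mul_le_one₀ (zero_lt_iff.mpr hcv)]
  obtain ⟨_, hy, ⟨k, rfl⟩⟩ := (v.denseRange_algebraMap (K := F)).inter_open_nonempty _ hopen
    ⟨x, by simp⟩
  have hy' : Valued.v (x - ((k : F) : v.adicCompletion F)) ≤ v.valuation F c := hy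
  have hk : v.valuation F k ≤ 1 := by
    rw [← valuedAdicCompletion_eq_valuation' v k, ← sub_sub_cancel x (k : v.adicCompletion F)]
    exact Valuation.map_sub_le _ hx (hy'.trans hc1)
  obtain ⟨r, hr⟩ := v.exists_valuation_sub_lt_of_integer hk (Units.mk0 _ hcv)
  refine ⟨r, ?_⟩
  have h2 : Valued.v (((r : F) : v.adicCompletion F) - (k : F)) ≤ v.valuation F c := by
    have h3 : (((r : F) : v.adicCompletion F) - (k : F)) = (((r : F) - k : F) : v.adicCompletion F) :=
      ((algebraMap F (v.adicCompletion F)).map_sub (r : F) k).symm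
    rw [h3, valuedAdicCompletion_eq_valuation']
    exact hr.le
  rw [← sub_sub_sub_cancel_right _ _ (k : v.adicCompletion F)]
  exact Valuation.map_sub_le _ hy' h2

/-- Approximation modulo a uniformizer shows that the finite ring 𝓞/v surjects onto the residue
field. -/
instance finite_residueField (v : HeightOneSpectrum (𝓞 F)) :
    Finite (IsLocalRing.ResidueField (v.adicCompletionIntegers F)) := by
  obtain ⟨π, hπ⟩ := v.valuation_exists_uniformizer F
  have hπ1 : v.valuation F π < 1 := by
    rw [hπ]
    exact exp_lt_exp.mpr (by norm_num)
  have hπ0 : π ≠ 0 := fun h => by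
    rw [h, map_zero] at hπ
    exact exp_ne_zero hπ.symm
  set f : 𝓞 F →+* IsLocalRing.ResidueField (v.adicCompletionIntegers F) :=
    (IsLocalRing.residue _).comp (algebraMap (𝓞 F) (v.adicCompletionIntegers F))
  have hmem : ∀ z : v.adicCompletionIntegers F, Valued.v (z : v.adicCompletion F) < 1 →
      IsLocalRing.residue _ z = 0 := fun z hz => by
    rw [IsLocalRing.residue_eq_zero_iff]
    exact (Valuation.mem_maximalIdeal_iff _ _).mpr hz
  have hker : ∀ a ∈ v.asIdeal, f a = 0 := fun a ha => by
    apply hmem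
    rw [algebraMap_adicCompletionIntegers_apply]
    exact (valuedAdicCompletion_eq_valuation' v _).trans_lt ((v.valuation_lt_one_iff_mem a).mpr ha)
  have : Finite (𝓞 F ⧸ v.asIdeal) := Ideal.finiteQuotientOfFreeOfNeBot _ v.ne_bot
  refine Finite.of_surjective (Ideal.Quotient.lift _ f hker) fun y => ?_
  obtain ⟨x, rfl⟩ := IsLocalRing.residue_surjective y
  obtain ⟨r, hr⟩ := exists_integer_valued_sub_le v x.2 hπ0 hπ1.le
  refine ⟨Ideal.Quotient.mk _ r, ?_⟩
  rw [Ideal.Quotient.lift_mk, eq_comm, ← sub_eq_zero]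
  refine (map_sub (IsLocalRing.residue _) x (algebraMap _ _ r)).symm.trans (hmem _ ?_)
  exact hr.trans_lt hπ1

instance compactSpace_integers (v : HeightOneSpectrum (𝓞 F)) :
    CompactSpace (v.adicCompletionIntegers F) := by
  refine (
    Valued.integer.compactSpace_iff_completeSpace_and_isDiscreteValuationRing_and_finite_residueField
    (K := v.adicCompletion F)).mpr ⟨?_, ?_, ?_⟩
  · exact (Valued.isClosed_valuationSubring (v.adicCompletion F)).completeSpace_coe
  · exact inferInstanceAs (IsDiscreteValuationRing (v.adicCompletionIntegers F))
  · exact finite_residueField v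

variable (F) in
/-- The everywhere integral finite adeles. -/
def intAdeles : AddSubgroup 𝔸ᶠ[F] where
  carrier := {a | ∀ v, Valued.v (a v) ≤ 1}
  zero_mem' v := by
    change Valued.v (0 : v.adicCompletion F) ≤ 1
    simp
  add_mem' {a b} ha hb v := by
    change Valued.v (a v + b v) ≤ 1
    exact Valuation.map_add_le _ (ha v) (hb v)
  neg_mem' {a} ha v := by
    change Valued.v (-(a v)) ≤ 1
    rw [Valuation.map_neg]
    exact ha v

lemma mem_intAdeles {a : 𝔸ᶠ[F]} : a ∈ intAdeles F ↔ ∀ v, Valued.v (a v) ≤ 1 := Iff.rfl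

lemma isOpen_intAdeles : IsOpen (intAdeles F : Set 𝔸ᶠ[F]) :=
  RestrictedProduct.isOpen_forall_mem (R := fun v : HeightOneSpectrum (𝓞 F) => v.adicCompletion F)
    (A := fun v => (v.adicCompletionIntegers F : Set (v.adicCompletion F)))
    (fun v ↦ Valued.isOpen_valuationSubring (v.adicCompletion F))

lemma isCompact_intAdeles : IsCompact (intAdeles F : Set 𝔸ᶠ[F]) := by
  have : ∀ v : HeightOneSpectrum (𝓞 F),
    CompactSpace (v.adicCompletionIntegers F : Set (v.adicCompletion F)) := compactSpace_integers
  have h := isCompact_range (RestrictedProduct.isOpenEmbedding_structureMap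
    (R := fun v : HeightOneSpectrum (𝓞 F) => v.adicCompletion F)
    (A := fun v => (v.adicCompletionIntegers F : Set (v.adicCompletion F)))
    (fun v ↦ Valued.isOpen_valuationSubring (v.adicCompletion F))).continuous
  rw [RestrictedProduct.range_structureMap] at h
  exact h

instance : T2Space 𝔸ᶠ[F] := inferInstanceAs (T2Space
  (RestrictedProduct (fun v : HeightOneSpectrum (𝓞 F) => v.adicCompletion F)
    (fun v => (v.adicCompletionIntegers F : Set (v.adicCompletion F))) Filter.cofinite))

lemma algebraMap_mem_intAdeles {x : F} :
    algebraMap F 𝔸ᶠ[F] x ∈ intAdeles F ↔ ∃ r : 𝓞 F, (r : F) = x := by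
  simp only [mem_intAdeles, FiniteAdeleRing.algebraMap_apply, valuedAdicCompletion_eq_valuation']
  constructor
  · exact fun h => HeightOneSpectrum.mem_integers_of_valuation_le_one F x h
  · rintro ⟨r, rfl⟩ v
    exact v.valuation_le_one r

lemma mul_mem_intAdeles {a b : 𝔸ᶠ[F]} (ha : a ∈ intAdeles F) (hb : b ∈ intAdeles F) :
    a * b ∈ intAdeles F := fun v => by
  change Valued.v (a v * b v) ≤ 1
  rw [map_mul]
  exact mul_le_one' (ha v) (hb v)

lemma valuation_natCast_le_one (v : HeightOneSpectrum (𝓞 F)) (n : ℕ) :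
    v.valuation F n ≤ 1 := by
  have := v.valuation_le_one (K := F) (n : 𝓞 F)
  simpa using this

lemma natCast_apply (n : ℕ) (v : HeightOneSpectrum (𝓞 F)) :
    (n : 𝔸ᶠ[F]) v = ((n : F) : v.adicCompletion F) := by
  rw [← map_natCast (algebraMap F 𝔸ᶠ[F]) n]
  rfl

lemma valued_natCast_apply (n : ℕ) (v : HeightOneSpectrum (𝓞 F)) :
    Valued.v ((n : 𝔸ᶠ[F]) v) = v.valuation F n := by
  rw [natCast_apply, valuedAdicCompletion_eq_valuation']

lemma exists_valuation_natCast_lt_one (v : HeightOneSpectrum (𝓞 F)) :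
    ∃ p : ℕ, 0 < p ∧ v.valuation F p < 1 := by
  refine ⟨Ideal.absNorm v.asIdeal, ?_, ?_⟩
  · exact Nat.pos_of_ne_zero (Ideal.absNorm_eq_zero_iff.not.mpr v.ne_bot)
  · have := (v.valuation_lt_one_iff_mem (K := F) (Ideal.absNorm v.asIdeal : 𝓞 F)).mpr
      (Ideal.absNorm_mem _)
    simpa using this

/-- Only finitely many components fail to be integral, and at each of them a power of the absolute
norm of v clears the denominator. -/
lemma exists_nat_mul_mem_intAdeles (a : 𝔸ᶠ[F]) : ∃ M : ℕ, 0 < M ∧ (M : 𝔸ᶠ[F]) * a ∈ intAdeles F := by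
  classical
  have hfin : {v : HeightOneSpectrum (𝓞 F) | ¬ Valued.v (a v) ≤ 1}.Finite := a.2
  have h : ∀ v : HeightOneSpectrum (𝓞 F), ∃ m : ℕ, 0 < m ∧ v.valuation F m * Valued.v (a v) ≤ 1 := by
    intro v
    obtain ⟨p, hp, hpv⟩ := exists_valuation_natCast_lt_one v
    by_cases ha : Valued.v (a v) = 0
    · exact ⟨1, one_pos, by rw [ha, mul_zero]; exact zero_le_one⟩
    · obtain ⟨k, hk⟩ := exists_pow_lt₀ hpv (Units.mk0 _ (inv_ne_zero ha))
      refine ⟨p ^ k, pow_pos hp k, ?_⟩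
      push_cast
      rw [map_pow]
      rw [Units.val_mk0] at hk
      calc _ ≤ (Valued.v (a v))⁻¹ * Valued.v (a v) := by gcongr
        _ = 1 := inv_mul_cancel₀ ha
  choose m hm hmv using h
  refine ⟨∏ v ∈ hfin.toFinset, m v, Finset.prod_pos fun v _ => hm v, fun v => ?_⟩
  change Valued.v (((∏ v ∈ hfin.toFinset, m v : ℕ) : 𝔸ᶠ[F]) v * a v) ≤ 1
  rw [map_mul, valued_natCast_apply]
  by_cases hv : Valued.v (a v) ≤ 1
  · exact mul_le_one' (valuation_natCast_le_one v _) hv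
  · have hmem : v ∈ hfin.toFinset := hfin.mem_toFinset.mpr hv
    rw [← Finset.mul_prod_erase _ _ hmem]
    push_cast
    rw [map_mul, mul_right_comm]
    refine mul_le_one' (hmv v) ?_
    have := valuation_natCast_le_one v (∏ w ∈ hfin.toFinset.erase v, m w)
    push_cast at this
    exact this

/-- The sets n!·(integral adeles) form a decreasing chain of compact sets with intersection {0}, so
one of them lies in `U`. Factorials make divisibility follow the order. -/
lemma exists_nat_mul_subset (U : Set 𝔸ᶠ[F]) (hU : U ∈ nhds 0) :
    ∃ N : ℕ, 0 < N ∧ ∀ a ∈ intAdeles F, (N : 𝔸ᶠ[F]) * a ∈ U := by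
  set V : ℕ → Set 𝔸ᶠ[F] := fun n => (fun a => (n.factorial : 𝔸ᶠ[F]) * a) '' intAdeles F with hV
  have hcomp : ∀ n, IsCompact (V n) := fun n => isCompact_intAdeles.image (continuous_const_mul _)
  have hanti : ∀ m n, m ≤ n → V n ⊆ V m := by
    rintro m n hmn _ ⟨a, ha, rfl⟩
    obtain ⟨d, hd⟩ := Nat.factorial_dvd_factorial hmn
    refine ⟨d * a, mul_mem_intAdeles (fun v => ?_) ha, ?_⟩
    · rw [valued_natCast_apply]
      exact valuation_natCast_le_one v d
    · rw [hd]
      push_cast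
      ring
  have hsub : ⋂ n, V n ⊆ {0} := by
    intro a ha
    rw [Set.mem_iInter] at ha
    refine FiniteAdeleRing.ext F fun v => ?_
    change a v = 0
    by_contra hne
    have hne' : Valued.v (a v) ≠ 0 := (Valuation.ne_zero_iff _).mpr hne
    obtain ⟨p, hp, hpv⟩ := exists_valuation_natCast_lt_one v
    obtain ⟨k, hk⟩ := exists_pow_lt₀ hpv (Units.mk0 _ hne')
    rw [Units.val_mk0] at hk
    obtain ⟨b, hb, hba⟩ := ha (p ^ k)
    obtain ⟨d, hd⟩ := Nat.dvd_factorial (pow_pos hp k) le_rfl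
    have h1 : Valued.v (a v) ≤ v.valuation F p ^ k := by
      rw [← hba]
      change Valued.v ((((p ^ k).factorial : ℕ) : 𝔸ᶠ[F]) v * b v) ≤ _
      rw [map_mul, valued_natCast_apply, hd]
      push_cast
      rw [map_mul, map_pow, mul_assoc]
      exact mul_le_of_le_one_right' (mul_le_one' (valuation_natCast_le_one v d) (hb v))
    exact absurd hk (not_lt.mpr h1)
  obtain ⟨n, hn⟩ := exists_subset_nhds_of_isCompact' (V := V)
    (fun m n => ⟨max m n, hanti _ _ (le_max_left _ _), hanti _ _ (le_max_right _ _)⟩) hcomp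
    (fun n => (hcomp n).isClosed) (U := U) (fun x hx => by rw [hsub hx]; exact hU)
  exact ⟨n.factorial, n.factorial_pos, fun a ha => hn ⟨a, ha, rfl⟩⟩

/-- **Strong approximation** for the additive group. -/
theorem exists_sub_mem_intAdeles (a : 𝔸ᶠ[F]) : ∃ x : F, a - algebraMap F 𝔸ᶠ[F] x ∈ intAdeles F := by
  classical
  obtain ⟨M, hM, hMa⟩ := exists_nat_mul_mem_intAdeles a
  have hM0 : (M : F) ≠ 0 := by exact_mod_cast hM.ne'
  have hMO : (M : 𝓞 F) ≠ 0 := by exact_mod_cast hM.ne'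
  have hloc : ∀ v : HeightOneSpectrum (𝓞 F), ∃ r : 𝓞 F,
      Valued.v (((M : 𝔸ᶠ[F]) * a) v - ((r : F) : v.adicCompletion F)) ≤ v.valuation F M :=
    fun v => exists_integer_valued_sub_le v (hMa v) hM0 (valuation_natCast_le_one v M)
  choose r hr using hloc
  have hfin : {v : HeightOneSpectrum (𝓞 F) | 1 < v.valuation F ((M : F)⁻¹)}.Finite :=
    HeightOneSpectrum.Support.finite (𝓞 F) ((M : F)⁻¹)
  have hexp : ∀ v : HeightOneSpectrum (𝓞 F), ∃ n : ℕ, v.valuation F M = exp (-(n : ℤ)) := fun v => by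
    have h1 := v.intValuation_if_neg hMO
    rw [← v.valuation_of_algebraMap (K := F)] at h1
    exact ⟨_, (congrArg (v.valuation F) (map_natCast (algebraMap (𝓞 F) F) M).symm).trans h1⟩
  choose e he using hexp
  -- The Chinese remainder theorem glues the local approximations of M·a to precision v(M) at the
  -- places where v(M) < 1; elsewhere integrality is already enough.
  obtain ⟨y, hy⟩ := exists_forall_sub_mem_ideal (s := hfin.toFinset)
    (fun v : HeightOneSpectrum (𝓞 F) => v.asIdeal) e (fun v _ => v.prime)
    (fun v _ w _ hvw h => hvw (HeightOneSpectrum.ext h)) (fun v => r v)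
  refine ⟨(M : F)⁻¹ * y, fun v => ?_⟩
  have key : Valued.v (((M : 𝔸ᶠ[F]) * a) v - ((y : F) : v.adicCompletion F)) ≤ v.valuation F M := by
    by_cases hv : v ∈ hfin.toFinset
    · have h1 : v.valuation F ((y - r v : 𝓞 F) : F) ≤ v.valuation F M := by
        rw [he v, v.valuation_of_algebraMap]
        exact (v.intValuation_le_pow_iff_mem _ _).mpr (hy v hv)
      rw [← valuedAdicCompletion_eq_valuation' v ((y - r v : 𝓞 F) : F)] at h1
      have h2 : (((M : 𝔸ᶠ[F]) * a) v - ((y : F) : v.adicCompletion F)) =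
          (((M : 𝔸ᶠ[F]) * a) v - ((r v : F) : v.adicCompletion F)) -
            (((y - r v : 𝓞 F) : F) : v.adicCompletion F) := by
        have h3 : (((y - r v : 𝓞 F) : F) : v.adicCompletion F) =
            ((y : F) : v.adicCompletion F) - ((r v : F) : v.adicCompletion F) := by
          have h4 : ((y - r v : 𝓞 F) : F) = (y : F) - (r v : F) := map_sub (algebraMap (𝓞 F) F) y (r v)
          rw [h4]
          exact (algebraMap F (v.adicCompletion F)).map_sub (y : F) (r v : F)
        rw [h3]
        ring
      rw [h2]
      exact Valuation.map_sub_le _ (hr v) h1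
    · have h1 : ¬ 1 < v.valuation F ((M : F)⁻¹) := fun h => hv (hfin.mem_toFinset.mpr h)
      have h2 : 1 ≤ v.valuation F M := by
        rw [map_inv₀, not_lt] at h1
        exact (inv_le_one₀ (zero_lt_iff.mpr ((Valuation.ne_zero_iff _).mpr hM0))).mp h1
      refine le_trans (Valuation.map_sub_le _ (hMa v) ?_) h2
      exact (valuedAdicCompletion_eq_valuation' v (y : F)).trans_le (v.valuation_le_one y)
  have h4 : (a - algebraMap F 𝔸ᶠ[F] ((M : F)⁻¹ * y)) v = (((M : F)⁻¹ : F) : v.adicCompletion F) *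
      (((M : 𝔸ᶠ[F]) * a) v - ((y : F) : v.adicCompletion F)) := by
    change a v - (((M : F)⁻¹ * y : F) : v.adicCompletion F) =
      _ * ((M : 𝔸ᶠ[F]) v * a v - ((y : F) : v.adicCompletion F))
    rw [natCast_apply, mul_sub, ← mul_assoc, ← adicCompletion.coe_mul, ← adicCompletion.coe_mul,
      inv_mul_cancel₀ hM0, adicCompletion.coe_one, one_mul]
  rw [h4, map_mul, valuedAdicCompletion_eq_valuation', map_inv₀,
    inv_mul_le_one₀ (zero_lt_iff.mpr ((Valuation.ne_zero_iff _).mpr hM0))]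
  exact key

end FiniteAdeles

end NonabelianDelta
end

/-! ### Real coordinates on F_∞ from an integral basis, and the norm of Q. -/

noncomputable section
namespace NonabelianDelta

section InfiniteAdeles

variable (F : Type*) [Field F] [NumberField F]

/-- The index set of an integral basis of `F`. -/
abbrev IntIndex := Module.Free.ChooseBasisIndex ℤ (𝓞 F)

/-- `F_∞` is isomorphic to the mixed space as a real vector space. -/
def infMixedEquiv : InfiniteAdeleRing F ≃ₗ[ℝ] mixedEmbedding.mixedSpace F :=
  { InfiniteAdeleRing.ringEquiv_mixedSpace F with
    map_smul' := fun r x => by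
      change InfiniteAdeleRing.ringEquiv_mixedSpace F (r • x) =
        r • InfiniteAdeleRing.ringEquiv_mixedSpace F x
      rw [Algebra.smul_def, map_mul, Algebra.smul_def]
      congr 1
      exact (InfiniteAdeleRing.ringEquiv_mixedSpace F).apply_symm_apply _ }

/-- Real coordinates on `F_∞` with respect to an integral basis of `F`. -/
def infCoord : InfiniteAdeleRing F ≃ₗ[ℝ] (IntIndex F → ℝ) :=
  infMixedEquiv F ≪≫ₗ (mixedEmbedding.latticeBasis F).equivFun

lemma infMixedEquiv_apply (x : InfiniteAdeleRing F) :
    infMixedEquiv F x = InfiniteAdeleRing.ringEquiv_mixedSpace F x := rfl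

lemma continuous_infMixedEquiv : Continuous (infMixedEquiv F) := by
  change Continuous fun x => InfiniteAdeleRing.ringEquiv_mixedSpace F x
  simp only [InfiniteAdeleRing.ringEquiv_mixedSpace_apply]
  refine Continuous.prodMk (continuous_pi fun v => ?_) (continuous_pi fun v => ?_)
  · exact (InfinitePlace.Completion.isometry_extensionEmbeddingOfIsReal v.2).continuous.comp
      (continuous_apply v.1)
  · exact (InfinitePlace.Completion.isometry_extensionEmbedding v.1).continuous.comp
      (continuous_apply v.1)

lemma continuous_infMixedEquiv_symm : Continuous (infMixedEquiv F).symm := by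
  refine continuous_pi fun v => ?_
  by_cases hv : v.IsReal
  · rw [(InfinitePlace.Completion.isometry_extensionEmbeddingOfIsReal hv).isEmbedding.continuous_iff]
    have : Continuous fun y : mixedEmbedding.mixedSpace F => y.1 ⟨v, hv⟩ := by fun_prop
    convert this using 1
    funext y
    have h := (infMixedEquiv F).apply_symm_apply y
    rw [infMixedEquiv_apply, InfiniteAdeleRing.ringEquiv_mixedSpace_apply] at h
    exact congrFun (congrArg Prod.fst h) ⟨v, hv⟩
  · have hv' := InfinitePlace.not_isReal_iff_isComplex.mp hv
    rw [(InfinitePlace.Completion.isometry_extensionEmbedding v).isEmbedding.continuous_iff]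
    have : Continuous fun y : mixedEmbedding.mixedSpace F => y.2 ⟨v, hv'⟩ := by fun_prop
    convert this using 1
    funext y
    have h := (infMixedEquiv F).apply_symm_apply y
    rw [infMixedEquiv_apply, InfiniteAdeleRing.ringEquiv_mixedSpace_apply] at h
    exact congrFun (congrArg Prod.snd h) ⟨v, hv'⟩

lemma continuous_infCoord : Continuous (infCoord F) :=
  ((mixedEmbedding.latticeBasis F).equivFun.toLinearMap.continuous_of_finiteDimensional).comp
    (continuous_infMixedEquiv F)

lemma continuous_infCoord_symm : Continuous (infCoord F).symm :=
  (continuous_infMixedEquiv_symm F).comp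
    ((mixedEmbedding.latticeBasis F).equivFun.symm.toLinearMap.continuous_of_finiteDimensional)

lemma infCoord_algebraMap (x : F) (i : IntIndex F) :
    infCoord F (algebraMap F (InfiniteAdeleRing F) x) i = ((integralBasis F).repr x i : ℝ) := by
  change (mixedEmbedding.latticeBasis F).repr (InfiniteAdeleRing.ringEquiv_mixedSpace F
    (algebraMap F (InfiniteAdeleRing F) x)) i = _
  rw [← InfiniteAdeleRing.mixedEmbedding_eq_algebraMap_comp]
  exact mixedEmbedding.latticeBasis_repr_apply F x i

variable {F} in
lemma exists_integer_iff_integralBasis {x : F} :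
    (∃ r : 𝓞 F, (r : F) = x) ↔ ∀ i, ∃ k : ℤ, (integralBasis F).repr x i = k := by
  have h : (∃ r : 𝓞 F, (r : F) = x) ↔ x ∈ (algebraMap (𝓞 F) F).range := Iff.rfl
  rw [h, ← mem_span_integralBasis, Module.Basis.mem_span_iff_repr_mem]
  refine forall_congr' fun i => ?_
  simp [eq_comm]

/-- Each component of Q has usual absolute value q, and the local multiplicities add up to [F : ℚ].
-/
lemma ideleNorm_eq {q : ℝ} (hq : 0 < q) : ideleNorm F q = q ^ Fintype.card (IntIndex F) := by
  have hcard : Fintype.card (IntIndex F) = Module.finrank ℚ F := by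
    rw [← RingOfIntegers.rank, Module.finrank_eq_card_chooseBasisIndex]
  have h : ∀ v : InfinitePlace F, ‖(algebraMap ℝ (InfiniteAdeleRing F) q) v‖ = q := by
    intro v
    set x : InfiniteAdeleRing F := algebraMap ℝ (InfiniteAdeleRing F) q
    have hx : InfiniteAdeleRing.ringEquiv_mixedSpace F x =
        algebraMap ℝ (mixedEmbedding.mixedSpace F) q :=
      (InfiniteAdeleRing.ringEquiv_mixedSpace F).apply_symm_apply _
    rw [InfiniteAdeleRing.ringEquiv_mixedSpace_apply] at hx
    by_cases hv : v.IsReal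
    · have h1 := congrFun (congrArg Prod.fst hx) ⟨v, hv⟩
      have h2 := (InfinitePlace.Completion.isometry_extensionEmbeddingOfIsReal hv).norm_map_of_map_zero
        (map_zero _) (x v)
      rw [← h2]
      refine (congrArg norm h1).trans ?_
      change ‖q‖ = q
      exact Real.norm_of_nonneg hq.le
    · have hv' := InfinitePlace.not_isReal_iff_isComplex.mp hv
      have h1 := congrFun (congrArg Prod.snd hx) ⟨v, hv'⟩
      have h2 := (InfinitePlace.Completion.isometry_extensionEmbedding v).norm_map_of_map_zero
        (map_zero _) (x v)
      rw [← h2]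
      refine (congrArg norm h1).trans ?_
      change ‖(q : ℂ)‖ = q
      rw [Complex.norm_real, Real.norm_of_nonneg hq.le]
  rw [ideleNorm, InfiniteAdeleRing.norm_def]
  simp only [h]
  rw [Finset.prod_pow_eq_pow_sum, InfinitePlace.sum_mult_eq, hcard]

end InfiniteAdeles

end NonabelianDelta
end

/-! ### Coordinates on D_𝔸 and the construction of its `AdelicLattice`. -/

noncomputable section
namespace NonabelianDelta

open IsDedekindDomain

section AdelicAlgebraTopology

variable (F : Type*) [Field F] [NumberField F] (D : Type*) [Ring D] [Algebra F D]

instance : IsModuleTopology 𝔸[F] (AdelicAlg F D) := ⟨rfl⟩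

instance : IsModuleTopology 𝔸ᶠ[F] (FinAlg F D) := ⟨rfl⟩

instance [FiniteDimensional F D] : IsTopologicalRing (AdelicAlg F D) :=
  IsModuleTopology.isTopologicalRing 𝔸[F] (AdelicAlg F D)

/-- The archimedean component of an adele. -/
def adeleInf : 𝔸[F] →+* InfiniteAdeleRing F := RingHom.fst (InfiniteAdeleRing F) 𝔸ᶠ[F]

/-- The non-archimedean component of an adele. -/
def adeleFin : 𝔸[F] →+* 𝔸ᶠ[F] := RingHom.snd (InfiniteAdeleRing F) 𝔸ᶠ[F]

/-- The adele with given components. -/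
def adeleMk (x : InfiniteAdeleRing F) (a : 𝔸ᶠ[F]) : 𝔸[F] :=
  ((x, a) : InfiniteAdeleRing F × 𝔸ᶠ[F])

/-- The index set of the rational coordinates on `D`. -/
abbrev CoordIndex := IntIndex F × Fin (Module.finrank F D)

lemma continuous_adeleInf : Continuous (adeleInf F) :=
  (continuous_fst : Continuous (Prod.fst : InfiniteAdeleRing F × 𝔸ᶠ[F] → InfiniteAdeleRing F))

lemma continuous_adeleFin : Continuous (adeleFin F) :=
  (continuous_snd : Continuous (Prod.snd : InfiniteAdeleRing F × 𝔸ᶠ[F] → 𝔸ᶠ[F]))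

lemma continuous_adeleMk {X : Type*} [TopologicalSpace X] {f : X → InfiniteAdeleRing F}
    {g : X → 𝔸ᶠ[F]} (hf : Continuous f) (hg : Continuous g) :
    Continuous fun x => adeleMk F (f x) (g x) :=
  (hf.prodMk hg : Continuous fun x => ((f x, g x) : InfiniteAdeleRing F × 𝔸ᶠ[F]))

variable {F} in
lemma adele_ext {a b : 𝔸[F]} (h1 : adeleInf F a = adeleInf F b) (h2 : adeleFin F a = adeleFin F b) :
    a = b := Prod.ext h1 h2

@[simp] lemma adeleInf_mk (x : InfiniteAdeleRing F) (a : 𝔸ᶠ[F]) : adeleInf F (adeleMk F x a) = x :=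
  rfl

@[simp] lemma adeleFin_mk (x : InfiniteAdeleRing F) (a : 𝔸ᶠ[F]) : adeleFin F (adeleMk F x a) = a :=
  rfl

@[simp] lemma adeleInf_algebraMap (x : F) :
    adeleInf F (algebraMap F 𝔸[F] x) = algebraMap F (InfiniteAdeleRing F) x := rfl

@[simp] lemma adeleFin_algebraMap (x : F) :
    adeleFin F (algebraMap F 𝔸[F] x) = algebraMap F 𝔸ᶠ[F] x := rfl

variable [FiniteDimensional F D]

/-- Adelic coordinates on `D_𝔸`. -/
def adelicCoord : AdelicAlg F D ≃ₗ[𝔸[F]] (Fin (Module.finrank F D) → 𝔸[F]) :=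
  (Algebra.TensorProduct.basis 𝔸[F] (Module.finBasis F D)).equivFun

lemma adelicCoord_tmul (a : 𝔸[F]) (δ : D) (j) :
    adelicCoord F D (a ⊗ₜ δ) j = a * algebraMap F 𝔸[F] ((Module.finBasis F D).repr δ j) := by
  simp [adelicCoord, Module.Basis.equivFun_apply]

lemma adelicCoord_diag (δ : D) (j) :
    adelicCoord F D (diag F D δ) j = algebraMap F 𝔸[F] ((Module.finBasis F D).repr δ j) := by
  rw [show diag F D δ = 1 ⊗ₜ δ from rfl, adelicCoord_tmul, one_mul]

lemma continuous_adelicCoord : Continuous (adelicCoord F D) :=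
  IsModuleTopology.continuous_of_linearMap (adelicCoord F D).toLinearMap

lemma continuous_adelicCoord_symm : Continuous (adelicCoord F D).symm :=
  IsModuleTopology.continuous_of_linearMap (adelicCoord F D).symm.toLinearMap

/-- Real coordinates of the archimedean component. -/
def realCoord : AdelicAlg F D →+ EuclideanSpace ℝ (CoordIndex F D) where
  toFun z := WithLp.toLp 2 fun p => infCoord F (adeleInf F (adelicCoord F D z p.2)) p.1
  map_zero' := by ext p; simp
  map_add' x y := by ext p; simp

lemma realCoord_apply (z : AdelicAlg F D) (p : CoordIndex F D) :
    realCoord F D z p = infCoord F (adeleInf F (adelicCoord F D z p.2)) p.1 := rfl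

/-- The element of `D_𝔸` with given real coordinates and non-archimedean component `0`. -/
def realEmbed : EuclideanSpace ℝ (CoordIndex F D) →+ AdelicAlg F D where
  toFun r := (adelicCoord F D).symm fun j =>
    adeleMk F ((infCoord F).symm fun i => r (i, j)) 0
  map_zero' := by
    rw [LinearEquiv.symm_apply_eq, map_zero]
    funext j
    refine adele_ext ?_ (map_zero _).symm
    rw [adeleInf_mk, LinearEquiv.symm_apply_eq, Pi.zero_apply, map_zero, map_zero]
    rfl
  map_add' x y := by
    rw [← map_add]
    congr 1
    funext j
    refine adele_ext ?_ ?_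
    · rw [Pi.add_apply, map_add, adeleInf_mk, adeleInf_mk, adeleInf_mk, ← map_add]
      rfl
    · rw [Pi.add_apply, map_add, adeleFin_mk, adeleFin_mk, adeleFin_mk, add_zero]

lemma adelicCoord_realEmbed (r : EuclideanSpace ℝ (CoordIndex F D)) (j) :
    adelicCoord F D (realEmbed F D r) j = adeleMk F ((infCoord F).symm fun i => r (i, j)) 0 :=
  congrFun ((adelicCoord F D).apply_symm_apply _) j

lemma realEmbed_smul_realCoord (q : ℝ) (z : AdelicAlg F D) :
    realEmbed F D (q • realCoord F D z) =
      adeleMk F (algebraMap ℝ (InfiniteAdeleRing F) q) 0 • z := by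
  apply (adelicCoord F D).injective
  funext j
  rw [adelicCoord_realEmbed, map_smul, Pi.smul_apply, smul_eq_mul]
  refine adele_ext ?_ ?_
  · have h : (fun i => (q • realCoord F D z) (i, j)) =
        q • infCoord F (adeleInf F (adelicCoord F D z j)) := by
      funext i
      rw [PiLp.smul_apply, realCoord_apply, Pi.smul_apply]
    rw [map_mul, adeleInf_mk, adeleInf_mk, h, map_smul, LinearEquiv.symm_apply_apply,
      Algebra.smul_def]
  · rw [map_mul, adeleFin_mk, adeleFin_mk, zero_mul]

/-- Projection to the archimedean part is multiplication by the idempotent (1, 0) of 𝔸_F. Being a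
scalar, it passes through products on either side, which gives `s_P_mul` and `s_P_mul'`. -/
lemma realEmbed_realCoord (z : AdelicAlg F D) :
    realEmbed F D (realCoord F D z) = adeleMk F 1 0 • z := by
  rw [← one_smul ℝ (realCoord F D z), realEmbed_smul_realCoord, map_one]

/-- The element of `D_𝔸` with given non-archimedean coordinates and archimedean component `0`. -/
def finEmbed (a : Fin (Module.finrank F D) → 𝔸ᶠ[F]) : AdelicAlg F D :=
  (adelicCoord F D).symm fun j => adeleMk F 0 (a j)

lemma continuous_finEmbed : Continuous (finEmbed F D) :=
  (continuous_adelicCoord_symm F D).comp (continuous_pi fun j =>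
    continuous_adeleMk F continuous_const (continuous_apply j))

lemma realEmbed_add_finEmbed (z : AdelicAlg F D) : realEmbed F D (realCoord F D z) +
    finEmbed F D (fun j => adeleFin F (adelicCoord F D z j)) = z := by
  apply (adelicCoord F D).injective
  rw [realEmbed_realCoord, map_add, map_smul, finEmbed, LinearEquiv.apply_symm_apply]
  funext j
  rw [Pi.add_apply, Pi.smul_apply, smul_eq_mul]
  refine adele_ext ?_ ?_
  · rw [map_add, map_mul, adeleInf_mk, adeleInf_mk, one_mul, add_zero]
  · rw [map_add, map_mul, adeleFin_mk, adeleFin_mk, zero_mul, zero_add]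

lemma continuous_realCoord : Continuous (realCoord F D) := by
  refine (PiLp.continuous_toLp 2 _).comp (continuous_pi fun p => ?_)
  exact (continuous_apply p.1).comp ((continuous_infCoord F).comp ((continuous_adeleInf F).comp
    ((continuous_apply p.2).comp (continuous_adelicCoord F D))))

lemma continuous_realEmbed : Continuous (realEmbed F D) := by
  refine (continuous_adelicCoord_symm F D).comp (continuous_pi fun j => ?_)
  refine continuous_adeleMk F ((continuous_infCoord_symm F).comp (continuous_pi fun i => ?_))
    continuous_const
  fun_prop

/-- The elements of `D_𝔸` whose non-archimedean coordinates are `N` times integral adeles. -/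
def intSubgroup (N : ℕ) : AddSubgroup (AdelicAlg F D) :=
  ⨅ j, ((intAdeles F).map (AddMonoidHom.mulLeft (N : 𝔸ᶠ[F]))).comap
    ((adeleFin F).toAddMonoidHom.comp
      ((Pi.evalAddMonoidHom _ j).comp (adelicCoord F D).toLinearMap.toAddMonoidHom))

lemma mem_intSubgroup {N : ℕ} {z : AdelicAlg F D} : z ∈ intSubgroup F D N ↔
    ∀ j, ∃ a ∈ intAdeles F, (N : 𝔸ᶠ[F]) * a = adeleFin F (adelicCoord F D z j) := by
  simp only [intSubgroup, AddSubgroup.mem_iInf, AddSubgroup.mem_comap, AddSubgroup.mem_map]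
  rfl

variable {F} in
lemma natCast_mul_inv {N : ℕ} (hN : 0 < N) (a : 𝔸ᶠ[F]) :
    (N : 𝔸ᶠ[F]) * (algebraMap F 𝔸ᶠ[F] (N : F)⁻¹ * a) = a := by
  have hN0 : (N : F) ≠ 0 := by exact_mod_cast hN.ne'
  rw [← mul_assoc, ← map_natCast (algebraMap F 𝔸ᶠ[F]), ← map_mul, mul_inv_cancel₀ hN0, map_one,
    one_mul]

variable {F} in
lemma inv_mul_natCast {N : ℕ} (hN : 0 < N) (a : 𝔸ᶠ[F]) :
    algebraMap F 𝔸ᶠ[F] (N : F)⁻¹ * ((N : 𝔸ᶠ[F]) * a) = a := by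
  rw [mul_left_comm, natCast_mul_inv hN]

lemma mem_intSubgroup_iff_inv {N : ℕ} (hN : 0 < N) {z : AdelicAlg F D} : z ∈ intSubgroup F D N ↔
    ∀ j, algebraMap F 𝔸ᶠ[F] (N : F)⁻¹ * adeleFin F (adelicCoord F D z j) ∈ intAdeles F := by
  rw [mem_intSubgroup]
  refine forall_congr' fun j => ⟨?_, fun h => ⟨_, h, natCast_mul_inv hN _⟩⟩
  rintro ⟨a, ha, h⟩
  rwa [← h, inv_mul_natCast hN]

end AdelicAlgebraTopology

section Lattice

variable (F : Type*) [Field F] [NumberField F] (D : Type*) [DivisionRing D] [Algebra F D]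
  [FiniteDimensional F D]

/-- Rational coordinates on `D`. -/
def ratCoord : D ≃+ (CoordIndex F D → ℚ) where
  toFun δ p := (integralBasis F).repr ((Module.finBasis F D).repr δ p.2) p.1
  invFun r := (Module.finBasis F D).equivFun.symm fun j =>
    (integralBasis F).equivFun.symm fun i => r (i, j)
  left_inv δ := by
    rw [LinearEquiv.symm_apply_eq]
    funext j
    rw [LinearEquiv.symm_apply_eq]
    rfl
  right_inv r := by
    funext p
    change (integralBasis F).equivFun ((Module.finBasis F D).equivFun _ p.2) p.1 = _
    rw [LinearEquiv.apply_symm_apply, LinearEquiv.apply_symm_apply]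
  map_add' x y := by
    funext p
    simp

lemma ratCoord_apply (δ : D) (p : CoordIndex F D) :
    ratCoord F D δ p = (integralBasis F).repr ((Module.finBasis F D).repr δ p.2) p.1 := rfl

lemma diag_mem_intSubgroup {N : ℕ} (hN : 0 < N) (δ : D) : diag F D δ ∈ intSubgroup F D N ↔
    ∃ k : CoordIndex F D → ℤ, ∀ p, ratCoord F D δ p = N * k p := by
  have hN0 : (N : ℚ) ≠ 0 := by exact_mod_cast hN.ne'
  have hNF : (N : F)⁻¹ = ((N : ℚ)⁻¹ : ℚ) := by push_cast; rfl
  have h1 : diag F D δ ∈ intSubgroup F D N ↔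
      ∀ j i, ∃ k : ℤ, ratCoord F D δ (i, j) = N * k := by
    rw [mem_intSubgroup_iff_inv F D hN]
    refine forall_congr' fun j => ?_
    rw [adelicCoord_diag, adeleFin_algebraMap, ← map_mul, algebraMap_mem_intAdeles,
      exists_integer_iff_integralBasis]
    refine forall_congr' fun i => exists_congr fun k => ?_
    rw [hNF, ← Rat.smul_def, map_smul, Finsupp.smul_apply, smul_eq_mul, ratCoord_apply,
      inv_mul_eq_iff_eq_mul₀ hN0]
  rw [h1]
  constructor
  · intro h
    choose k hk using h
    exact ⟨fun p => k p.2 p.1, fun p => hk p.2 p.1⟩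
  · rintro ⟨k, hk⟩ j i
    exact ⟨k (i, j), hk (i, j)⟩

/-- Strong approximation is applied to each coordinate after division by N. -/
lemma exists_sub_diag_mem_intSubgroup {N : ℕ} (hN : 0 < N) (z : AdelicAlg F D) :
    ∃ δ, z - diag F D δ ∈ intSubgroup F D N := by
  have h := fun j => exists_sub_mem_intAdeles
    (algebraMap F 𝔸ᶠ[F] (N : F)⁻¹ * adeleFin F (adelicCoord F D z j))
  choose x hx using h
  refine ⟨(Module.finBasis F D).equivFun.symm fun j => N * x j, ?_⟩
  rw [mem_intSubgroup]
  intro j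
  refine ⟨_, hx j, ?_⟩
  have hj : (Module.finBasis F D).repr ((Module.finBasis F D).equivFun.symm fun j => N * x j) j =
      N * x j := congrFun ((Module.finBasis F D).equivFun.apply_symm_apply _) j
  rw [mul_sub, natCast_mul_inv hN, map_sub, Pi.sub_apply, adelicCoord_diag, hj, map_sub,
    adeleFin_algebraMap, map_mul, map_natCast]

/-- The lattice data of `D` in `D_𝔸`. -/
def adelicLattice : AdelicLattice (AdelicAlg F D) D (CoordIndex F D) where
  diag := (diag F D).toRingHom
  P := realCoord F D
  s := realEmbed F D
  W := intSubgroup F D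
  coord := ratCoord F D
  continuous_P := continuous_realCoord F D
  continuous_s := continuous_realEmbed F D
  P_s r := by
    ext p
    rw [realCoord_apply, adelicCoord_realEmbed, adeleInf_mk, LinearEquiv.apply_symm_apply]
  s_P_mul x y := by
    rw [realEmbed_realCoord, realEmbed_realCoord, smul_mul_assoc]
  s_P_mul' x y := by
    rw [realEmbed_realCoord, realEmbed_realCoord, mul_smul_comm]
  P_diag δ := by
    ext p
    change realCoord F D (diag F D δ) p = _
    rw [realCoord_apply, adelicCoord_diag, adeleInf_algebraMap, infCoord_algebraMap]
    rfl
  isOpen_W N hN := by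
    have : (intSubgroup F D N : Set (AdelicAlg F D)) = ⋂ j, (fun z => algebraMap F 𝔸ᶠ[F] (N : F)⁻¹ *
        adeleFin F (adelicCoord F D z j)) ⁻¹' (intAdeles F) := by
      ext z
      rw [SetLike.mem_coe, mem_intSubgroup_iff_inv F D hN, Set.mem_iInter]
      rfl
    rw [this]
    exact isOpen_iInter_of_finite fun j => isOpen_intAdeles.preimage
      (continuous_const.mul ((continuous_adeleFin F).comp
        ((continuous_apply j).comp (continuous_adelicCoord F D))))
  s_mem_W N r := by
    rw [mem_intSubgroup]
    intro j
    exact ⟨0, zero_mem _, by rw [adelicCoord_realEmbed, adeleFin_mk, mul_zero]⟩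
  diag_mem_W N hN δ := diag_mem_intSubgroup F D hN δ
  W_le M N := by
    rintro ⟨d, rfl⟩ z hz
    rw [mem_intSubgroup] at hz ⊢
    intro j
    obtain ⟨a, ha, h⟩ := hz j
    refine ⟨d * a, mul_mem_intAdeles (fun v => ?_) ha, by rw [← h]; push_cast; ring⟩
    rw [valued_natCast_apply]
    exact valuation_natCast_le_one v d
  exists_W_subset U hU := by
    have h0 : finEmbed F D 0 = 0 := by
      rw [finEmbed, LinearEquiv.symm_apply_eq, map_zero]
      rfl
    have h1 : finEmbed F D ⁻¹' U ∈ nhds 0 :=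
      (continuous_finEmbed F D).continuousAt.preimage_mem_nhds (by rwa [h0])
    rw [nhds_pi, Filter.mem_pi'] at h1
    obtain ⟨I, t, ht, hI⟩ := h1
    choose N hN hNt using fun j => exists_nat_mul_subset (t j) (ht j)
    refine ⟨∏ j, N j, Finset.prod_pos fun j _ => hN j, fun z hz hPz => ?_⟩
    rw [← realEmbed_add_finEmbed F D z, hPz, map_zero, zero_add]
    refine hI fun j _ => ?_
    rw [mem_intSubgroup] at hz
    obtain ⟨a, ha, h⟩ := hz j
    rw [← h]
    obtain ⟨d, hd⟩ := Finset.dvd_prod_of_mem N (Finset.mem_univ j)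
    rw [hd, Nat.cast_mul, mul_assoc]
    refine hNt j _ (mul_mem_intAdeles (fun v => ?_) ha)
    rw [valued_natCast_apply]
    exact valuation_natCast_le_one v d
  exists_sub_mem_W N hN z := exists_sub_diag_mem_intSubgroup F D hN z
  exists_isCompact R := by
    refine ⟨(fun p : EuclideanSpace ℝ (CoordIndex F D) × (Fin (Module.finrank F D) → 𝔸ᶠ[F]) =>
      realEmbed F D p.1 + finEmbed F D p.2) ''
        (Metric.closedBall 0 R ×ˢ Set.univ.pi fun _ => (intAdeles F : Set 𝔸ᶠ[F])), ?_, ?_⟩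
    · refine IsCompact.image ((isCompact_closedBall _ _).prod
        (isCompact_univ_pi fun _ => isCompact_intAdeles)) ?_
      exact ((continuous_realEmbed F D).comp continuous_fst).add
        ((continuous_finEmbed F D).comp continuous_snd)
    · intro z hz hR
      refine ⟨(realCoord F D z, fun j => adeleFin F (adelicCoord F D z j)),
        ⟨by simpa using hR, fun j _ => ?_⟩, realEmbed_add_finEmbed F D z⟩
      rw [mem_intSubgroup] at hz
      obtain ⟨a, ha, h⟩ := hz j
      rw [Nat.cast_one, one_mul] at h
      rwa [h] at ha

lemma realIdele_smul {q : ℝ} (z : AdelicAlg F D) :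
    realIdele F q • z = (adelicLattice F D).scale q z := by
  have h : (adelicLattice F D).scale q z =
      realEmbed F D (q • realCoord F D z) + (z - realEmbed F D (realCoord F D z)) := rfl
  rw [h, realEmbed_smul_realCoord, realEmbed_realCoord]
  have h2 : z - adeleMk F 1 0 • z = (1 - adeleMk F 1 0) • z := by rw [sub_smul, one_smul]
  rw [h2, ← add_smul]
  congr 1
  refine adele_ext ?_ ?_
  · rw [map_add, map_sub, map_one, adeleInf_mk, adeleInf_mk, sub_self, add_zero]
    rfl
  · rw [map_add, map_sub, map_one, adeleFin_mk, adeleFin_mk, sub_zero, zero_add]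
    rfl

end Lattice

end NonabelianDelta
end

/-! ### The reduced trace and its character; archimedean and finite coordinates. -/

noncomputable section
namespace NonabelianDelta

section Trace

variable (F : Type*) [Field F] (D : Type*) [Ring D] [Algebra F D]

lemma reducedTrace_mul_comm (x y : D) : reducedTrace F D (x * y) = reducedTrace F D (y * x) := by
  have h : ∀ x y : D, LinearMap.mul F D (x * y) = LinearMap.mul F D x * LinearMap.mul F D y :=
    fun x y => LinearMap.ext fun z => mul_assoc x y z
  simp only [reducedTrace, LinearMap.smul_apply, LinearMap.comp_apply]
  rw [h, h, LinearMap.trace_mul_comm]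

lemma reducedTrace_one_ne_zero [CharZero F] [FiniteDimensional F D] [Nontrivial D] :
    reducedTrace F D 1 ≠ 0 := by
  have h : LinearMap.mul F D 1 = 1 := LinearMap.ext fun z => one_mul z
  have hpos : 0 < Module.finrank F D := Module.finrank_pos
  have h1 : Nat.sqrt (Module.finrank F D) ≠ 0 := (Nat.sqrt_pos.mpr hpos).ne'
  simp only [reducedTrace, LinearMap.smul_apply, LinearMap.comp_apply]
  rw [h, LinearMap.trace_one, smul_eq_mul]
  exact mul_ne_zero (inv_ne_zero (Nat.cast_ne_zero.mpr h1)) (Nat.cast_ne_zero.mpr hpos.ne')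

variable [NumberField F]

lemma adelicTrd_tmul (a : 𝔸[F]) (x : D) :
    adelicTrd F D (a ⊗ₜ x) = reducedTrace F D x • a := by
  simp [adelicTrd]

lemma adelicTrd_mul_comm (x y : AdelicAlg F D) :
    adelicTrd F D (x * y) = adelicTrd F D (y * x) := by
  induction x using TensorProduct.induction_on with
  | zero => simp
  | add x₁ x₂ h₁ h₂ => rw [add_mul, mul_add, map_add, map_add, h₁, h₂]
  | tmul a x =>
    induction y using TensorProduct.induction_on with
    | zero => simp
    | add y₁ y₂ h₁ h₂ => rw [add_mul, mul_add, map_add, map_add, h₁, h₂]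
    | tmul b y =>
      rw [Algebra.TensorProduct.tmul_mul_tmul, Algebra.TensorProduct.tmul_mul_tmul, adelicTrd_tmul,
        adelicTrd_tmul, reducedTrace_mul_comm, mul_comm a b]

lemma adelicTrd_diag (x : D) :
    adelicTrd F D (diag F D x) = algebraMap F 𝔸[F] (reducedTrace F D x) := by
  rw [show diag F D x = 1 ⊗ₜ x from rfl, adelicTrd_tmul, Algebra.algebraMap_eq_smul_one]

/-- Since trd(1) ≠ 0, multiples of 1 already reach every adele. This transfers nontriviality from ψ
to ψ ∘ trd. -/
lemma adelicTrd_surjective [FiniteDimensional F D] [Nontrivial D] :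
    Function.Surjective (adelicTrd F D) := fun a => by
  refine ⟨((reducedTrace F D 1)⁻¹ • a) ⊗ₜ 1, ?_⟩
  rw [adelicTrd_tmul, smul_inv_smul₀ (reducedTrace_one_ne_zero F D)]

lemma continuous_adelicTrd [FiniteDimensional F D] : Continuous (adelicTrd F D) :=
  IsModuleTopology.continuous_of_linearMap _

end Trace

section Character

variable {F : Type*} [Field F] [NumberField F] (D : Type*) [DivisionRing D] [Algebra F D]
  [FiniteDimensional F D]

/-- The character `ψ ∘ trd` of `D_𝔸`. -/
def trdChar (ψ : AddChar 𝔸[F] ℂ) : AddChar (AdelicAlg F D) ℂ :=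
  ψ.compAddMonoidHom (adelicTrd F D).toAddMonoidHom

/-- The duality defined by `ψ ∘ trd`. -/
def adelicDuality (ψ : AddChar 𝔸[F] ℂ) (hψ_cont : Continuous ψ)
    (hψ_inv : ∀ a : F, ψ (algebraMap F 𝔸[F] a) = 1) (hψ_ne : ψ ≠ 1) :
    DualityChar (adelicLattice F D) :=
  have hc : Continuous (trdChar D ψ) := hψ_cont.comp (continuous_adelicTrd F D)
  have hD : ∀ δ, trdChar D ψ ((adelicLattice F D).diag δ) = 1 := fun δ =>
    (congrArg ψ (adelicTrd_diag F D δ)).trans (hψ_inv _)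
  have hne : trdChar D ψ ≠ 1 := fun h => hψ_ne <| by
    ext a
    obtain ⟨z, rfl⟩ := adelicTrd_surjective F D a
    exact DFunLike.congr_fun h z
  { char := trdChar D ψ
    continuous_char := hc
    char_diag := hD
    T := ((adelicLattice F D).exists_dual hc hD hne).choose
    char_diag_mul_s := ((adelicLattice F D).exists_dual hc hD hne).choose_spec }

end Character

section Components

variable (F : Type*) [Field F] [NumberField F] (D : Type*) [Ring D] [Algebra F D]
  [FiniteDimensional F D]

/-- Linear coordinates on `D_∞`. -/
def infAlgCoord : InfAlg F D ≃ₗ[ℝ] EuclideanSpace ℝ (CoordIndex F D) :=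
  ((Algebra.TensorProduct.basis (InfiniteAdeleRing F) (Module.finBasis F D)).equivFun.restrictScalars ℝ
    ≪≫ₗ LinearEquiv.piCongrRight fun _ => infCoord F) ≪≫ₗ
  ({ toFun := fun r => WithLp.toLp 2 fun p => r p.2 p.1
     invFun := fun r j i => r (i, j)
     map_add' := fun _ _ => rfl
     map_smul' := fun _ _ => rfl
     left_inv := fun _ => rfl
     right_inv := fun _ => rfl } :
      (Fin (Module.finrank F D) → IntIndex F → ℝ) ≃ₗ[ℝ] EuclideanSpace ℝ (CoordIndex F D))

lemma infAlgCoord_apply (z : InfAlg F D) (p : CoordIndex F D) : infAlgCoord F D z p = infCoord F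
    ((Algebra.TensorProduct.basis (InfiniteAdeleRing F) (Module.finBasis F D)).repr z p.2) p.1 := rfl

lemma infAlgCoord_toInf (z : AdelicAlg F D) : infAlgCoord F D (toInf F D z) = realCoord F D z := by
  induction z using TensorProduct.induction_on with
  | zero => simp
  | add x y hx hy => rw [map_add, map_add, map_add, hx, hy]
  | tmul a x =>
    ext p
    rw [infAlgCoord_apply, realCoord_apply, adelicCoord_tmul, map_mul, adeleInf_algebraMap]
    rw [show toInf F D (a ⊗ₜ x) = adeleInf F a ⊗ₜ x from rfl, Algebra.TensorProduct.basis_repr_tmul]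
    rfl

instance : IsTopologicalRing (FinAlg F D) :=
  IsModuleTopology.isTopologicalRing 𝔸ᶠ[F] (FinAlg F D)

/-- Adelic coordinates on `D_{𝔸^∞}`. -/
def finAlgCoord : FinAlg F D ≃ₗ[𝔸ᶠ[F]] (Fin (Module.finrank F D) → 𝔸ᶠ[F]) :=
  (Algebra.TensorProduct.basis 𝔸ᶠ[F] (Module.finBasis F D)).equivFun

lemma finAlgCoord_toFin (z : AdelicAlg F D) (j) :
    finAlgCoord F D (toFin F D z) j = adeleFin F (adelicCoord F D z j) := by
  induction z using TensorProduct.induction_on with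
  | zero => simp
  | add x y hx hy => rw [map_add, map_add, map_add, Pi.add_apply, Pi.add_apply, map_add, hx, hy]
  | tmul a x =>
    rw [adelicCoord_tmul, map_mul, adeleFin_algebraMap,
      show toFin F D (a ⊗ₜ x) = adeleFin F a ⊗ₜ x from rfl, finAlgCoord,
      Module.Basis.equivFun_apply, Algebra.TensorProduct.basis_repr_tmul]
    rfl

lemma continuous_finAlgCoord : Continuous (finAlgCoord F D) :=
  IsModuleTopology.continuous_of_linearMap (finAlgCoord F D).toLinearMap

lemma continuous_finAlgCoord_symm : Continuous (finAlgCoord F D).symm :=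
  IsModuleTopology.continuous_of_linearMap (finAlgCoord F D).symm.toLinearMap

/-- `(D_{𝔸^∞})^m` is homeomorphic to a power of `𝔸_F^∞`. -/
def finAlgPiHomeomorph (m : ℕ) :
    (Fin m → FinAlg F D) ≃ₜ (Fin m × Fin (Module.finrank F D) → 𝔸ᶠ[F]) where
  toFun v p := finAlgCoord F D (v p.1) p.2
  invFun a i := (finAlgCoord F D).symm fun j => a (i, j)
  left_inv v := by
    funext i
    change (finAlgCoord F D).symm (fun j => finAlgCoord F D (v i) j) = v i
    rw [LinearEquiv.symm_apply_apply]
  right_inv a := by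
    funext p
    change finAlgCoord F D ((finAlgCoord F D).symm fun j => a (p.1, j)) p.2 = a p
    rw [LinearEquiv.apply_symm_apply]
  continuous_toFun := continuous_pi fun p => (continuous_apply p.2).comp
    ((continuous_finAlgCoord F D).comp (continuous_apply p.1))
  continuous_invFun := continuous_pi fun i => (continuous_finAlgCoord_symm F D).comp
    (continuous_pi fun j => continuous_apply (i, j))

end Components

section LocallyConstant

variable {F : Type*} [Field F] [NumberField F] {J : Type*} [Finite J]

/-- A locally constant function of compact support on a power of `𝔸_F^∞` is supported in some
`K⁻¹ Ô` and invariant under some `M Ô`. -/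
lemma exists_support_and_invariance {H : (J → 𝔸ᶠ[F]) → ℂ} (hl : IsLocallyConstant H)
    (hc : HasCompactSupport H) : ∃ K M : ℕ, 0 < K ∧ 0 < M ∧
      (∀ a, H a ≠ 0 → ∀ j, (K : 𝔸ᶠ[F]) * a j ∈ intAdeles F) ∧
      ∀ a w : J → 𝔸ᶠ[F], (∀ j, ∃ b ∈ intAdeles F, (M : 𝔸ᶠ[F]) * b = w j) → H (a + w) = H a := by
  have hmulInt : ∀ (n : ℕ) (a : 𝔸ᶠ[F]), a ∈ intAdeles F → (n : 𝔸ᶠ[F]) * a ∈ intAdeles F :=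
    fun n a ha => mul_mem_intAdeles (fun v => by
      rw [valued_natCast_apply]
      exact valuation_natCast_le_one v n) ha
  set U : ℕ → Set (J → 𝔸ᶠ[F]) := fun n => {a | ∀ j, (n.factorial : 𝔸ᶠ[F]) * a j ∈ intAdeles F}
    with hU
  have hUmono : Monotone U := by
    intro m n hmn a ha j
    obtain ⟨d, hd⟩ := Nat.factorial_dvd_factorial hmn
    rw [hd, mul_comm (m.factorial), Nat.cast_mul, mul_assoc]
    exact hmulInt _ _ (ha j)
  have hUopen : ∀ n, IsOpen (U n) := fun n => by
    have : U n = ⋂ j, (fun a : J → 𝔸ᶠ[F] => (n.factorial : 𝔸ᶠ[F]) * a j) ⁻¹' intAdeles F := by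
      ext a
      simp [hU]
    rw [this]
    exact isOpen_iInter_of_finite fun j =>
      isOpen_intAdeles.preimage (continuous_const.mul (continuous_apply j))
  have hUcover : ∀ a, ∃ n, a ∈ U n := fun a => by
    have := Fintype.ofFinite J
    choose M hM hMa using fun j => exists_nat_mul_mem_intAdeles (a j)
    refine ⟨∏ j, M j, fun j => ?_⟩
    obtain ⟨d, hd⟩ := (Finset.dvd_prod_of_mem M (Finset.mem_univ j)).trans
      (Nat.dvd_factorial (Finset.prod_pos fun j _ => hM j) le_rfl)
    rw [hd, mul_comm (M j), Nat.cast_mul, mul_assoc]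
    exact hmulInt _ _ (hMa j)
  -- The sets `U n` exhaust the space by open sets increasing with n, so the compact support lies in
  -- one of them.
  obtain ⟨k, hk⟩ := hc.isCompact.elim_directed_cover U hUopen
    (fun a _ => Set.mem_iUnion.mpr (hUcover a)) hUmono.directed_le
  have hBcompact : IsCompact (U k) := by
    have : U k = (fun (a : J → 𝔸ᶠ[F]) j => algebraMap F 𝔸ᶠ[F] ((k.factorial : F)⁻¹) * a j) ''
        Set.univ.pi fun _ => (intAdeles F : Set 𝔸ᶠ[F]) := by
      ext a
      constructor
      · intro ha
        refine ⟨fun j => k.factorial * a j, fun j _ => ha j, ?_⟩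
        funext j
        exact inv_mul_natCast k.factorial_pos _
      · rintro ⟨b, hb, rfl⟩ j
        rw [natCast_mul_inv k.factorial_pos]
        exact hb j trivial
    rw [this]
    exact (isCompact_univ_pi fun _ => isCompact_intAdeles).image
      (continuous_pi fun j => continuous_const.mul (continuous_apply j))
  set T : ℕ → Set (J → 𝔸ᶠ[F]) := fun n => {w | ∀ j, ∃ b ∈ intAdeles F, (n.factorial : 𝔸ᶠ[F]) * b = w j}
    with hT
  have hTanti : Antitone T := by
    intro m n hmn w hw j
    obtain ⟨d, hd⟩ := Nat.factorial_dvd_factorial hmn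
    obtain ⟨b, hb, hbw⟩ := hw j
    exact ⟨d * b, hmulInt d b hb, by rw [← hbw, hd]; push_cast; ring⟩
  have hTadd : ∀ n, ∀ w ∈ T n, ∀ w' ∈ T n, w + w' ∈ T n := fun n w hw w' hw' j => by
    obtain ⟨b, hb, hbw⟩ := hw j
    obtain ⟨b', hb', hbw'⟩ := hw' j
    exact ⟨b + b', add_mem hb hb', by rw [mul_add, hbw, hbw']; rfl⟩
  have hT0 : ∀ n, 0 ∈ T n := fun n j => ⟨0, zero_mem _, mul_zero _⟩
  have hTnhds : ∀ n, T n ∈ nhds 0 := fun n => by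
    have : T n = ⋂ j, (fun a : J → 𝔸ᶠ[F] => algebraMap F 𝔸ᶠ[F] ((n.factorial : F)⁻¹) * a j) ⁻¹'
        intAdeles F := by
      ext a
      simp only [hT, Set.mem_iInter, Set.mem_preimage]
      refine forall_congr' fun j => ⟨?_, fun h => ⟨_, h, natCast_mul_inv n.factorial_pos _⟩⟩
      rintro ⟨b, hb, h⟩
      rw [← h, inv_mul_natCast n.factorial_pos]
      exact hb
    refine IsOpen.mem_nhds ?_ (hT0 n)
    rw [this]
    exact isOpen_iInter_of_finite fun j =>
      isOpen_intAdeles.preimage (continuous_const.mul (continuous_apply j))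
  have hTbasis : ∀ V ∈ nhds (0 : J → 𝔸ᶠ[F]), ∃ n, T n ⊆ V := fun V hV => by
    have := Fintype.ofFinite J
    rw [nhds_pi, Filter.mem_pi'] at hV
    obtain ⟨I, t, ht, hI⟩ := hV
    choose N hN hNt using fun j => exists_nat_mul_subset (t j) (ht j)
    refine ⟨∏ j, N j, fun w hw => hI fun j _ => ?_⟩
    obtain ⟨b, hb, hbw⟩ := hw j
    obtain ⟨d, hd⟩ := (Finset.dvd_prod_of_mem N (Finset.mem_univ j)).trans
      (Nat.dvd_factorial (Finset.prod_pos fun j _ => hN j) le_rfl)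
    rw [← hbw, hd, Nat.cast_mul, mul_assoc]
    exact hNt j _ (hmulInt d b hb)
  set V : ℕ → Set (J → 𝔸ᶠ[F]) := fun n => {a | ∀ w ∈ T n, H (a + w) = H a} with hV
  have hVmono : Monotone V := fun m n hmn a ha w hw => ha w (hTanti hmn hw)
  have hVopen : ∀ n, IsOpen (V n) := fun n => by
    rw [isOpen_iff_mem_nhds]
    intro a ha
    have h1 : (fun x => x - a) ⁻¹' T n ∈ nhds a :=
      (continuous_id.sub continuous_const).continuousAt.preimage_mem_nhds (by simpa using hTnhds n)
    refine Filter.mem_of_superset h1 fun x hx w hw => ?_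
    have hx' : x = a + (x - a) := by abel
    rw [hx', add_assoc, ha _ (hTadd n _ hx _ hw), ha _ hx]
  have hVcover : ∀ a, ∃ n, a ∈ V n := fun a => by
    have h1 : (fun w => a + w) ⁻¹' {x | H x = H a} ∈ nhds 0 :=
      (continuous_const.add continuous_id).continuousAt.preimage_mem_nhds
        (by rw [Pi.add_apply, id_eq, add_zero]; exact hl.eventually_eq a)
    obtain ⟨n, hn⟩ := hTbasis _ h1
    exact ⟨n, fun w hw => hn hw⟩
  -- Compactness of `U k` makes the invariance of H uniform there.
  obtain ⟨n, hn⟩ := hBcompact.elim_directed_cover V hVopen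
    (fun a _ => Set.mem_iUnion.mpr (hVcover a)) hVmono.directed_le
  have hsupp : ∀ a, H a ≠ 0 → a ∈ U k := fun a ha => hk (subset_tsupport _ ha)
  have hTU : ∀ w ∈ T n, w ∈ U k := fun w hw j => by
    obtain ⟨b, hb, hbw⟩ := hw j
    rw [← hbw]
    exact hmulInt _ _ (hmulInt _ _ hb)
  have hUadd : ∀ a w, a + w ∈ U k → w ∈ U k → a ∈ U k := fun a w ha hw j => by
    have h1 := sub_mem (ha j) (hw j)
    rw [Pi.add_apply, mul_add, add_sub_cancel_right] at h1
    exact h1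
  refine ⟨k.factorial, n.factorial, k.factorial_pos, n.factorial_pos, hsupp, fun a w hw => ?_⟩
  -- Outside `U k` both values vanish: `U k` is stable under subtraction and contains `T n`, so
  -- adding w cannot bring a into it.
  by_cases ha : a ∈ U k
  · exact hn ha w hw
  · have h1 : H a = 0 := by_contra fun h => ha (hsupp a h)
    have h2 : H (a + w) = 0 := by_contra fun h => ha (hUadd a w (hsupp _ h) (hTU w hw))
    rw [h1, h2]

end LocallyConstant

end NonabelianDelta
end

/-! ### The Schwartz space in terms of the lattice model, and the self-dual measure. -/

noncomputable section
namespace NonabelianDelta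

/-- A function on `A^m` that decays rapidly in the archimedean direction and has bounded support in
the non-archimedean direction, separately in each entry. -/
structure HasDecay {A D ι : Type*} [Ring A] [TopologicalSpace A] [DivisionRing D] [Fintype ι]
    (L : AdelicLattice A D ι) {m : ℕ} (f : (Fin m → A) → ℂ) : Prop where
  support : ∃ K : ℕ, 0 < K ∧ ∀ z, f z ≠ 0 → ∀ i, K • z i ∈ L.W 1
  bound : ∀ k : ℕ, ∃ C, 0 ≤ C ∧ ∀ z i, ‖f z‖ ≤ C * ((1 + ‖L.P (z i)‖) ^ k)⁻¹

namespace HasDecay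

variable {A D ι : Type*} [Ring A] [TopologicalSpace A] [DivisionRing D] [Fintype ι]
  {L : AdelicLattice A D ι} {m : ℕ}

lemma zero : HasDecay L (0 : (Fin m → A) → ℂ) :=
  ⟨⟨1, one_pos, fun z hz => absurd rfl hz⟩, fun k => ⟨0, le_rfl, fun z i => by simp⟩⟩

lemma add {f g : (Fin m → A) → ℂ} (hf : HasDecay L f) (hg : HasDecay L g) : HasDecay L (f + g) := by
  refine ⟨?_, fun k => ?_⟩
  · obtain ⟨K, hK, hKf⟩ := hf.support
    obtain ⟨M, hM, hMg⟩ := hg.support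
    refine ⟨K * M, Nat.mul_pos hK hM, fun z hz i => ?_⟩
    by_cases h : f z = 0
    · rw [mul_smul]
      refine AddSubgroup.nsmul_mem _ (hMg z (fun h' => hz ?_) i) K
      rw [Pi.add_apply, h, h', add_zero]
    · rw [mul_comm, mul_smul]
      exact AddSubgroup.nsmul_mem _ (hKf z h i) M
  · obtain ⟨C, hC, hCf⟩ := hf.bound k
    obtain ⟨C', hC', hCg⟩ := hg.bound k
    refine ⟨C + C', add_nonneg hC hC', fun z i => ?_⟩
    rw [add_mul]
    exact (norm_add_le _ _).trans (add_le_add (hCf z i) (hCg z i))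

lemma smul {f : (Fin m → A) → ℂ} (hf : HasDecay L f) (c : ℂ) : HasDecay L (c • f) := by
  refine ⟨?_, fun k => ?_⟩
  · obtain ⟨K, hK, hKf⟩ := hf.support
    exact ⟨K, hK, fun z hz i => hKf z (fun h => hz (by rw [Pi.smul_apply, h, smul_zero])) i⟩
  · obtain ⟨C, hC, hCf⟩ := hf.bound k
    refine ⟨‖c‖ * C, by positivity, fun z i => ?_⟩
    rw [Pi.smul_apply, norm_smul, mul_assoc]
    gcongr
    exact hCf z i

end HasDecay

section SchwartzFunctions

variable {F : Type*} [Field F] [NumberField F] {D : Type*} [DivisionRing D] [Algebra F D]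
  [FiniteDimensional F D]

lemma IsSchwartz.exists_schwartzMap {m : ℕ} {g : (Fin m → InfAlg F D) → ℂ} (hg : IsSchwartz g) :
    ∃ G : 𝓢(Fin m → EuclideanSpace ℝ (CoordIndex F D), ℂ),
      ∀ x, g x = G fun i => infAlgCoord F D (x i) := by
  obtain ⟨n, e, g', h⟩ := hg
  set e' : (Fin m → EuclideanSpace ℝ (CoordIndex F D)) ≃ₗ[ℝ] EuclideanSpace ℝ (Fin n) :=
    (LinearEquiv.piCongrRight fun _ => (infAlgCoord F D).symm) ≪≫ₗ e with he'
  refine ⟨SchwartzMap.compCLMOfContinuousLinearEquiv ℂ e'.toContinuousLinearEquiv g', fun x => ?_⟩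
  have : e' (fun i => infAlgCoord F D (x i)) = e x := by
    rw [he', LinearEquiv.trans_apply]
    congr 1
    funext i
    exact (infAlgCoord F D).symm_apply_apply _
  rw [h, ← this]
  rfl

lemma finAlgPiHomeomorph_toFin {m : ℕ} (z : Fin m → AdelicAlg F D)
    (p : Fin m × Fin (Module.finrank F D)) :
    finAlgPiHomeomorph F D m (fun i => toFin F D (z i)) p =
      adeleFin F (adelicCoord F D (z p.1) p.2) := finAlgCoord_toFin F D (z p.1) p.2

lemma nsmul_mem_intSubgroup_one {K : ℕ} {z : AdelicAlg F D} : K • z ∈ intSubgroup F D 1 ↔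
    ∀ j, (K : 𝔸ᶠ[F]) * adeleFin F (adelicCoord F D z j) ∈ intAdeles F := by
  rw [mem_intSubgroup]
  refine forall_congr' fun j => ?_
  rw [map_nsmul, Pi.smul_apply, map_nsmul, nsmul_eq_mul]
  simp

lemma exists_support_and_invariance_toFin {m : ℕ} {h : (Fin m → FinAlg F D) → ℂ}
    (hl : IsLocallyConstant h) (hc : HasCompactSupport h) : ∃ K M : ℕ, 0 < K ∧ 0 < M ∧
      (∀ z : Fin m → AdelicAlg F D, h (fun i => toFin F D (z i)) ≠ 0 →
        ∀ i, K • z i ∈ intSubgroup F D 1) ∧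
      ∀ z w : Fin m → AdelicAlg F D, (∀ i, w i ∈ intSubgroup F D M) →
        h (fun i => toFin F D (z i + w i)) = h (fun i => toFin F D (z i)) := by
  set e := finAlgPiHomeomorph F D m
  obtain ⟨K, M, hK, hM, hsupp, hinv⟩ := exists_support_and_invariance
    (hl.comp_continuous e.symm.continuous) (hc.comp_homeomorph e.symm)
  refine ⟨K, M, hK, hM, fun z hz i => ?_, fun z w hw => ?_⟩
  · rw [nsmul_mem_intSubgroup_one]
    intro j
    have := hsupp (e fun i => toFin F D (z i)) (by simpa using hz) (i, j)
    rwa [finAlgPiHomeomorph_toFin] at this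
  · have h1 := hinv (e fun i => toFin F D (z i)) (e fun i => toFin F D (w i)) fun p => by
      rw [finAlgPiHomeomorph_toFin]
      exact (mem_intSubgroup F D).mp (hw p.1) p.2
    have h2 : e (fun i => toFin F D (z i)) + e (fun i => toFin F D (w i)) =
        e fun i => toFin F D (z i + w i) := by
      funext p
      rw [Pi.add_apply, finAlgPiHomeomorph_toFin, finAlgPiHomeomorph_toFin,
        finAlgPiHomeomorph_toFin, map_add, Pi.add_apply, map_add]
    rw [h2] at h1
    simpa using h1

/-- The archimedean factor decays in the sup norm, which dominates each entry; the finite factor is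
bounded and has compact support. -/
lemma hasDecay_of_mem_schwartzSpace {m : ℕ} {f : (Fin m → AdelicAlg F D) → ℂ}
    (hf : f ∈ schwartzSpace F D m) : HasDecay (adelicLattice F D) f := by
  induction hf using Submodule.span_induction with
  | zero => exact HasDecay.zero
  | add f g _ _ hf hg => exact hf.add hg
  | smul c f _ hf => exact hf.smul c
  | mem f hf =>
    obtain ⟨g, h, hg, hl, hc, rfl⟩ := hf
    obtain ⟨G, hG⟩ := hg.exists_schwartzMap
    obtain ⟨K, M, hK, hM, hsupp, hinv⟩ := exists_support_and_invariance_toFin hl hc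
    refine ⟨⟨K, hK, fun z hz i => hsupp z (fun h0 => hz ?_) i⟩, fun k => ?_⟩
    · simp only [h0, mul_zero]
    · obtain ⟨C, hC, hCG⟩ := schwartz_bound G k
      obtain ⟨B, hB⟩ := hl.continuous.bounded_above_of_compact_support hc
      have hB0 : 0 ≤ B := (norm_nonneg _).trans (hB 0)
      refine ⟨C * B, mul_nonneg hC hB0, fun z i => ?_⟩
      simp only [hG, infAlgCoord_toInf]
      rw [norm_mul]
      calc _ ≤ C * ((1 + ‖realCoord F D (z i)‖) ^ k)⁻¹ * B := by
            refine mul_le_mul ((hCG _).trans ?_) (hB _) (norm_nonneg _) (by positivity)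
            gcongr
            exact norm_le_pi_norm (fun i => realCoord F D (z i)) i
        _ = _ := by
            change _ = C * B * ((1 + ‖realCoord F D (z i)‖) ^ k)⁻¹
            ring

lemma cons_zero_mem_basicSpan {f : (Fin 2 → AdelicAlg F D) → ℂ} (hf : f ∈ schwartzSpace F D 2) :
    (fun z => f ![0, z]) ∈ AdelicLattice.basicSpan (adelicLattice F D) := by
  induction hf using Submodule.span_induction with
  | zero => exact Submodule.zero_mem _
  | add f g _ _ hf hg => exact Submodule.add_mem _ hf hg
  | smul c f _ hf => exact Submodule.smul_mem _ c hf
  | mem f hf =>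
    obtain ⟨g, h, hg, hl, hc, rfl⟩ := hf
    obtain ⟨G, hG⟩ := hg.exists_schwartzMap
    obtain ⟨K, M, hK, hM, hsupp, hinv⟩ := exists_support_and_invariance_toFin hl hc
    set E := EuclideanSpace ℝ (CoordIndex F D)
    set s := ContinuousLinearMap.single ℝ (fun _ : Fin 2 => E) 1
    -- Inclusion of the second entry does not decrease norms, so the restriction of a Schwartz
    -- function along it is Schwartz.
    have hs : AntilipschitzWith 1 s := AddMonoidHomClass.antilipschitz_of_bound _ fun x => by
      rw [NNReal.coe_one, one_mul]
      have h1 : s x 1 = x := by simp [s]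
      exact (congrArg norm h1).ge.trans (norm_le_pi_norm (s x) 1)
    set G' : 𝓢(E, ℂ) := SchwartzMap.compCLMOfAntilipschitz ℂ s.hasTemperateGrowth hs G
    have heq : (fun z => (fun x => g (fun i => toInf F D (x i)) * h fun i => toFin F D (x i)) ![0, z])
        = fun z => G' ((adelicLattice F D).P z) * h fun i => toFin F D ((![0, z] : Fin 2 → _) i) := by
      funext z
      refine congrArg₂ (· * ·) ((hG _).trans ?_) rfl
      change _ = G (s (realCoord F D z))
      congr 1
      funext i
      rw [infAlgCoord_toInf]
      fin_cases i <;> simp [s]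
    rw [heq]
    refine AdelicLattice.mul_mem_basicSpan G' hK hM (fun z w hw => ?_) fun z hz => hsupp _ hz 1
    have h1 := hinv ![0, z] ![0, w] fun i => by
      fin_cases i
      · exact zero_mem _
      · exact hw
    convert h1 using 3
    next i => fin_cases i <;> simp

/-- This makes the self-duality hypothesis available for g ⊗ 1_{W 1}, the functions used to compute
the covolume; the finite part of W 1 is compact and open. -/
lemma basic_mem_schwartzSpace (g : 𝓢(EuclideanSpace ℝ (CoordIndex F D), ℂ)) :
    (fun v : Fin 1 → AdelicAlg F D => (adelicLattice F D).basic g 0 1 (v 0)) ∈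
      schwartzSpace F D 1 := by
  set S : Set (Fin 1 → FinAlg F D) :=
    finAlgPiHomeomorph F D 1 ⁻¹' Set.univ.pi fun _ => (intAdeles F : Set 𝔸ᶠ[F]) with hS
  have hScomp : IsCompact S :=
    (Homeomorph.isCompact_preimage _).mpr (isCompact_univ_pi fun _ => isCompact_intAdeles)
  have hSclosed : IsClosed S :=
    (isCompact_univ_pi fun _ => isCompact_intAdeles).isClosed.preimage (Homeomorph.continuous _)
  have hSopen : IsOpen S :=
    (isOpen_set_pi Set.finite_univ fun _ _ => isOpen_intAdeles).preimage (Homeomorph.continuous _)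
  have hmem : ∀ v : Fin 1 → AdelicAlg F D,
      (fun i => toFin F D (v i)) ∈ S ↔ v 0 ∈ intSubgroup F D 1 := by
    intro v
    rw [hS, Set.mem_preimage, Set.mem_univ_pi, ← one_smul ℕ (v 0), nsmul_mem_intSubgroup_one]
    simp only [finAlgPiHomeomorph_toFin, Nat.cast_one, one_mul, SetLike.mem_coe]
    exact ⟨fun h j => h (0, j), fun h p => by rw [Subsingleton.elim p.1 0]; exact h p.2⟩
  refine Submodule.subset_span ⟨fun x => g (infAlgCoord F D (x 0)), S.indicator 1, ?_, ?_, ?_, ?_⟩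
  · refine ⟨_, LinearEquiv.funUnique (Fin 1) ℝ (InfAlg F D) ≪≫ₗ infAlgCoord F D ≪≫ₗ
      toEuclidean.toLinearEquiv,
      SchwartzMap.compCLMOfContinuousLinearEquiv ℂ toEuclidean.symm g, fun x => ?_⟩
    have : toEuclidean.symm ((LinearEquiv.funUnique (Fin 1) ℝ (InfAlg F D) ≪≫ₗ infAlgCoord F D ≪≫ₗ
        toEuclidean.toLinearEquiv) x) = infAlgCoord F D (x 0) :=
      toEuclidean.symm_apply_apply _
    exact congrArg g this.symm
  · rw [IsLocallyConstant.iff_eventually_eq]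
    intro x
    by_cases hx : x ∈ S
    · filter_upwards [hSopen.mem_nhds hx] with y hy
      rw [Set.indicator_of_mem hy, Set.indicator_of_mem hx]; rfl
    · filter_upwards [hSclosed.isOpen_compl.mem_nhds hx] with y hy
      rw [Set.indicator_of_notMem hy, Set.indicator_of_notMem hx]
  · exact hScomp.of_isClosed_subset (isClosed_tsupport _)
      (closure_minimal Set.support_indicator_subset hSclosed)
  · funext v
    have hW : v 0 - (adelicLattice F D).diag 0 ∈ (adelicLattice F D).W 1 ↔
        (fun i => toFin F D (v i)) ∈ S := by
      rw [hmem, map_zero, sub_zero]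
      rfl
    by_cases hv : (fun i => toFin F D (v i)) ∈ S
    · rw [AdelicLattice.basic_of_mem _ (hW.mpr hv), Set.indicator_of_mem hv, Pi.one_apply, mul_one]
      exact congrArg g (infAlgCoord_toInf F D (v 0)).symm
    · rw [AdelicLattice.basic_of_notMem _ fun h => hv (hW.mp h), Set.indicator_of_notMem hv,
        mul_zero]

end SchwartzFunctions

section SelfDual

variable {F : Type*} [Field F] [NumberField F] {D : Type*} [DivisionRing D] [Algebra F D]
  [FiniteDimensional F D] {ψ : AddChar 𝔸[F] ℂ} (μ : Measure (AdelicAlg F D))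

lemma fourierEntry_one_eq_ft (hψ_cont : Continuous ψ)
    (hψ_inv : ∀ a : F, ψ (algebraMap F 𝔸[F] a) = 1) (hψ_ne : ψ ≠ 1) (f : (Fin 2 → AdelicAlg F D) → ℂ) (y : AdelicAlg F D) :
    fourierEntry ψ μ 1 f ![0, y] =
      AdelicLattice.ft μ (adelicDuality D ψ hψ_cont hψ_inv hψ_ne) (fun z => f ![0, z]) y := by
  have h : ∀ z, Function.update ![0, y] 1 z = ![0, z] := fun z => by
    funext i
    fin_cases i <;> simp
  simp only [fourierEntry, AdelicLattice.ft, h]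
  rfl

/-- For the self-dual measure, `D` has covolume one in `D_𝔸`. -/
theorem density_one_eq_one_of_isSelfDual (hψ_cont : Continuous ψ)
    (hψ_inv : ∀ a : F, ψ (algebraMap F 𝔸[F] a) = 1) (hψ_ne : ψ ≠ 1) [μ.IsAddHaarMeasure] (hμ : IsSelfDual ψ μ) :
    (adelicLattice F D).density μ 1 = 1 := by
  refine AdelicLattice.density_one_eq_one μ (adelicDuality D ψ hψ_cont hψ_inv hψ_ne) fun g y => ?_
  have h := hμ _ (basic_mem_schwartzSpace g) y
  refine Eq.trans h ?_
  rw [AdelicLattice.ft]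
  refine integral_congr_ae (Filter.Eventually.of_forall fun x => ?_)
  change _ = _ * ψ (adelicTrd F D (-y * x))
  rw [neg_mul, map_neg, adelicTrd_mul_comm F D y x]
  congr 1

end SelfDual

end NonabelianDelta
end

/-! ### Sums over D^×, estimates in q, and cancellation. -/

noncomputable section
namespace NonabelianDelta

section LatticeSums

variable {A D ι : Type*} [Ring A] [TopologicalSpace A] [DivisionRing D] [Fintype ι]
  {L : AdelicLattice A D ι} {m : ℕ}

/-- Values of a rapidly decaying function at scaled rational points are dominated by a summable
function, uniformly in the scaling. -/
lemma HasDecay.exists_summable_bound {f : (Fin m → A) → ℂ} (hf : HasDecay L f) (i : Fin m) {k : ℕ}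
    (hk : Fintype.card ι < k) : ∃ B : D → ℝ, Summable B ∧ ∀ q : ℝ, 0 < q → ∀ z δ, δ ≠ 0 →
      z i = L.scale q⁻¹ (L.diag δ) → ‖f z‖ ≤ q ^ k * B δ := by
  obtain ⟨K, hK, hsupp⟩ := hf.support
  obtain ⟨C, hC, hbound⟩ := hf.bound k
  have hKq : (K : ℚ) ≠ 0 := by exact_mod_cast hK.ne'
  have hKr : (K : ℝ) ≠ 0 := by exact_mod_cast hK.ne'
  set S : Set D := {δ | K • L.diag δ ∈ L.W 1} with hS
  set p : (ι → ℤ) → D := fun v => L.coord.symm fun j => (v j : ℚ) / K with hp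
  have hinj : Function.Injective p := fun v w h => by
    have h1 := L.coord.symm.injective h
    funext j
    have := (div_left_inj' hKq).mp (congrFun h1 j)
    exact_mod_cast this
  have hrange : ∀ δ ∈ S, δ ∈ Set.range p := fun δ hδ => by
    rw [hS, Set.mem_ofPred_eq, ← map_nsmul, L.diag_mem_W 1 one_pos] at hδ
    obtain ⟨v, hv⟩ := hδ
    refine ⟨v, ?_⟩
    rw [hp, AddEquiv.symm_apply_eq]
    funext j
    have := hv j
    rw [map_nsmul, Pi.smul_apply, nsmul_eq_mul, Nat.cast_one, one_mul] at this
    rw [← this]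
    field_simp
  have hpv : ∀ v, ratVec (L.coord (p v)) = (K : ℝ)⁻¹ • intVec v := fun v => by
    ext j
    simp [hp, div_eq_inv_mul]
  -- The support condition restricts δ to K⁻¹ℤ^ι independently of q, and dropping the 1 from 1 + ‖·‖
  -- pulls out the factor q^k.
  refine ⟨S.indicator fun δ => C * (‖ratVec (L.coord δ)‖ ^ k)⁻¹, ?_, fun q hq z δ hδ hz => ?_⟩
  · have hnn : ∀ δ, 0 ≤ S.indicator (fun δ => C * (‖ratVec (L.coord δ)‖ ^ k)⁻¹) δ := fun δ =>
      Set.indicator_nonneg (fun _ _ => by positivity) _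
    have hle : ∀ δ, S.indicator (fun δ => C * (‖ratVec (L.coord δ)‖ ^ k)⁻¹) δ ≤
        C * (‖ratVec (L.coord δ)‖ ^ k)⁻¹ := fun δ =>
      Set.indicator_le_self' (fun _ _ => by positivity) _
    rw [← hinj.summable_iff fun δ hδ => Set.indicator_of_notMem (fun h => hδ (hrange δ h)) _]
    refine Summable.of_nonneg_of_le (fun v => hnn (p v)) (fun v => (hle (p v)).trans (le_of_eq ?_))
      ((summable_norm_intVec_pow_inv hk).mul_left (C * (K : ℝ) ^ k))
    rw [hpv, norm_smul, mul_pow, norm_inv, inv_pow, mul_inv, inv_inv, RCLike.norm_natCast]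
    ring
  · by_cases h0 : f z = 0
    · rw [h0, norm_zero]
      exact mul_nonneg (by positivity) (Set.indicator_nonneg (fun _ _ => by positivity) _)
    · have hδS : δ ∈ S := by
        have h1 := hsupp z h0 i
        have h2 : K • L.scale q⁻¹ (L.diag δ) = L.s (K • (q⁻¹ • L.P (L.diag δ))) +
            (K • L.diag δ - L.s (K • L.P (L.diag δ))) := by
          rw [AdelicLattice.scale, AdelicLattice.fin_apply, smul_add, smul_sub, map_nsmul, map_nsmul]
        rw [hz, h2, sub_eq_add_neg, AddSubgroup.add_mem_cancel_left _ (L.s_mem_W 1 _),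
          AddSubgroup.add_mem_cancel_right _ (neg_mem (L.s_mem_W 1 _))] at h1
        exact h1
      have hpos : 0 < ‖ratVec (L.coord δ)‖ := norm_pos_iff.mpr fun h => hδ <| by
        rw [← ratVec_zero] at h
        exact (map_eq_zero_iff L.coord L.coord.injective).mp (ratVec_injective h)
      rw [Set.indicator_of_mem hδS]
      refine (hbound z i).trans ?_
      rw [hz, L.P_scale, L.P_diag, norm_smul, Real.norm_of_nonneg (inv_pos.mpr hq).le]
      calc _ ≤ C * ((q⁻¹ * ‖ratVec (L.coord δ)‖) ^ k)⁻¹ := by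
            gcongr
            linarith
        _ = _ := by
            rw [mul_pow, inv_pow, mul_inv, inv_inv]
            ring

lemma hasSum_units_iff {f : D → ℂ} (h0 : f 0 = 0) {S : ℂ} :
    HasSum (fun δ : Dˣ => f δ) S ↔ HasSum f S :=
  Units.val_injective.hasSum_iff (f := f) fun x hx => by
    by_cases h : x = 0
    · rw [h, h0]
    · exact absurd ⟨Units.mk0 x h, rfl⟩ hx

end LatticeSums

section RealEstimates

/-- A quantity which is bounded for `q ≤ 1` and decays faster than any power of `q` is bounded by any
nonpositive power of `q ^ n`. -/
lemma exists_rpow_bound {e : ℝ → ℝ} {n b₀ : ℕ} {C₀ : ℝ} (hsmall : ∀ q, 0 < q → q ≤ 1 → e q ≤ C₀)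
    (hlarge : ∀ b : ℕ, b₀ < b → ∃ C, ∀ q, 0 < q → e q ≤ C * (q ^ b)⁻¹) (N : ℝ) (hN : 0 ≤ N) :
    ∃ C, ∀ q, 0 < q → e q ≤ C * (q ^ n) ^ (-N) := by
  -- The exponent must exceed b₀ for `hlarge` to apply, and be at least nN to beat (q^n)^(-N) when q
  -- ≥ 1.
  obtain ⟨C, hC⟩ := hlarge (b₀ + 1 + ⌈n * N⌉₊) (by omega)
  refine ⟨max |C₀| |C|, fun q hq => ?_⟩
  rcases le_total q 1 with h | h
  · have h1 : 1 ≤ (q ^ n) ^ (-N) :=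
      Real.one_le_rpow_of_pos_of_le_one_of_nonpos (by positivity) (pow_le_one₀ hq.le h)
        (neg_nonpos.mpr hN)
    calc e q ≤ |C₀| := (hsmall q hq h).trans (le_abs_self _)
      _ ≤ max |C₀| |C| * 1 := by rw [mul_one]; exact le_max_left _ _
      _ ≤ _ := by gcongr
  · have h1 : (q ^ (b₀ + 1 + ⌈n * N⌉₊))⁻¹ ≤ (q ^ n) ^ (-N) := by
      rw [← Real.rpow_natCast q n, ← Real.rpow_mul hq.le, ← Real.rpow_natCast, ← Real.rpow_neg hq.le]
      refine Real.rpow_le_rpow_of_exponent_le h ?_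
      have := Nat.le_ceil (n * N)
      push_cast
      linarith
    calc e q ≤ C * (q ^ (b₀ + 1 + ⌈n * N⌉₊))⁻¹ := hC q hq
      _ ≤ max |C₀| |C| * (q ^ (b₀ + 1 + ⌈n * N⌉₊))⁻¹ := by
        gcongr
        exact (le_abs_self _).trans (le_max_right _ _)
      _ ≤ _ := by gcongr

/-- If `b` tends to `a ≠ 0` faster than any power of `X`, then `b` is eventually nonzero and `b⁻¹`
tends to `a⁻¹` faster than any power of `X`. -/
lemma exists_inv_rpow_bound {T : Type*} {b : T → ℂ} {X : T → ℝ} {a : ℂ} (ha : a ≠ 0)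
    (hX : ∀ t, 0 < X t) (h : ∀ N : ℝ, 0 ≤ N → ∃ C, ∀ t, ‖b t - a‖ ≤ C * X t ^ (-N)) :
    ∃ R : ℝ, (∀ t, R ≤ X t → b t ≠ 0) ∧
      ∀ N : ℝ, 0 ≤ N → ∃ C, ∀ t, R ≤ X t → ‖(b t)⁻¹ - 1 / a‖ ≤ C * X t ^ (-N) := by
  have ha' : 0 < ‖a‖ := norm_pos_iff.mpr ha
  obtain ⟨C, hC⟩ := h 1 zero_le_one
  -- The case N = 1 already keeps b within ‖a‖/2 of a for large X, which fixes one R for all N.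
  have hhalf : ∀ t, 2 * |C| / ‖a‖ + 1 ≤ X t → ‖a‖ / 2 ≤ ‖b t‖ := fun t ht => by
    have h1 := hC t
    rw [Real.rpow_neg_one] at h1
    have h2 : C * (X t)⁻¹ ≤ ‖a‖ / 2 := by
      rw [← div_eq_mul_inv, div_le_iff₀ (hX t)]
      have h3 : 2 * |C| ≤ X t * ‖a‖ := by
        rw [← div_le_iff₀ ha']
        linarith
      linarith [le_abs_self C]
    have h4 := norm_sub_norm_le a (b t)
    rw [norm_sub_rev] at h4
    linarith
  refine ⟨2 * |C| / ‖a‖ + 1, fun t ht h0 => ?_, fun N hN => ?_⟩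
  · have := hhalf t ht
    rw [h0, norm_zero] at this
    linarith
  · obtain ⟨C', hC'⟩ := h N hN
    refine ⟨2 / ‖a‖ ^ 2 * C', fun t ht => ?_⟩
    have hb := hhalf t ht
    have hb0 : b t ≠ 0 := fun h0 => by
      rw [h0, norm_zero] at hb
      linarith
    have h1 : (b t)⁻¹ - 1 / a = -(b t - a) * ((b t)⁻¹ * a⁻¹) := by
      field_simp
      ring
    rw [h1, norm_mul, norm_neg, norm_mul, norm_inv, norm_inv]
    have h2 : ‖b t‖⁻¹ ≤ 2 / ‖a‖ := by
      rw [← inv_div]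
      exact inv_anti₀ (by positivity) hb
    calc _ ≤ ‖b t - a‖ * (2 / ‖a‖ * ‖a‖⁻¹) := by gcongr
      _ ≤ C' * X t ^ (-N) * (2 / ‖a‖ * ‖a‖⁻¹) := by gcongr; exact hC' t
      _ = _ := by field_simp

end RealEstimates

section DeltaSums

variable {F : Type*} [Field F] [NumberField F] {D : Type*} [DivisionRing D] [Algebra F D]
  [FiniteDimensional F D] {Φ : (Fin 2 → AdelicAlg F D) → ℂ}

lemma deltaTerm_eq (q : ℝ) (α : D) (δ : Dˣ) : deltaTerm F Φ q α δ =
    Φ ![(adelicLattice F D).scale q⁻¹ ((adelicLattice F D).diag (α * (δ : D)⁻¹)),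
      (adelicLattice F D).scale q⁻¹ ((adelicLattice F D).diag δ)] -
    Φ ![(adelicLattice F D).scale q⁻¹ ((adelicLattice F D).diag δ),
      (adelicLattice F D).scale q⁻¹ ((adelicLattice F D).diag ((δ : D)⁻¹ * α))] := by
  rw [deltaTerm, realIdele_smul, realIdele_smul, realIdele_smul]
  rfl

/-- Decay in a single entry suffices, so the other entry may depend on δ in any way. -/
lemma summable_scale_units (hΦ : HasDecay (adelicLattice F D) Φ) {q : ℝ} (hq : 0 < q) (i : Fin 2)
    (z : Dˣ → Fin 2 → AdelicAlg F D)
    (hz : ∀ δ, z δ i = (adelicLattice F D).scale q⁻¹ ((adelicLattice F D).diag (δ : D))) :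
    Summable fun δ => Φ (z δ) := by
  obtain ⟨B, hB, hbound⟩ := hΦ.exists_summable_bound i (Nat.lt_succ_self _)
  exact Summable.of_norm_bounded ((hB.comp_injective Units.val_injective).mul_left _)
    fun δ => hbound q hq (z δ) δ δ.ne_zero (hz δ)

lemma summable_deltaTerm (hΦ : HasDecay (adelicLattice F D) Φ) {q : ℝ} (hq : 0 < q) (α : D) :
    Summable (deltaTerm F Φ q α) := by
  rw [show deltaTerm F Φ q α = _ from funext fun δ => deltaTerm_eq q α δ]
  exact (summable_scale_units hΦ hq 1 _ fun δ => rfl).sub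
    (summable_scale_units hΦ hq 0 _ fun δ => rfl)

/-- Both halves converge absolutely. Replacing δ by δ⁻¹α in the first gives α(δ⁻¹α)⁻¹ = δ, hence the
second; the order of the factors matters as D need not be commutative. -/
lemma tsum_deltaTerm_of_ne_zero (hΦ : HasDecay (adelicLattice F D) Φ) {q : ℝ} (hq : 0 < q) {α : D}
    (hα : α ≠ 0) : ∑' δ, deltaTerm F Φ q α δ = 0 := by
  rw [show deltaTerm F Φ q α = _ from funext fun δ => deltaTerm_eq q α δ]
  rw [(summable_scale_units hΦ hq 1 _ fun δ => rfl).tsum_sub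
    (summable_scale_units hΦ hq 0 _ fun δ => rfl), sub_eq_zero]
  rw [← ((Equiv.inv Dˣ).trans (Equiv.mulRight (Units.mk0 α hα))).tsum_eq]
  refine tsum_congr fun δ => ?_
  have h1 : ((((Equiv.inv Dˣ).trans (Equiv.mulRight (Units.mk0 α hα))) δ : Dˣ) : D) =
      (δ : D)⁻¹ * α := by simp
  rw [h1, mul_inv_rev, inv_inv, mul_inv_cancel_left₀ hα]

lemma hasSum_deltaTerm_zero (hΦ_zero : ∀ t, Φ ![t, 0] = 0) {q : ℝ} {S : ℂ}
    (hS : HasSum (fun δ : D => Φ ![0, (adelicLattice F D).scale q⁻¹ ((adelicLattice F D).diag δ)]) S) :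
    HasSum (deltaTerm F Φ q 0) S := by
  have h := (hasSum_units_iff (by rw [map_zero, AdelicLattice.scale_zero, hΦ_zero])).mpr hS
  convert h using 1
  funext δ
  rw [deltaTerm_eq, zero_mul, mul_zero, map_zero, AdelicLattice.scale_zero, hΦ_zero, sub_zero]

end DeltaSums

end NonabelianDelta
end

/-! ### The theorem. -/

open NonabelianDelta in
theorem lemma3p1 (F : Type*) [Field F] [NumberField F]
    (D : Type*) [DivisionRing D] [Algebra F D] [FiniteDimensional F D] [Algebra.IsCentral F D]
    (ψ : AddChar 𝔸[F] ℂ) (hψ_cont : Continuous ψ)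
    (hψ_inv : ∀ a : F, ψ (algebraMap F 𝔸[F] a) = 1) (hψ_ne : ψ ≠ 1)
    (μ : MeasureTheory.Measure (AdelicAlg F D)) [μ.IsAddHaarMeasure] (hμ : IsSelfDual ψ μ)
    (Φ : (Fin 2 → AdelicAlg F D) → ℂ) (hΦ : Φ ∈ schwartzSpace F D 2)
    (hΦ_zero : ∀ t : AdelicAlg F D, Φ ![t, 0] = 0)
    (hΦ_ne : fourierEntry ψ μ 1 Φ ![0, 0] ≠ 0) :
    -- the expansion for every `Q`, with absolutely convergent sums
    (∀ q : ℝ, 0 < q →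
      Summable (bTerm ψ μ Φ q) ∧
      ∀ α : D, Summable (deltaTerm F Φ q α) ∧
        bCoeff ψ μ Φ q * deltaSymbol α =
          1 / (ideleNorm F q : ℂ) ^ Module.finrank F D * ∑' δ : Dˣ, deltaTerm F Φ q α δ) ∧
    -- the size of `b_{Φ,Q}`
    (∀ N : ℝ, 0 ≤ N → ∃ C : ℝ, ∀ q : ℝ, 0 < q →
      ‖bCoeff ψ μ Φ q - fourierEntry ψ μ 1 Φ ![0, 0]‖ ≤ C * ideleNorm F q ^ (-N)) ∧
    -- the expansion for `|Q|` sufficiently large, with `c_{Φ,Q} = b_{Φ,Q}⁻¹`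
    (∃ R : ℝ,
      (∀ q : ℝ, 0 < q → R ≤ ideleNorm F q →
        bCoeff ψ μ Φ q ≠ 0 ∧
        ∀ α : D, deltaSymbol α =
          (bCoeff ψ μ Φ q)⁻¹ / (ideleNorm F q : ℂ) ^ Module.finrank F D *
            ∑' δ : Dˣ, deltaTerm F Φ q α δ) ∧
      ∀ N : ℝ, 0 ≤ N → ∃ C : ℝ, ∀ q : ℝ, 0 < q → R ≤ ideleNorm F q →
        ‖(bCoeff ψ μ Φ q)⁻¹ - 1 / fourierEntry ψ μ 1 Φ ![0, 0]‖ ≤ C * ideleNorm F q ^ (-N)) := by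
  set X := adelicDuality D ψ hψ_cont hψ_inv hψ_ne
  have hft : ∀ y, fourierEntry ψ μ 1 Φ ![0, y] = AdelicLattice.ft μ X (fun z => Φ ![0, z]) y :=
    fourierEntry_one_eq_ft μ hψ_cont hψ_inv hψ_ne Φ
  have hdecay : HasDecay (adelicLattice F D) Φ := hasDecay_of_mem_schwartzSpace hΦ
  have hpoisson := AdelicLattice.satisfiesPoisson_of_mem_basicSpan μ X (cons_zero_mem_basicSpan hΦ)
  rw [density_one_eq_one_of_isSelfDual μ hψ_cont hψ_inv hψ_ne hμ] at hpoisson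
  have hbTerm : ∀ q, bTerm ψ μ Φ q = fun δ => AdelicLattice.ft μ X (fun z => Φ ![0, z])
      ((adelicLattice F D).scale q ((adelicLattice F D).diag δ)) := fun q => by
    funext δ
    rw [bTerm, hft, realIdele_smul]
    rfl
  have hcard : Fintype.card (CoordIndex F D) = Fintype.card (IntIndex F) * Module.finrank F D := by
    rw [Fintype.card_prod, Fintype.card_fin]
  have hnorm : ∀ q, 0 < q → (1 : ℂ) / (ideleNorm F q : ℂ) ^ Module.finrank F D =
      (q⁻¹ : ℂ) ^ Fintype.card (CoordIndex F D) := fun q hq => by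
    rw [ideleNorm_eq F hq, hcard, Complex.ofReal_pow, ← pow_mul, one_div, inv_pow]
  have hexp : ∀ q : ℝ, 0 < q → ∀ α : D, bCoeff ψ μ Φ q * deltaSymbol α =
      1 / (ideleNorm F q : ℂ) ^ Module.finrank F D * ∑' δ : Dˣ, deltaTerm F Φ q α δ := by
    intro q hq α
    by_cases hα : α = 0
    · obtain ⟨S, hS, hS'⟩ := hpoisson.hasSum q hq
      rw [hα, deltaSymbol, if_pos rfl, mul_one, (hasSum_deltaTerm_zero hΦ_zero hS).tsum_eq, hnorm q hq,
        bCoeff, hbTerm, hS'.tsum_eq, Complex.ofReal_one, one_mul]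
    · rw [deltaSymbol, if_neg hα, mul_zero, tsum_deltaTerm_of_ne_zero hdecay hq hα, mul_zero]
  have hsize : ∀ N : ℝ, 0 ≤ N → ∃ C : ℝ, ∀ q : ℝ, 0 < q →
      ‖bCoeff ψ μ Φ q - fourierEntry ψ μ 1 Φ ![0, 0]‖ ≤ C * ideleNorm F q ^ (-N) := by
    intro N hN
    obtain ⟨B, hB, hbound⟩ := hdecay.exists_summable_bound 1 (Nat.lt_succ_self _)
    -- The frequency-side bound blows up as q → 0. On the other side the prefactor is q^{-n} with n
    -- the real dimension of D_∞, and the decay bound with exponent n + 1 leaves a factor q ≤ 1. The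
    -- term δ = 0, which that bound does not cover, is zero.
    have hsmall : ∀ q, 0 < q → q ≤ 1 → ‖bCoeff ψ μ Φ q - fourierEntry ψ μ 1 Φ ![0, 0]‖ ≤
        ‖∑' δ : Dˣ, B δ‖ + ‖fourierEntry ψ μ 1 Φ ![0, 0]‖ := by
      intro q hq hq1
      refine (norm_sub_le _ _).trans (add_le_add_left ?_ _)
      obtain ⟨S, hS, hS'⟩ := hpoisson.hasSum q hq
      have hSu := (hasSum_units_iff
        (by rw [map_zero, AdelicLattice.scale_zero, hΦ_zero])).mpr hS
      have hBu : Summable fun δ : Dˣ => B δ := hB.comp_injective Units.val_injective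
      have hle := tsum_of_norm_bounded (hBu.hasSum.mul_left (q ^ (Fintype.card (CoordIndex F D) + 1)))
        fun δ : Dˣ => hbound q hq ![0, (adelicLattice F D).scale q⁻¹ ((adelicLattice F D).diag (δ : D))]
          δ δ.ne_zero rfl
      rw [hSu.tsum_eq] at hle
      rw [bCoeff, hbTerm, hS'.tsum_eq, Complex.ofReal_one, one_mul, norm_mul, norm_pow, norm_inv,
        Complex.norm_real, Real.norm_of_nonneg hq.le]
      calc _ ≤ q⁻¹ ^ Fintype.card (CoordIndex F D) *
            (q ^ (Fintype.card (CoordIndex F D) + 1) * ∑' δ : Dˣ, B δ) := by gcongr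
        _ = q * ∑' δ : Dˣ, B δ := by
            rw [pow_succ, inv_pow]
            field_simp
        _ ≤ 1 * ‖∑' δ : Dˣ, B δ‖ := by
            refine (mul_le_mul_of_nonneg_left (Real.le_norm_self _) hq.le).trans ?_
            gcongr
        _ = _ := one_mul _
    obtain ⟨C, hC⟩ := exists_rpow_bound (n := Fintype.card (IntIndex F)) hsmall (fun b hb => by
      obtain ⟨C, hC⟩ := hpoisson.decay b hb
      refine ⟨C, fun q hq => ?_⟩
      rw [hft, bCoeff, hbTerm]
      exact hC q hq) N hN
    exact ⟨C, fun q hq => by rw [ideleNorm_eq F hq]; exact hC q hq⟩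
  refine ⟨fun q hq => ⟨?_, fun α => ⟨summable_deltaTerm hdecay hq α, hexp q hq α⟩⟩, hsize, ?_⟩
  · obtain ⟨S, -, hS'⟩ := hpoisson.hasSum q hq
    rw [hbTerm]
    exact hS'.summable
  · obtain ⟨R, hR, hinv⟩ := exists_inv_rpow_bound
      (b := fun q : {q : ℝ // 0 < q} => bCoeff ψ μ Φ q)
      (X := fun q : {q : ℝ // 0 < q} => ideleNorm F q) hΦ_ne
      (fun q => by rw [ideleNorm_eq F q.2]; exact pow_pos q.2 _)
      (fun N hN => (hsize N hN).imp fun C hC q => hC q q.2)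
    refine ⟨R, fun q hq hqR => ⟨hR ⟨q, hq⟩ hqR, fun α => ?_⟩,
      fun N hN => (hinv N hN).imp fun C hC q hq hqR => hC ⟨q, hq⟩ hqR⟩
    rw [← one_div_mul_eq_div, mul_comm (1 / _), mul_assoc, ← hexp q hq α,
      inv_mul_cancel_left₀ (hR ⟨q, hq⟩ hqR)]
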